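/- **Theorem (digital quantum simulation of the time-dependent Dirac equation with the $2k$-th order product formula).** Let $\alpha^i=\sigma^1\otimes\sigma^i$ $(i=1,2,3)$ and $\beta=\sigma^3\otimes \mathbb 1_2$ be the Dirac matrices, and consider on the periodic cell $[-\Omega/2,\Omega/2)^3$ of side $\Omega>0$ the equation $i\,\partial_t\psi=H\psi$ with $$H=\boldsymbol\alpha\cdot(-i\nabla+e\boldsymbol A)+\beta m-e\phi ,$$ where $m,e\in\mathbb R$ and the real potentials $\phi$ and $\boldsymbol A=(A_1,A_2,A_3)$ are time-independent, continuous and $\Omega$-periodic; put $\|\phi\|_{\max}=\sup_x|\phi(x)|$, $\|\boldsymbol A\|_{\max}=\sup_x|\boldsymbol A(x)|$ (Euclidean length). *Discretization.* For $n=2^q$ let the register consist of two spinor qubits and $q$ qubits for each coordinate; its basis states are labelled by a spinor index $a$ and $p\in([-n/2,n/2)\cap\mathbb Z)^3$. A spinor field $f$ is encoded by the amplitudes $(\Omega/n)^{3/2}f_a(r_p)$, $r_p=p\,\Omega/n$, and a register state $v$ represents the spinor field $x\mapsto\Omega^{-3/2}\sum_p (\mathcal F v)_{p}\,e^{ik_p\cdot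 x}$, $k_p=2\pi p/\Omega$, where $\mathcal F$ is the unitary discrete Fourier transform in position. On the register let $$H_1=\mathcal F^\dagger\,(\boldsymbol\alpha\cdot k_p)\,\mathcal F,\qquad H_2=\beta m,\qquad H_3=-e\,\phi(r_p),\qquad H_4=e\,\boldsymbol\alpha\cdot\boldsymbol A(r_p).$$ *Product formula.* Let $U_2(t)=e^{-i\frac t2H_1}e^{-i\frac t2H_2}e^{-i\frac t2H_3}e^{-i\frac t2H_4}\,e^{-i\frac t2H_4}e^{-i\frac t2H_3}e^{-i\frac t2H_2}e^{-i\frac t2H_1}$ and, for $k\ge2$, $U_{2k}(t)=U_{2k-2}(u_kt)^2\,U_{2k-2}((1-4u_k)t)\,U_{2k-2}(u_kt)^2$ with $u_k=1/(4-4^{1/(2k-1)})$. *Solutions.* For $\rho>0$ and $M$, let $\mathcal S_{\rho,M}(T)$ be the set of solutions $\psi$ of the Dirac equation for all times between $0$ and $T$ with $\|\psi(0)\|_{L^2(\mathrm{cell})}=1$ which are spatially differentiable, periodic and analytic uniformly in time: at each such time $\psi(t,x)=\sum_{p\in\mathbb Z^3}c_p(t)e^{2\pi i p\cdot x/\Omega}$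 with all four components of $c_p(t)$ bounded by $Me^{-\rho(|p_1|+|p_2|+|p_3|)}$. *Claim.* Fix $\Omega,\rho,\kappa>0$ and $m,e,M\in\mathbb R$. There are $C>0$ and $a\in\mathbb N$, depending only on these six numbers, such that the following holds for all $\phi,\boldsymbol A$ as above with $V:=\|\phi\|_{\max}+\|\boldsymbol A\|_{\max}\ge\kappa$, all integers $k\ge1$, all $T\in\mathbb R$ with $|T|\ge\kappa$ and all $0<\varepsilon\le1/\kappa$. There are $q\ge0$, $r\ge1$ and circuits $W_j(s)$ $(j=1,\dots,4,\ s\in\mathbb R)$ of one-qubit and two-qubit gates on the register such that 1. $n=2^q\le C\log(2+|T|/\varepsilon)$; 2. $W_j(s)$ implements $e^{-isH_j}$ and has at most $C\log^a(2+|T|/\varepsilon)$ gates; $W_2(s)$ has at most one gate; 3. the circuit $\mathcal C$ obtained from the product formula $[U_{2k}(T/r)]^r$ by replacing each factor $e^{-isH_j}$ by $W_j(s)$ has at most $C\,g\,\log^a(2+g)$ gates, where $$g=5^{2k}\,\frac{(\|\phi\|_{\max}+\|\boldsymbol A\|_{\max})^{1+1/2k}\,|T|^{1+1/2k}}{\varepsilon^{1/2k}}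 ,$$ that is, its gate complexity is $\widetilde{\mathcal O}(g)$; 4. the operator of $\mathcal C$ is within $\varepsilon$, in operator norm, of $e^{-iT(H_1+H_2+H_3+H_4)}$; 5. for every $\psi\in\mathcal S_{\rho,M}(T)$, applying $\mathcal C$ to the normalized encoding of $\psi(0)$ gives a normalized state whose $\ell^2$-distance to the encoding of $\psi(T)$ is at most $\varepsilon$, and the spinor field that it represents is within $\varepsilon$ of $\psi(T)$ in $L^2(\mathrm{cell})$. -/

import Mathlib

open Complex

noncomputable section

namespace DiracSim

/-! ## The Dirac equation in a periodic box -/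

/-- Points of space. -/
abbrev Space : Type := Fin 3 → ℝ

/-- Spinor labels: `ℂ⁴ = ℂ² ⊗ ℂ²`, the first factor separates large and small components. -/
abbrev SpinIdx : Type := Fin 2 × Fin 2

/-- The Pauli matrices `σ¹, σ², σ³` (indexed by `0, 1, 2`). -/
def pauli : Fin 3 → Matrix (Fin 2) (Fin 2) ℂ :=
  ![!![0, 1; 1, 0], !![0, -I; I, 0], !![1, 0; 0, -1]]

/-- `αⁱ = σ¹ ⊗ σⁱ`. -/
def diracAlpha (i : Fin 3) : Matrix SpinIdx SpinIdx ℂ :=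
  Matrix.kroneckerMap (fun x y => x * y) (pauli 0) (pauli i)

/-- `β = σ³ ⊗ 1`. -/
def diracBeta : Matrix SpinIdx SpinIdx ℂ :=
  Matrix.kroneckerMap (fun x y => x * y) (pauli 2) (1 : Matrix (Fin 2) (Fin 2) ℂ)

/-- The Dirac Hamiltonian `H = α · (-i∇ + e A) + β m - e φ` applied to a spinor field. -/
def diracHamiltonian (m e : ℝ) (φ : Space → ℝ) (A : Space → Fin 3 → ℝ)
    (ψ : Space → SpinIdx → ℂ) (x : Space) : SpinIdx → ℂ :=
  (∑ i, (diracAlpha i).mulVec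
      ((-I) • fderiv ℝ ψ x (Pi.single i 1) + ((e * A x i : ℝ) : ℂ) • ψ x))
    + (m : ℂ) • diracBeta.mulVec (ψ x) - ((e * φ x : ℝ) : ℂ) • ψ x

/-- The cubic cell of side length `Ω`, centred at the origin. -/
def cell (Ω : ℝ) : Set Space :=
  Set.univ.pi fun _ => Set.Ico (-(Ω / 2)) (Ω / 2)

/-- The plane wave `exp (i k_p · x)` with wave vector `k_p = 2π p / Ω`. -/
def planeWave (Ω : ℝ) (p : Fin 3 → ℤ) (x : Space) : ℂ :=
  exp (I * ((∑ i, 2 * Real.pi * (p i : ℝ) / Ω * x i : ℝ) : ℂ))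

/-- The `L²` norm over the cell of a spinor field. -/
def cellNorm (Ω : ℝ) (f : Space → SpinIdx → ℂ) : ℝ :=
  Real.sqrt (∫ x in cell Ω, ∑ a, ‖f x a‖ ^ 2)

/-- `f` is a real-analytic `Ω`-periodic spinor field whose Fourier coefficients decay
exponentially with rate `ρ` and constant `M`. -/
def AnalyticPeriodic (Ω ρ M : ℝ) (f : Space → SpinIdx → ℂ) : Prop :=
  ∃ c : (Fin 3 → ℤ) → SpinIdx → ℂ,
    (∀ p a, ‖c p a‖ ≤ M * Real.exp (-(ρ * ∑ i, |(p i : ℝ)|))) ∧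
    ∀ x, HasSum (fun p => planeWave Ω p x • c p) (f x)

/-- `ψ` is a normalized solution of `i ∂ψ/∂t = H ψ` for times between `0` and `T`, in the periodic
cell of side `Ω`, spatially analytic at these times with constants `ρ, M`. -/
structure IsDiracSolution (Ω m e : ℝ) (φ : Space → ℝ) (A : Space → Fin 3 → ℝ) (ρ M T : ℝ)
    (ψ : ℝ → Space → SpinIdx → ℂ) : Prop where
  analytic : ∀ t ∈ Set.uIcc 0 T, AnalyticPeriodic Ω ρ M (ψ t)
  differentiable : ∀ t ∈ Set.uIcc 0 T, Differentiable ℝ (ψ t)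
  equation : ∀ t ∈ Set.uIcc 0 T, ∀ x,
    HasDerivWithinAt (fun s => ψ s x) ((-I) • diracHamiltonian m e φ A (ψ t) x)
      (Set.uIcc 0 T) t
  normalized : cellNorm Ω (ψ 0) = 1

/-- `Ω`-periodicity in each coordinate. -/
def Periodic3 {β : Type} (Ω : ℝ) (f : Space → β) : Prop :=
  ∀ (x : Space) (i : Fin 3), f (x + Pi.single i Ω) = f x

/-- `‖φ‖_max`. -/
def scalarMax (φ : Space → ℝ) : ℝ := ⨆ x, |φ x|

/-- `‖A‖_max`, the maximal Euclidean length of the vector potential. -/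
def vectorMax (A : Space → Fin 3 → ℝ) : ℝ := ⨆ x, Real.sqrt (∑ i, A x i ^ 2)

/-! ## Registers, gates and circuits -/

/-- Two spinor qubits, and `q` qubits for each of the three coordinates (`n = 2 ^ q`). -/
abbrev Qubit (q : ℕ) : Type := Fin 2 ⊕ (Fin 3 × Fin q)

/-- Computational basis labels. -/
abbrev Reg (q : ℕ) : Type := Qubit q → Fin 2

/-- Pure (not necessarily normalized) states of the register. -/
abbrev QState (q : ℕ) : Type := EuclideanSpace ℂ (Reg q)

/-- The action of a matrix on a state. -/
def act {q : ℕ} (U : Matrix (Reg q) (Reg q) ℂ) (v : QState q) : QState q :=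
  WithLp.toLp 2 (U.mulVec v.ofLp)

/-- One-qubit and two-qubit gates. -/
inductive Gate (q : ℕ) : Type
  | one (i : Qubit q) (U : Matrix.unitaryGroup (Fin 2) ℂ) : Gate q
  | two (i j : Qubit q) (hij : i ≠ j) (U : Matrix.unitaryGroup (Fin 2 × Fin 2) ℂ) : Gate q

open Classical in
/-- The matrix of a gate on the whole register (identity on the other qubits). -/
def Gate.matrix {q : ℕ} : Gate q → Matrix (Reg q) (Reg q) ℂ
  | .one i U => fun b b' =>
      if ∀ l, l ≠ i → b l = b' l then (U : Matrix (Fin 2) (Fin 2) ℂ) (b i) (b' i) else 0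
  | .two i j _ U => fun b b' =>
      if ∀ l, l ≠ i → l ≠ j → b l = b' l then
        (U : Matrix (Fin 2 × Fin 2) (Fin 2 × Fin 2) ℂ) (b i, b j) (b' i, b' j) else 0

/-- A circuit is a word of gates; the rightmost gate acts first. Its gate count is
`FreeMonoid.length`. -/
abbrev Circuit (q : ℕ) : Type := FreeMonoid (Gate q)

/-- The unitary matrix of a circuit. -/
def circuitMatrix {q : ℕ} (c : Circuit q) : Matrix (Reg q) (Reg q) ℂ :=
  FreeMonoid.lift Gate.matrix c

/-! ## Space discretization -/

/-- The spinor label stored in a basis state. -/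
def spin {q : ℕ} (b : Reg q) : SpinIdx := (b (Sum.inl 0), b (Sum.inl 1))

/-- The integers `p ∈ [-n/2, n/2)³` stored in a basis state. -/
def gridIdx {q : ℕ} (b : Reg q) (i : Fin 3) : ℤ :=
  (∑ j : Fin q, ((b (Sum.inr (i, j)) : ℕ) : ℤ) * 2 ^ (j : ℕ)) - ((2 ^ q / 2 : ℕ) : ℤ)

/-- The position grid point `r_p = p Ω / n`. -/
def node (Ω : ℝ) {q : ℕ} (b : Reg q) : Space :=
  fun i => (gridIdx b i : ℝ) * Ω / 2 ^ q

/-- The momentum grid point `k_p = 2π p / Ω`. -/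
def waveVec (Ω : ℝ) {q : ℕ} (b : Reg q) (i : Fin 3) : ℝ :=
  2 * Real.pi * (gridIdx b i : ℝ) / Ω

/-- The three-dimensional discrete Fourier transform from the position grid (columns) to the
momentum grid (rows), acting trivially on the spinor. -/
def fourierMatrix (q : ℕ) : Matrix (Reg q) (Reg q) ℂ := fun b b' =>
  if spin b = spin b' then
    ((((Real.sqrt (2 ^ q)) ^ 3)⁻¹ : ℝ) : ℂ) *
      exp (-(I * ((2 * Real.pi * (∑ i, (gridIdx b i : ℝ) * (gridIdx b' i : ℝ)) / 2 ^ q : ℝ) : ℂ)))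
  else 0

/-- A position- (or momentum-) dependent matrix acting on the spinor. -/
def localMatrix {q : ℕ} (D : Reg q → Matrix SpinIdx SpinIdx ℂ) : Matrix (Reg q) (Reg q) ℂ :=
  fun b b' => if gridIdx b = gridIdx b' then D b (spin b) (spin b') else 0

/-- The four parts of the Dirac Hamiltonian on the grid: the kinetic term
`H₁ = -i α · ∇` (diagonal in momentum), the mass term `H₂ = β m`, the scalar potential
`H₃ = -e φ` and the vector potential `H₄ = e α · A`. -/
def hamTerm (Ω m e : ℝ) (φ : Space → ℝ) (A : Space → Fin 3 → ℝ) (q : ℕ) :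
    Fin 4 → Matrix (Reg q) (Reg q) ℂ :=
  ![(fourierMatrix q).conjTranspose *
      localMatrix (fun b => ∑ i, (waveVec Ω b i : ℂ) • diracAlpha i) * fourierMatrix q,
    localMatrix (fun _ => (m : ℂ) • diracBeta),
    localMatrix (fun b => ((-(e * φ (node Ω b)) : ℝ) : ℂ) • 1),
    localMatrix (fun b => ∑ i, ((e * A (node Ω b) i : ℝ) : ℂ) • diracAlpha i)]

/-- `exp (-i t H)` for a matrix `H`. -/
def propagator {q : ℕ} (H : Matrix (Reg q) (Reg q) ℂ) (t : ℝ) : Matrix (Reg q) (Reg q) ℂ :=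
  NormedSpace.exp ((-(I * (t : ℂ))) • H)

/-- The amplitudes `(Ω / n)^{3/2} ψ(r_p)` that encode a spinor field on the register. -/
def sampleState (Ω : ℝ) (q : ℕ) (f : Space → SpinIdx → ℂ) : QState q :=
  WithLp.toLp 2 fun b => (((Real.sqrt (Ω / 2 ^ q)) ^ 3 : ℝ) : ℂ) * f (node Ω b) (spin b)

/-- The normalized register state that encodes a spinor field. -/
def initialState (Ω : ℝ) (q : ℕ) (f : Space → SpinIdx → ℂ) : QState q :=
  ((‖sampleState Ω q f‖⁻¹ : ℝ) : ℂ) • sampleState Ω q f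

open Classical in
/-- The spinor field represented by a register state: the trigonometric polynomial with wave
vectors on the momentum grid that takes the values `(n / Ω)^{3/2} v_p` at the grid points. -/
def interpolant (Ω : ℝ) {q : ℕ} (v : QState q) (x : Space) : SpinIdx → ℂ := fun a =>
  ((((Real.sqrt Ω) ^ 3)⁻¹ : ℝ) : ℂ) *
    ∑ b : Reg q, if spin b = a then (act (fourierMatrix q) v) b * planeWave Ω (gridIdx b) x else 0

/-! ## Product formulas -/

/-- Suzuki's coefficient `u_k = 1 / (4 - 4^{1/(2k-1)})`. -/
def suzukiCoeff (k : ℕ) : ℝ := 1 / (4 - (4 : ℝ) ^ (1 / (2 * (k : ℝ) - 1)))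

/-- The product formula `U_{2k}(t)` (with `k` as the natural-number argument) built from
`E j t`, which stands for `exp (-i t H_j)`. It is defined in any monoid, so that it makes sense both
for matrices and for circuits. -/
def suzuki {G : Type} [Monoid G] (E : Fin 4 → ℝ → G) : ℕ → ℝ → G
  | 0, _ => 1
  | 1, t => E 0 (t / 2) * E 1 (t / 2) * E 2 (t / 2) * E 3 (t / 2) *
      (E 3 (t / 2) * E 2 (t / 2) * E 1 (t / 2) * E 0 (t / 2))
  | k + 2, t =>
      suzuki E (k + 1) (suzukiCoeff (k + 2) * t) ^ 2 *
        suzuki E (k + 1) ((1 - 4 * suzukiCoeff (k + 2)) * t) *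
        suzuki E (k + 1) (suzukiCoeff (k + 2) * t) ^ 2

/-- `g = 5^{2k} V^{1+1/2k} |T|^{1+1/2k} / ε^{1/2k}`. -/
def costScale (k : ℕ) (V T ε : ℝ) : ℝ :=
  5 ^ (2 * k) * V ^ (1 + 1 / (2 * (k : ℝ))) * |T| ^ (1 + 1 / (2 * (k : ℝ))) /
    ε ^ (1 / (2 * (k : ℝ)))

end DiracSim

end

/-!
For a spatially analytic solution, sampling on `n` points per direction commits an error of order
`exp (-ρ n / 4)`: the register reproduces every plane wave with momentum on the grid exactly, and
the unresolved ones have exponentially small coefficients. Duhamel's formula turns this consistency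
error into an evolution error that grows linearly in time, so `n = O(log (|T| / ε))` suffices.
With so few grid points the register has dimension `4 n³`, polylogarithmic in `|T| / ε`, so that
even exact synthesis of an arbitrary unitary costs only polylogarithmically many gates. The total
norm of the four terms is `O(n + |m| + |e| V)`.

The order of the product formula is seen on formal power series in the step size. The series of
`U_{2k}` and of the exact exponential both satisfy `p(X) p(-X) = 1`, so their first disagreement has
odd degree, and Suzuki's coefficient is chosen to cancel it. All series involved are dominated
coefficientwise by the exponential series of `3^{k-1} |t| ∑ⱼ ‖Hⱼ‖`, which turns agreement up to
degree `2k` into an error bound with explicit constants.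
-/

noncomputable section

namespace DiracSim

/-! ## Product formulas -/

section ProductFormula

variable {G G' : Type} [Monoid G] [Monoid G']

theorem map_suzuki {F : Type*} [FunLike F G G'] [MonoidHomClass F G G'] (f : F)
    (E : Fin 4 → ℝ → G) (k : ℕ) (t : ℝ) :
    f (suzuki E k t) = suzuki (fun j s => f (E j s)) k t := by
  fun_induction suzuki E k t <;> simp_all [suzuki]

theorem suzuki_comp_mul (E : Fin 4 → ℝ → G) (s : ℝ) (k : ℕ) (t : ℝ) :
    suzuki (fun j x => E j (s * x)) k t = suzuki E k (s * t) := by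
  fun_induction suzuki (fun j x => E j (s * x)) k t with
  | case1 => rfl
  | case2 => simp only [suzuki, mul_div_assoc]
  | case3 k t ih₁ ih₂ => simp only [suzuki, ih₁, ih₂, mul_left_comm]

theorem suzuki_mul_suzuki_neg (E : Fin 4 → ℝ → G) (hE : ∀ j t, E j t * E j (-t) = 1) (k : ℕ)
    (t : ℝ) : suzuki E k t * suzuki E k (-t) = 1 := by
  have cancel {x y : G} (h : x * y = 1) (z : G) : x * (y * z) = z := by
    rw [← mul_assoc, h, one_mul]
  fun_induction suzuki E k t with
  | case1 => simp only [suzuki, mul_one]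
  | case2 t => simp only [suzuki, neg_div, mul_assoc, cancel (hE _ _), hE]
  | case3 k t ih₁ ih₂ =>
    simp only [suzuki, mul_neg, mul_assoc, pow_two, cancel ih₁, cancel ih₂, ih₁]

theorem suzuki_mem {S : Submonoid G} {E : Fin 4 → ℝ → G} (hE : ∀ j t, E j t ∈ S) (k : ℕ) (t : ℝ) :
    suzuki E k t ∈ S := by
  fun_induction suzuki E k t with
  | case1 => exact one_mem S
  | case2 t =>
    have h := fun j => hE j (t / 2)
    exact mul_mem (mul_mem (mul_mem (mul_mem (h 0) (h 1)) (h 2)) (h 3))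
      (mul_mem (mul_mem (mul_mem (h 3) (h 2)) (h 1)) (h 0))
  | case3 k t ih₁ ih₂ => exact mul_mem (mul_mem (pow_mem ih₁ 2) ih₂) (pow_mem ih₁ 2)

theorem length_suzuki_le {α : Type} {E : Fin 4 → ℝ → FreeMonoid α} {L : ℕ}
    (hE : ∀ j t, (E j t).length ≤ L) (k : ℕ) (t : ℝ) :
    (suzuki E (k + 1) t).length ≤ 8 * 5 ^ k * L := by
  induction k generalizing t with
  | zero =>
    simp only [suzuki, FreeMonoid.length_mul]
    linarith [hE 0 (t / 2), hE 1 (t / 2), hE 2 (t / 2), hE 3 (t / 2)]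
  | succ k ih =>
    simp only [suzuki, FreeMonoid.length_mul, pow_two]
    linarith [ih (suzukiCoeff (k + 2) * t), ih ((1 - 4 * suzukiCoeff (k + 2)) * t),
      pow_succ 5 k, congrArg (8 * · * L) (pow_succ 5 k)]

theorem length_pow_freeMonoid {α : Type*} (c : FreeMonoid α) (n : ℕ) :
    (c ^ n).length = n * c.length := by
  induction n with
  | zero => simp
  | succ n ih => rw [pow_succ, FreeMonoid.length_mul, ih, add_one_mul]

theorem suzukiCoeff_add_two (k : ℕ) :
    suzukiCoeff (k + 2) = 1 / (4 - (4 : ℝ) ^ ((2 * k + 3 : ℕ) : ℝ)⁻¹) := by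
  rw [suzukiCoeff, one_div (2 * _ - 1 : ℝ)]
  push_cast
  ring_nf

theorem four_rpow_inv_le_two (k : ℕ) : (4 : ℝ) ^ ((2 * k + 3 : ℕ) : ℝ)⁻¹ ≤ 2 := by
  calc (4 : ℝ) ^ ((2 * k + 3 : ℕ) : ℝ)⁻¹ ≤ 4 ^ (2⁻¹ : ℝ) := by
        gcongr
        · norm_num
        · push_cast
          linarith [k.cast_nonneg (α := ℝ)]
    _ = 2 := by
        rw [show (4 : ℝ) = 2 ^ (2 : ℝ) by norm_num, ← Real.rpow_mul (by norm_num)]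
        norm_num

theorem suzukiCoeff_mem_Icc (k : ℕ) : suzukiCoeff (k + 2) ∈ Set.Icc (1 / 4) (1 / 2) := by
  have h2 := four_rpow_inv_le_two k
  have h0 : 0 < (4 : ℝ) ^ ((2 * k + 3 : ℕ) : ℝ)⁻¹ := by positivity
  rw [suzukiCoeff_add_two]
  exact ⟨one_div_le_one_div_of_le (by linarith) (by linarith),
    one_div_le_one_div_of_le (by norm_num) (by linarith)⟩

/- With `w = 4^{1/(2k+3)}` and `u = 1/(4 - w)` one has `1 - 4u = -wu`. -/
theorem suzukiCoeff_pow (k : ℕ) :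
    4 * suzukiCoeff (k + 2) ^ (2 * k + 3) + (1 - 4 * suzukiCoeff (k + 2)) ^ (2 * k + 3) = 0 := by
  have hw := four_rpow_inv_le_two k
  rw [suzukiCoeff_add_two]
  set w := (4 : ℝ) ^ ((2 * k + 3 : ℕ) : ℝ)⁻¹
  have hne : 4 - w ≠ 0 := by linarith
  have hwp : w ^ (2 * k + 3) = 4 := Real.rpow_inv_natCast_pow (by norm_num) (by omega)
  have hneg : 1 - 4 * (1 / (4 - w)) = -(w * (1 / (4 - w))) := by field_simp; ring
  rw [hneg, Odd.neg_pow ⟨k + 1, by ring⟩, mul_pow, hwp]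
  ring

end ProductFormula

/-! ## Formal power series of product formulas -/

section FormalSeries

open PowerSeries Finset

theorem sum_antidiagonal_pow_div_factorial {K : Type*} [Field K] [CharZero K] (x y : K) (n : ℕ) :
    ∑ p ∈ antidiagonal n, (x ^ p.1 / p.1.factorial) * (y ^ p.2 / p.2.factorial)
      = (x + y) ^ n / n.factorial := by
  have h := congrArg (coeff n) (PowerSeries.exp_mul_exp_eq_exp_add x y)
  simpa [coeff_mul, coeff_exp, div_eq_mul_inv] using h

section Dilation

variable {K R : Type*} [CommSemiring K] [Semiring R] [Algebra K R]

/-- Substitution of `t X` for `X`, where the scalar `t` commutes with the (possibly noncommuting)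
coefficients. -/
def dilate (t : K) : PowerSeries R →+* PowerSeries R where
  toFun p := PowerSeries.mk fun n => t ^ n • coeff n p
  map_zero' := by ext n; simp
  map_add' p q := by ext n; simp
  map_one' := by
    ext n
    rw [coeff_mk, coeff_one]
    rcases eq_or_ne n 0 with rfl | h <;> simp [*]
  map_mul' p q := by
    ext n
    simp only [coeff_mk, coeff_mul, Finset.smul_sum]
    refine Finset.sum_congr rfl fun x hx => ?_
    rw [smul_mul_smul_comm, ← pow_add, mem_antidiagonal.1 hx]

@[simp]
theorem coeff_dilate (t : K) (p : PowerSeries R) (n : ℕ) :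
    coeff n (dilate t p) = t ^ n • coeff n p := by
  simp [dilate]

@[simp]
theorem constantCoeff_dilate (t : K) (p : PowerSeries R) :
    constantCoeff (dilate t p) = constantCoeff p := by
  simp only [← coeff_zero_eq_constantCoeff_apply, coeff_dilate, pow_zero, one_smul]

theorem dilate_X_pow_mul (t : K) (m : ℕ) (s : PowerSeries R) :
    dilate t (X ^ m * s) = X ^ m * t ^ m • dilate t s := by
  ext n
  simp only [coeff_dilate, coeff_X_pow_mul', coeff_smul]
  split_ifs with h
  · rw [smul_smul, ← pow_add, Nat.add_sub_cancel' h]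
  · rw [smul_zero]

end Dilation

section Exponential

variable {K R : Type*} [Field K] [Ring R] [Algebra K R]

/-- The power series of `exp (t X Y)` in the formal variable `X`. -/
def expPowerSeries (Y : R) (t : K) : PowerSeries R :=
  PowerSeries.mk fun n => (t ^ n / n.factorial) • Y ^ n

theorem coeff_expPowerSeries (Y : R) (t : K) (n : ℕ) :
    coeff n (expPowerSeries Y t) = (t ^ n / n.factorial) • Y ^ n :=
  coeff_mk n _

@[simp]
theorem constantCoeff_expPowerSeries (Y : R) (t : K) : constantCoeff (expPowerSeries Y t) = 1 := by
  simpa using coeff_expPowerSeries Y t 0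

theorem expPowerSeries_mul [CharZero K] (Y : R) (s t : K) :
    expPowerSeries Y s * expPowerSeries Y t = expPowerSeries Y (s + t) := by
  ext n
  simp only [coeff_mul, coeff_expPowerSeries, ← sum_antidiagonal_pow_div_factorial, Finset.sum_smul]
  refine Finset.sum_congr rfl fun p hp => ?_
  rw [smul_mul_smul_comm, ← pow_add, mem_antidiagonal.1 hp]

theorem expPowerSeries_zero (Y : R) : expPowerSeries Y (0 : K) = 1 := by
  ext n
  rw [coeff_expPowerSeries, coeff_one]
  rcases eq_or_ne n 0 with rfl | h <;> simp [*]

theorem expPowerSeries_mul_neg [CharZero K] (Y : R) (t : K) :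
    expPowerSeries Y t * expPowerSeries Y (-t) = 1 := by
  rw [expPowerSeries_mul, add_neg_cancel, expPowerSeries_zero]

theorem dilate_expPowerSeries (Y : R) (s t : K) :
    dilate s (expPowerSeries Y t) = expPowerSeries Y (s * t) := by
  ext n
  rw [coeff_dilate, coeff_expPowerSeries, coeff_expPowerSeries, smul_smul, mul_pow, mul_div_assoc]

end Exponential

/-- `p` and `q` have constant coefficient `1`, agree below degree `m`, and their coefficients of
degree `m` differ by `d`. The defect `d` is additive in products, which is what makes Suzuki's
cancellation of the leading error term work. -/
structure HasLeadingDefect {R : Type*} [Semiring R] (m : ℕ) (p q : PowerSeries R) (d : R) :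
    Prop where
  constantCoeff_left : constantCoeff p = 1
  constantCoeff_right : constantCoeff q = 1
  exists_remainder : ∃ s : PowerSeries R, p = q + X ^ m * s ∧ constantCoeff s = d

namespace HasLeadingDefect

theorem coeff_eq {R : Type*} [Semiring R] {m n : ℕ} {p q : PowerSeries R} {d : R}
    (h : HasLeadingDefect m p q d) (hn : n < m) : coeff n p = coeff n q := by
  obtain ⟨s, rfl, -⟩ := h.exists_remainder
  rw [map_add, coeff_X_pow_mul', if_neg hn.not_ge, add_zero]

theorem mul {R : Type*} [Semiring R] {m : ℕ} {p q p' q' : PowerSeries R} {d d' : R} (hm : m ≠ 0)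
    (h : HasLeadingDefect m p q d) (h' : HasLeadingDefect m p' q' d') :
    HasLeadingDefect m (p * p') (q * q') (d + d') where
  constantCoeff_left := by rw [map_mul, h.constantCoeff_left, h'.constantCoeff_left, one_mul]
  constantCoeff_right := by rw [map_mul, h.constantCoeff_right, h'.constantCoeff_right, one_mul]
  exists_remainder := by
    obtain ⟨s, rfl, hs⟩ := h.exists_remainder
    obtain ⟨s', rfl, hs'⟩ := h'.exists_remainder
    refine ⟨s * q' + q * s' + s * (X ^ m * s'), ?_, ?_⟩
    · simp only [add_mul, mul_add, ← mul_assoc, ← X_pow_mul (φ := q), add_assoc, add_left_comm]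
    · simp [hm, h.constantCoeff_right, h'.constantCoeff_right, hs, hs']

theorem dilate {K R : Type*} [CommSemiring K] [Semiring R] [Algebra K R] {m : ℕ}
    {p q : PowerSeries R} {d : R} (h : HasLeadingDefect m p q d) (t : K) :
    HasLeadingDefect m (dilate t p) (dilate t q) (t ^ m • d) where
  constantCoeff_left := by rw [constantCoeff_dilate, h.constantCoeff_left]
  constantCoeff_right := by rw [constantCoeff_dilate, h.constantCoeff_right]
  exists_remainder := by
    obtain ⟨s, rfl, hs⟩ := h.exists_remainder
    refine ⟨t ^ m • DiracSim.dilate t s, ?_, ?_⟩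
    · rw [map_add, dilate_X_pow_mul]
    · rw [← hs, constantCoeff_smul, constantCoeff_dilate]

theorem succ {R : Type*} [Semiring R] {m : ℕ} {p q : PowerSeries R}
    (h : HasLeadingDefect m p q 0) : ∃ d, HasLeadingDefect (m + 1) p q d := by
  obtain ⟨s, hp, hs⟩ := h.exists_remainder
  obtain ⟨s', rfl⟩ := X_dvd_iff.2 hs
  exact ⟨constantCoeff s', h.constantCoeff_left, h.constantCoeff_right, s',
    by rw [hp, pow_succ, mul_assoc], rfl⟩

theorem sub_of_right {R : Type*} [Ring R] {m : ℕ} {p p' q : PowerSeries R} {d d' : R}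
    (h : HasLeadingDefect m p q d) (h' : HasLeadingDefect m p' q d') :
    HasLeadingDefect m p p' (d - d') where
  constantCoeff_left := h.constantCoeff_left
  constantCoeff_right := h'.constantCoeff_left
  exists_remainder := by
    obtain ⟨s, rfl, hs⟩ := h.exists_remainder
    obtain ⟨s', rfl, hs'⟩ := h'.exists_remainder
    exact ⟨s - s', by noncomm_ring, by rw [map_sub, hs, hs']⟩

theorem defect_eq_zero {R : Type*} [Ring R] {m : ℕ} {p : PowerSeries R} {d : R}
    (h : HasLeadingDefect m p p d) : d = 0 := by
  obtain ⟨s, hs, rfl⟩ := h.exists_remainder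
  have hs0 : X ^ m * s = 0 := by simpa using hs
  simpa [coeff_X_pow_mul'] using congrArg (coeff m) hs0

theorem eq_zero_of_mul_dilate_neg_one {R : Type*} [Ring R] [Algebra ℝ R] {m : ℕ} (hm : m ≠ 0)
    (heven : Even m) {p q : PowerSeries R} {d : R} (h : HasLeadingDefect m p q d)
    (hp : p * DiracSim.dilate (-1 : ℝ) p = 1) (hq : q * DiracSim.dilate (-1 : ℝ) q = 1) :
    d = 0 := by
  have hdefect := h.mul hm (h.dilate (-1 : ℝ))
  rw [hp, hq, heven.neg_one_pow, one_smul] at hdefect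
  have htwo : (2 : ℝ) • d = 0 := by rw [two_smul, hdefect.defect_eq_zero]
  exact (smul_eq_zero_iff_right two_ne_zero).1 htwo

end HasLeadingDefect

section SuzukiSeries

variable {R : Type} [Ring R] [Algebra ℝ R]

/-- The formal power series in the step size of the product formula `U_{2k}`, whose factors are
the exponentials of the `Y j`. -/
def suzukiSeries (Y : Fin 4 → R) (k : ℕ) (t : ℝ) : PowerSeries R :=
  suzuki (fun j => expPowerSeries (Y j)) k t

theorem dilate_suzukiSeries (Y : Fin 4 → R) (k : ℕ) (t : ℝ) :
    dilate t (suzukiSeries Y k 1) = suzukiSeries Y k t := by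
  simp only [suzukiSeries, map_suzuki, dilate_expPowerSeries]
  rw [suzuki_comp_mul (fun j => expPowerSeries (Y j)), mul_one]

theorem suzukiSeries_mul_dilate_neg_one (Y : Fin 4 → R) (k : ℕ) :
    suzukiSeries Y k 1 * dilate (-1 : ℝ) (suzukiSeries Y k 1) = 1 := by
  rw [dilate_suzukiSeries]
  exact suzuki_mul_suzuki_neg _ (fun j t => expPowerSeries_mul_neg (Y j) t) k 1

theorem expPowerSeries_mul_dilate_neg_one (Y : R) :
    expPowerSeries Y (1 : ℝ) * dilate (-1 : ℝ) (expPowerSeries Y (1 : ℝ)) = 1 := by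
  rw [dilate_expPowerSeries, mul_one, expPowerSeries_mul_neg]

theorem hasLeadingDefect_expPowerSeries (Y : R) (t : ℝ) :
    HasLeadingDefect 1 (expPowerSeries Y t) 1 (t • Y) where
  constantCoeff_left := constantCoeff_expPowerSeries Y t
  constantCoeff_right := map_one _
  exists_remainder := by
    refine ⟨PowerSeries.mk fun n => coeff (n + 1) (expPowerSeries Y t), ?_, ?_⟩
    · ext n
      cases n <;> simp [coeff_one, coeff_succ_X_mul]
    · simp [coeff_expPowerSeries]

theorem hasLeadingDefect_suzukiSeries_one (Y : Fin 4 → R) :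
    HasLeadingDefect 1 (suzukiSeries Y 1 1) (expPowerSeries (∑ j, Y j) (1 : ℝ)) 0 := by
  have half := fun j => hasLeadingDefect_expPowerSeries (Y j) (1 / 2)
  have hleft := (((half 0).mul one_ne_zero (half 1)).mul one_ne_zero (half 2)).mul one_ne_zero
    (half 3)
  have hright := (((half 3).mul one_ne_zero (half 2)).mul one_ne_zero (half 1)).mul one_ne_zero
    (half 0)
  have hprod := hleft.mul one_ne_zero hright
  simp only [mul_one] at hprod
  have hdefect := hprod.sub_of_right (hasLeadingDefect_expPowerSeries (∑ j, Y j) 1)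
  rwa [show _ - _ = (0 : R) by rw [Fin.sum_univ_four]; module] at hdefect

theorem hasLeadingDefect_suzukiSeries_add_two {Y : Fin 4 → R} {k : ℕ} {d : R}
    (h : HasLeadingDefect (2 * k + 3) (suzukiSeries Y (k + 1) 1)
      (expPowerSeries (∑ j, Y j) (1 : ℝ)) d) :
    HasLeadingDefect (2 * k + 3) (suzukiSeries Y (k + 2) 1)
      (expPowerSeries (∑ j, Y j) (1 : ℝ)) 0 := by
  have hm : 2 * k + 3 ≠ 0 := by omega
  have hstep (s : ℝ) : HasLeadingDefect (2 * k + 3) (suzukiSeries Y (k + 1) s)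
      (expPowerSeries (∑ j, Y j) s) (s ^ (2 * k + 3) • d) := by
    simpa only [dilate_suzukiSeries, dilate_expPowerSeries, mul_one] using h.dilate s
  have hcoeff := suzukiCoeff_pow k
  set u := suzukiCoeff (k + 2) with hu
  have hsquare := (hstep u).mul hm (hstep u)
  convert (hsquare.mul hm (hstep (1 - 4 * u))).mul hm hsquare using 1
  · simp only [suzukiSeries, suzuki, mul_one, pow_two, hu]
  · simp only [expPowerSeries_mul]
    congr 1
    ring
  · calc (0 : R) = (4 * u ^ (2 * k + 3) + (1 - 4 * u) ^ (2 * k + 3)) • d := by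
          rw [hcoeff, zero_smul]
      _ = _ := by module

theorem exists_hasLeadingDefect_suzukiSeries (Y : Fin 4 → R) (k : ℕ) :
    ∃ d, HasLeadingDefect (2 * k + 3) (suzukiSeries Y (k + 1) 1)
      (expPowerSeries (∑ j, Y j) (1 : ℝ)) d := by
  have raise_two {m k : ℕ} (hm : Even (m + 1)) (h : HasLeadingDefect m (suzukiSeries Y k 1)
      (expPowerSeries (∑ j, Y j) (1 : ℝ)) 0) :
      ∃ d, HasLeadingDefect (m + 2) (suzukiSeries Y k 1) (expPowerSeries (∑ j, Y j) (1 : ℝ)) d := by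
    obtain ⟨d, hd⟩ := h.succ
    have hd0 := hd.eq_zero_of_mul_dilate_neg_one m.succ_ne_zero hm
      (suzukiSeries_mul_dilate_neg_one Y k) (expPowerSeries_mul_dilate_neg_one _)
    exact (hd0 ▸ hd).succ
  induction k with
  | zero => exact raise_two even_two (hasLeadingDefect_suzukiSeries_one Y)
  | succ k ih =>
    obtain ⟨d, hd⟩ := ih
    exact raise_two ⟨k + 2, by ring⟩ (hasLeadingDefect_suzukiSeries_add_two hd)

end SuzukiSeries

/-! ## Majorants -/

section Majorants

variable {R : Type*} [NormedRing R]

/-- The power series `p` converges to `x` at `1` and is dominated by the series of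
`exp (τ X)`. -/
structure ExpMajorized (p : PowerSeries R) (x : R) (τ : ℝ) : Prop where
  nonneg : 0 ≤ τ
  norm_coeff_le : ∀ n, ‖coeff n p‖ ≤ τ ^ n / n.factorial
  hasSum : HasSum (fun n => coeff n p) x

namespace ExpMajorized

theorem summable_norm {p : PowerSeries R} {x : R} {τ : ℝ} (h : ExpMajorized p x τ) :
    Summable fun n => ‖coeff n p‖ :=
  (Real.summable_pow_div_factorial τ).of_nonneg_of_le (fun _ => norm_nonneg _) h.norm_coeff_le

theorem mul [CompleteSpace R] {p p' : PowerSeries R} {x x' : R} {τ τ' : ℝ}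
    (h : ExpMajorized p x τ) (h' : ExpMajorized p' x' τ') :
    ExpMajorized (p * p') (x * x') (τ + τ') where
  nonneg := add_nonneg h.nonneg h'.nonneg
  norm_coeff_le n := by
    have := h.nonneg
    rw [coeff_mul, ← sum_antidiagonal_pow_div_factorial]
    refine (norm_sum_le _ _).trans (Finset.sum_le_sum fun i _ => (norm_mul_le _ _).trans ?_)
    exact mul_le_mul (h.norm_coeff_le _) (h'.norm_coeff_le _) (norm_nonneg _) (by positivity)
  hasSum := by
    have cauchy := tsum_mul_tsum_eq_tsum_sum_antidiagonal_of_summable_norm h.summable_norm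
      h'.summable_norm
    rw [h.hasSum.tsum_eq, h'.hasSum.tsum_eq] at cauchy
    simp only [coeff_mul, cauchy]
    exact (summable_norm_sum_mul_antidiagonal_of_summable_norm h.summable_norm
      h'.summable_norm).of_norm.hasSum

theorem mono {p : PowerSeries R} {x : R} {τ τ' : ℝ} (h : ExpMajorized p x τ) (hτ : τ ≤ τ') :
    ExpMajorized p x τ' where
  nonneg := h.nonneg.trans hτ
  norm_coeff_le n := (h.norm_coeff_le n).trans (by have := h.nonneg; gcongr)
  hasSum := h.hasSum

theorem norm_coeff_add_le {p : PowerSeries R} {x : R} {τ : ℝ} (h : ExpMajorized p x τ)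
    (hτ : τ ≤ 1) (m n : ℕ) : ‖coeff (n + m) p‖ ≤ τ ^ m / n.factorial := by
  have h0 := h.nonneg
  refine (h.norm_coeff_le _).trans ?_
  gcongr ?_ / ((Nat.factorial ?_ : ℕ) : ℝ)
  · exact pow_le_pow_of_le_one h0 hτ (Nat.le_add_left m n)
  · exact Nat.le_add_right n m

theorem norm_sub_le {p q : PowerSeries R} {x y d : R} {τ : ℝ} {m : ℕ} (hp : ExpMajorized p x τ)
    (hq : ExpMajorized q y τ) (hpq : HasLeadingDefect m p q d) (hτ : τ ≤ 1) :
    ‖x - y‖ ≤ 6 * τ ^ m := by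
  have h0 := hp.nonneg
  have hlow : ∑ i ∈ range m, (coeff i p - coeff i q) = 0 :=
    Finset.sum_eq_zero fun i hi => sub_eq_zero.2 (hpq.coeff_eq (mem_range.1 hi))
  have htail : HasSum (fun n => coeff (n + m) p - coeff (n + m) q) (x - y) := by
    simpa only [hlow, sub_zero] using (hasSum_nat_add_iff' m).2 (hp.hasSum.sub hq.hasSum)
  have hexp : HasSum (fun n : ℕ => 2 * τ ^ m * (1 / n.factorial)) (2 * τ ^ m * Real.exp 1) := by
    simpa [Real.exp_eq_exp_ℝ] using
      (NormedSpace.expSeries_div_hasSum_exp (1 : ℝ)).mul_left (2 * τ ^ m)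
  calc ‖x - y‖ ≤ 2 * τ ^ m * Real.exp 1 := by
        refine htail.norm_le_of_bounded hexp fun n => (_root_.norm_sub_le _ _).trans ?_
        calc _ ≤ τ ^ m / n.factorial + τ ^ m / n.factorial :=
              add_le_add (hp.norm_coeff_add_le hτ m n) (hq.norm_coeff_add_le hτ m n)
          _ = _ := by ring
    _ ≤ 2 * τ ^ m * 3 := by
        gcongr
        exact Real.exp_one_lt_three.le
    _ = 6 * τ ^ m := by ring

end ExpMajorized

section Exponential

variable [NormedAlgebra ℝ R] [CompleteSpace R] [NormOneClass R]

theorem expMajorized_expPowerSeries (Y : R) (t : ℝ) :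
    ExpMajorized (expPowerSeries Y t) (NormedSpace.exp (t • Y)) (‖Y‖ * |t|) where
  nonneg := by positivity
  norm_coeff_le n := by
    rw [coeff_expPowerSeries, norm_smul, norm_div, norm_pow, Real.norm_natCast, Real.norm_eq_abs,
      mul_pow, mul_comm (‖Y‖ ^ n), mul_div_right_comm]
    gcongr
    exact norm_pow_le Y n
  hasSum := by
    convert NormedSpace.exp_series_hasSum_exp' (𝕂 := ℝ) (t • Y) using 2 with n
    rw [coeff_expPowerSeries, smul_pow, smul_smul, div_eq_inv_mul]

end Exponential

section Suzuki

variable {R : Type} [NormedRing R] [NormedAlgebra ℝ R] [CompleteSpace R] [NormOneClass R]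

theorem expMajorized_suzukiSeries (Y : Fin 4 → R) (k : ℕ) (t : ℝ) :
    ExpMajorized (suzukiSeries Y (k + 1) t)
      (suzuki (fun j s => NormedSpace.exp (s • Y j)) (k + 1) t) (3 ^ k * (∑ j, ‖Y j‖) * |t|) := by
  induction k generalizing t with
  | zero =>
    have half := fun j => expMajorized_expPowerSeries (Y j) (t / 2)
    refine (((((half 0).mul (half 1)).mul (half 2)).mul (half 3)).mul
      ((((half 3).mul (half 2)).mul (half 1)).mul (half 0))).mono (le_of_eq ?_)
    rw [abs_div, abs_two, Fin.sum_univ_four]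
    ring
  | succ k ih =>
    obtain ⟨hu₁, hu₂⟩ := suzukiCoeff_mem_Icc k
    have hsquare := (ih (suzukiCoeff (k + 2) * t)).mul (ih (suzukiCoeff (k + 2) * t))
    have hprod := (hsquare.mul (ih ((1 - 4 * suzukiCoeff (k + 2)) * t))).mul hsquare
    simp only [← pow_two] at hprod
    refine hprod.mono ?_
    set u := suzukiCoeff (k + 2)
    rw [abs_mul, abs_mul, abs_of_nonneg (by linarith : 0 ≤ u),
      abs_of_nonpos (by linarith : 1 - 4 * u ≤ 0)]
    calc _ = 3 ^ k * (∑ j, ‖Y j‖) * |t| * (8 * u - 1) := by ring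
      _ ≤ 3 ^ k * (∑ j, ‖Y j‖) * |t| * 3 := by
          gcongr
          linarith
      _ = 3 ^ (k + 1) * (∑ j, ‖Y j‖) * |t| := by ring

theorem norm_suzuki_sub_exp_le (Y : Fin 4 → R) (k : ℕ) (t : ℝ)
    (ht : 3 ^ k * (∑ j, ‖Y j‖) * |t| ≤ 1) :
    ‖suzuki (fun j s => NormedSpace.exp (s • Y j)) (k + 1) t - NormedSpace.exp (t • ∑ j, Y j)‖
      ≤ 6 * (3 ^ k * (∑ j, ‖Y j‖) * |t|) ^ (2 * k + 3) := by
  have hnorm : ‖∑ j, Y j‖ ≤ 3 ^ k * ∑ j, ‖Y j‖ :=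
    (norm_sum_le _ _).trans
      (le_mul_of_one_le_left (by positivity) (one_le_pow₀ (by norm_num)))
  have hexp := (expMajorized_expPowerSeries (∑ j, Y j) t).mono
    (mul_le_mul_of_nonneg_right hnorm (abs_nonneg t))
  obtain ⟨d, hd⟩ := exists_hasLeadingDefect_suzukiSeries Y k
  have hdefect := hd.dilate t
  rw [dilate_suzukiSeries, dilate_expPowerSeries, mul_one] at hdefect
  exact (expMajorized_suzukiSeries Y k t).norm_sub_le hexp hdefect ht

end Suzuki

end Majorants

end FormalSeries

/-! ## Cost scale and number of time steps -/

section Parameters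

/-- The range of the parameters of a simulation: potential strength `V`, evolution time `T` and
precision `ε` all kept away from the degenerate regime by the same constant `κ`. -/
structure ParameterRegime (κ V T ε : ℝ) : Prop where
  pos : 0 < κ
  le_potential : κ ≤ V
  le_time : κ ≤ |T|
  precision_pos : 0 < ε
  precision_le : ε ≤ 1 / κ

theorem log_two_le_log_two_add {x : ℝ} (hx : 0 ≤ x) : Real.log 2 ≤ Real.log (2 + x) :=
  Real.log_le_log (by norm_num) (by linarith)

theorem le_div_log_two_mul_log {a x : ℝ} (ha : 0 ≤ a) (hx : 0 ≤ x) :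
    a ≤ a / Real.log 2 * Real.log (2 + x) := by
  rw [div_mul_eq_mul_div, le_div_iff₀ (Real.log_pos one_lt_two)]
  exact mul_le_mul_of_nonneg_left (log_two_le_log_two_add hx) ha

theorem log_mul_le_mul_log_two_add {K x : ℝ} (hK : 0 < K) (hx : 0 < x) :
    Real.log (K * x) ≤ (|Real.log K| / Real.log 2 + 1) * Real.log (2 + x) := by
  have hKlog := (le_abs_self _).trans (le_div_log_two_mul_log (abs_nonneg (Real.log K)) hx.le)
  have hxlog : Real.log x ≤ Real.log (2 + x) := Real.log_le_log hx (by linarith)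
  rw [Real.log_mul hK.ne' hx.ne']
  linarith

theorem exists_two_pow_le_mul_log {δ K : ℝ} (hδ : 0 < δ) (hK : 0 < K) :
    ∃ B : ℝ, 0 < B ∧ ∀ x : ℝ, 0 ≤ x → ∃ q : ℕ, (2 : ℝ) ^ q ≤ B * Real.log (2 + x) ∧
      K * Real.exp (-(δ * 2 ^ q)) * (2 + x) ≤ 1 := by
  have : 0 < Real.log 2 := Real.log_pos one_lt_two
  set b := (|Real.log K| / Real.log 2 + 1) / δ with hb
  refine ⟨2 * (b + 1 / Real.log 2), by positivity, fun x hx => ?_⟩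
  have hℓ : 0 < Real.log (2 + x) := Real.log_pos (by linarith)
  have hone : 1 ≤ (b + 1 / Real.log 2) * Real.log (2 + x) := by
    have hbℓ : 0 ≤ b * Real.log (2 + x) := by positivity
    linarith [le_div_log_two_mul_log zero_le_one hx]
  obtain ⟨n, hn, hn'⟩ := exists_nat_pow_near hone one_lt_two
  refine ⟨n + 1, by linarith [pow_succ (2 : ℝ) n], ?_⟩
  have hexponent : Real.log (K * (2 + x)) ≤ δ * 2 ^ (n + 1) := by
    have hKlog := (le_abs_self _).trans (le_div_log_two_mul_log (abs_nonneg (Real.log K)) hx)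
    calc Real.log (K * (2 + x)) = Real.log K + Real.log (2 + x) := Real.log_mul hK.ne' (by linarith)
      _ ≤ δ * (b * Real.log (2 + x)) := by
        rw [← mul_assoc, hb, mul_div_cancel₀ _ hδ.ne']
        linarith
      _ ≤ δ * 2 ^ (n + 1) := by
        gcongr
        have : 0 ≤ 1 / Real.log 2 * Real.log (2 + x) := by positivity
        linarith
  calc K * Real.exp (-(δ * 2 ^ (n + 1))) * (2 + x)
      = K * (2 + x) * Real.exp (-(δ * 2 ^ (n + 1))) := by ring
    _ ≤ Real.exp (δ * 2 ^ (n + 1)) * Real.exp (-(δ * 2 ^ (n + 1))) := by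
        gcongr
        exact (Real.log_le_iff_le_exp (by positivity)).1 hexponent
    _ = 1 := by rw [← Real.exp_add, add_neg_cancel, Real.exp_zero]

theorem exists_grid_size {δ κ K c : ℝ} (hδ : 0 < δ) (hκ : 0 < κ) (hK : 0 < K) (hc : 0 < c) :
    ∃ B : ℝ, 0 < B ∧ ∀ T ε : ℝ, κ ≤ |T| → 0 < ε → ∃ q : ℕ,
      (2 : ℝ) ^ q ≤ B * Real.log (2 + |T| / ε) ∧
      K * Real.exp (-(δ * 2 ^ q)) * (1 + |T|) ≤ c * ε := by
  obtain ⟨B, hB, hgrid⟩ :=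
    exists_two_pow_le_mul_log hδ (by positivity : 0 < K * (1 + 1 / κ) / c)
  refine ⟨B, hB, fun T ε hT hε => ?_⟩
  obtain ⟨q, hq, hexp⟩ := hgrid (|T| / ε) (by positivity)
  refine ⟨q, hq, ?_⟩
  have htime : 1 + |T| ≤ (1 + 1 / κ) * (ε * (2 + |T| / ε)) := by
    have honeT : 1 ≤ 1 / κ * |T| := by rwa [one_div_mul_eq_div, one_le_div hκ]
    have hεT : |T| ≤ ε * (2 + |T| / ε) := by
      rw [mul_add, mul_div_cancel₀ _ hε.ne']
      linarith
    calc 1 + |T| ≤ (1 + 1 / κ) * |T| := by linarith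
      _ ≤ _ := by gcongr
  calc K * Real.exp (-(δ * 2 ^ q)) * (1 + |T|)
      ≤ K * Real.exp (-(δ * 2 ^ q)) * ((1 + 1 / κ) * (ε * (2 + |T| / ε))) := by gcongr
    _ = c * ε * (K * (1 + 1 / κ) / c * Real.exp (-(δ * 2 ^ q)) * (2 + |T| / ε)) := by field_simp
    _ ≤ c * ε * 1 := by gcongr
    _ = c * ε := mul_one _

theorem mul_div_pow_succ_le_div {τ ε z r : ℝ} {n : ℕ} (hτ : 0 < τ) (hε : 0 < ε) (hr : 0 < r)
    (hz : 24 * (τ / ε) ≤ z) (hpow : τ ^ n * z ≤ r ^ n) :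
    r * (6 * (τ / r) ^ (n + 1)) ≤ ε / 4 := by
  have hscaled : 24 * τ ^ (n + 1) ≤ ε * r ^ n :=
    calc 24 * τ ^ (n + 1) = ε * (τ ^ n * (24 * (τ / ε))) := by field_simp; ring
      _ ≤ ε * (τ ^ n * z) := by gcongr
      _ ≤ ε * r ^ n := by gcongr
  calc r * (6 * (τ / r) ^ (n + 1)) = 24 * τ ^ (n + 1) / (4 * r ^ n) := by
        rw [div_pow, pow_succ r]
        field_simp
        ring
    _ ≤ ε / 4 := by
        rw [div_le_div_iff₀ (by positivity) (by norm_num)]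
        linarith

theorem exists_steps {τ ε : ℝ} (hτ : 0 < τ) (hε : 0 < ε) {n : ℕ} (hn : n ≠ 0) :
    ∃ r : ℕ, 0 < r ∧ τ ≤ r ∧ r * (6 * (τ / r) ^ (n + 1)) ≤ ε / 4 ∧
      (r : ℝ) ≤ 1 + τ * (1 + 24 * (τ / ε)) ^ (n : ℝ)⁻¹ := by
  set z := 1 + 24 * (τ / ε)
  have hτε : 0 < τ / ε := by positivity
  have hroot : 1 ≤ z ^ (n : ℝ)⁻¹ := Real.one_le_rpow (by linarith) (by positivity)
  have hpos : 0 < τ * z ^ (n : ℝ)⁻¹ := by positivity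
  have hceil := Nat.le_ceil (τ * z ^ (n : ℝ)⁻¹)
  refine ⟨⌈τ * z ^ (n : ℝ)⁻¹⌉₊, Nat.ceil_pos.2 hpos, ?_, ?_, ?_⟩
  · exact (le_mul_of_one_le_right hτ.le hroot).trans hceil
  · refine mul_div_pow_succ_le_div hτ hε (hpos.trans_le hceil) (by linarith : _ ≤ z) ?_
    calc τ ^ n * z = (τ * z ^ (n : ℝ)⁻¹) ^ n := by
          rw [mul_pow, Real.rpow_inv_natCast_pow (by positivity) hn]
      _ ≤ _ := by gcongr
  · linarith [Nat.ceil_lt_add_one hpos.le]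

theorem costScale_eq {V T ε : ℝ} (hV : 0 < V) (hT : 0 < |T|) (hε : 0 < ε) (k : ℕ) :
    costScale k V T ε
      = 25 ^ k * (V * |T|) * (V * |T| / ε) ^ ((2 * k : ℕ) : ℝ)⁻¹ := by
  rw [costScale, Real.rpow_add hV, Real.rpow_add hT, Real.rpow_one, Real.rpow_one,
    Real.div_rpow (by positivity) hε.le, Real.mul_rpow hV.le hT.le, pow_mul]
  norm_num
  ring

theorem three_pow_rpow_le_three (k : ℕ) : ((3 : ℝ) ^ k) ^ ((2 * (k + 1) : ℕ) : ℝ)⁻¹ ≤ 3 := by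
  rw [← Real.rpow_natCast, ← Real.rpow_mul (by norm_num)]
  refine (Real.rpow_le_self_of_one_le (by norm_num) ?_)
  rw [← div_eq_mul_inv, div_le_one (by positivity)]
  exact_mod_cast (by omega : k ≤ 2 * (k + 1))

theorem rpow_one_add_le {κ a y : ℝ} (hκ : 0 < κ) (ha : 1 ≤ a) (hy : κ ^ 3 ≤ y) (k : ℕ) :
    (1 + 24 * (3 ^ k * (a * y))) ^ ((2 * (k + 1) : ℕ) : ℝ)⁻¹
      ≤ (24 + 1 / κ ^ 3) * (3 * (a * y ^ ((2 * (k + 1) : ℕ) : ℝ)⁻¹)) := by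
  have hy0 : 0 < y := (by positivity : 0 < κ ^ 3).trans_le hy
  have hK : 1 ≤ 24 + 1 / κ ^ 3 := by linarith [show 0 < 1 / κ ^ 3 by positivity]
  have hbase : 1 + 24 * (3 ^ k * (a * y)) ≤ (24 + 1 / κ ^ 3) * (3 ^ k * (a * y)) := by
    have hone : 1 ≤ 1 / κ ^ 3 * (3 ^ k * (a * y)) :=
      calc (1 : ℝ) = 1 / κ ^ 3 * (1 * (1 * κ ^ 3)) := by field_simp
        _ ≤ 1 / κ ^ 3 * (3 ^ k * (a * y)) := by
          gcongr
          exact one_le_pow₀ (by norm_num)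
    linarith
  have hx := Nat.cast_inv_le_one (α := ℝ) (2 * (k + 1))
  calc (1 + 24 * (3 ^ k * (a * y))) ^ ((2 * (k + 1) : ℕ) : ℝ)⁻¹
      ≤ ((24 + 1 / κ ^ 3) * (3 ^ k * (a * y))) ^ ((2 * (k + 1) : ℕ) : ℝ)⁻¹ := by gcongr
    _ = (24 + 1 / κ ^ 3) ^ ((2 * (k + 1) : ℕ) : ℝ)⁻¹ * (((3 : ℝ) ^ k) ^ ((2 * (k + 1) : ℕ) : ℝ)⁻¹
          * (a ^ ((2 * (k + 1) : ℕ) : ℝ)⁻¹ * y ^ ((2 * (k + 1) : ℕ) : ℝ)⁻¹)) := by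
        rw [Real.mul_rpow, Real.mul_rpow, Real.mul_rpow] <;> positivity
    _ ≤ _ := by
        gcongr
        · exact Real.rpow_le_self_of_one_le hK hx
        · exact three_pow_rpow_le_three k
        · exact Real.rpow_le_self_of_one_le ha hx

namespace ParameterRegime

variable {κ V T ε : ℝ}

theorem potential_pos (h : ParameterRegime κ V T ε) : 0 < V := h.pos.trans_le h.le_potential

theorem abs_time_pos (h : ParameterRegime κ V T ε) : 0 < |T| := h.pos.trans_le h.le_time

theorem sq_le (h : ParameterRegime κ V T ε) : κ ^ 2 ≤ V * |T| := by
  rw [pow_two]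
  exact mul_le_mul h.le_potential h.le_time h.pos.le h.potential_pos.le

theorem cube_le (h : ParameterRegime κ V T ε) : κ ^ 3 ≤ V * |T| / ε := by
  have hκ := h.pos
  rw [le_div_iff₀ h.precision_pos]
  calc κ ^ 3 * ε ≤ κ ^ 3 * (1 / κ) := by gcongr; exact h.precision_le
    _ = κ ^ 2 := by field_simp
    _ ≤ V * |T| := h.sq_le

theorem action_pos (h : ParameterRegime κ V T ε) : 0 < V * |T| / ε :=
  (pow_pos h.pos 3).trans_le h.cube_le

theorem costScale_eq (h : ParameterRegime κ V T ε) (k : ℕ) :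
    costScale k V T ε = 25 ^ k * (V * |T|) * (V * |T| / ε) ^ ((2 * k : ℕ) : ℝ)⁻¹ :=
  DiracSim.costScale_eq h.potential_pos h.abs_time_pos h.precision_pos k

theorem costScale_pos (h : ParameterRegime κ V T ε) (k : ℕ) : 0 < costScale k V T ε := by
  have := h.potential_pos
  have := h.abs_time_pos
  have := h.action_pos
  rw [h.costScale_eq]
  positivity

theorem sq_mul_rpow_le_costScale (h : ParameterRegime κ V T ε) (k : ℕ) :
    κ ^ 2 * (V * |T| / ε) ^ ((2 * k : ℕ) : ℝ)⁻¹ ≤ costScale k V T ε := by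
  have := h.action_pos
  rw [h.costScale_eq]
  have hfactor : κ ^ 2 ≤ 25 ^ k * (V * |T|) :=
    h.sq_le.trans (le_mul_of_one_le_left ((sq_nonneg κ).trans h.sq_le) (one_le_pow₀ (by norm_num)))
  exact mul_le_mul_of_nonneg_right hfactor (by positivity)

theorem sq_mul_min_mul_exp_le_costScale (h : ParameterRegime κ V T ε) (k : ℕ) :
    κ ^ 2 * min 1 (κ ^ 3) * Real.exp k ≤ costScale k V T ε := by
  have hmin : 0 < min 1 (κ ^ 3) := lt_min one_pos (pow_pos h.pos 3)
  have hroot : min 1 (κ ^ 3) ≤ (V * |T| / ε) ^ ((2 * k : ℕ) : ℝ)⁻¹ :=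
    calc min 1 (κ ^ 3) ≤ min 1 (κ ^ 3) ^ ((2 * k : ℕ) : ℝ)⁻¹ :=
          Real.self_le_rpow_of_le_one hmin.le (min_le_left _ _) (Nat.cast_inv_le_one _)
      _ ≤ _ := by
          gcongr
          exact (min_le_right _ _).trans h.cube_le
  have hexp : Real.exp k ≤ 25 ^ k := by
    rw [← Real.exp_one_pow k]
    gcongr
    linarith [Real.exp_one_lt_three]
  have hfactor : Real.exp k * κ ^ 2 ≤ 25 ^ k * (V * |T|) :=
    mul_le_mul hexp h.sq_le (sq_nonneg κ) (by positivity)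
  calc κ ^ 2 * min 1 (κ ^ 3) * Real.exp k = Real.exp k * κ ^ 2 * min 1 (κ ^ 3) := by ring
    _ ≤ 25 ^ k * (V * |T|) * (V * |T| / ε) ^ ((2 * k : ℕ) : ℝ)⁻¹ :=
        mul_le_mul hfactor hroot hmin.le ((by positivity : 0 ≤ Real.exp k * κ ^ 2).trans hfactor)
    _ = costScale k V T ε := (h.costScale_eq k).symm

theorem natCast_le_log (h : ParameterRegime κ V T ε) (k : ℕ) :
    (k : ℝ) ≤ Real.log ((κ ^ 2 * min 1 (κ ^ 3))⁻¹ * costScale k V T ε) := by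
  have hd : 0 < κ ^ 2 * min 1 (κ ^ 3) :=
    mul_pos (pow_pos h.pos 2) (lt_min one_pos (pow_pos h.pos 3))
  rw [Real.le_log_iff_exp_le (mul_pos (inv_pos.2 hd) (h.costScale_pos k)), le_inv_mul_iff₀ hd]
  exact h.sq_mul_min_mul_exp_le_costScale k

/- Both `e^k` and `y^{1/2k}`, where `y = V|T|/ε`, are bounded by a multiple of the cost scale `g`,
so that `log y = 2k · log y^{1/2k}` is of order `(log g)²`. -/
theorem log_action_le (h : ParameterRegime κ V T ε) {k : ℕ} (hk : k ≠ 0) :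
    Real.log (V * |T| / ε)
      ≤ 2 * Real.log ((κ ^ 2 * min 1 (κ ^ 3))⁻¹ * costScale k V T ε) ^ 2 := by
  have hy := h.action_pos
  have hmin : 0 < min 1 (κ ^ 3) := lt_min one_pos (pow_pos h.pos 3)
  have hd : 0 < κ ^ 2 * min 1 (κ ^ 3) := mul_pos (pow_pos h.pos 2) hmin
  have hks := h.natCast_le_log k
  set s := Real.log ((κ ^ 2 * min 1 (κ ^ 3))⁻¹ * costScale k V T ε)
  have hroot : ((2 * k : ℕ) : ℝ)⁻¹ * Real.log (V * |T| / ε) ≤ s := by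
    rw [← Real.log_rpow hy]
    refine Real.log_le_log (by positivity) ?_
    rw [le_inv_mul_iff₀ hd]
    refine le_trans ?_ (h.sq_mul_rpow_le_costScale k)
    gcongr
    exact mul_le_of_le_one_right (sq_nonneg κ) (min_le_left _ _)
  rw [inv_mul_le_iff₀ (by positivity)] at hroot
  push_cast at hroot
  calc Real.log (V * |T| / ε) ≤ 2 * k * s := hroot
    _ ≤ 2 * s * s := by
        gcongr
        exact k.cast_nonneg.trans hks
    _ = 2 * s ^ 2 := by ring

theorem two_add_time_div_le (h : ParameterRegime κ V T ε) :
    2 + |T| / ε ≤ (2 / κ ^ 3 + 1 / κ) * (V * |T| / ε) := by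
  have hκ := h.pos
  have hε := h.precision_pos
  rw [add_mul]
  gcongr ?_ + ?_
  · rw [div_mul_eq_mul_div, le_div_iff₀ (by positivity)]
    gcongr
    exact h.cube_le
  · rw [one_div_mul_eq_div, le_div_iff₀ hκ, div_mul_eq_mul_div, mul_comm |T|]
    gcongr
    exact h.le_potential

end ParameterRegime

theorem exists_log_le_log_costScale_sq {κ : ℝ} (hκ : 0 < κ) :
    ∃ K : ℝ, 0 < K ∧ ∀ {V T ε : ℝ} {k : ℕ}, ParameterRegime κ V T ε → k ≠ 0 →
      Real.log (2 + |T| / ε) ≤ K * Real.log (2 + costScale k V T ε) ^ 2 := by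
  have : 0 < Real.log 2 := Real.log_pos one_lt_two
  have hd : 0 < (κ ^ 2 * min 1 (κ ^ 3))⁻¹ := by positivity
  set K₁ := |Real.log (κ ^ 2 * min 1 (κ ^ 3))⁻¹| / Real.log 2 + 1
  set K₂ := |Real.log (2 / κ ^ 3 + 1 / κ)| / Real.log 2 ^ 2
  refine ⟨K₂ + 2 * K₁ ^ 2, by positivity, fun {V T ε k} h hk => ?_⟩
  have hg := h.costScale_pos k
  have hy := h.action_pos
  have hG := log_two_le_log_two_add hg.le
  set G := Real.log (2 + costScale k V T ε)
  have hconst : Real.log (2 / κ ^ 3 + 1 / κ) ≤ K₂ * G ^ 2 := by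
    refine (le_abs_self _).trans ?_
    rw [div_mul_eq_mul_div, le_div_iff₀ (by positivity)]
    gcongr
  have haction : Real.log (V * |T| / ε) ≤ 2 * (K₁ * G) ^ 2 := by
    refine (h.log_action_le hk).trans ?_
    gcongr
    · exact k.cast_nonneg.trans (h.natCast_le_log k)
    · exact log_mul_le_mul_log_two_add hd hg
  have := h.two_add_time_div_le
  have := h.precision_pos
  calc Real.log (2 + |T| / ε) ≤ Real.log ((2 / κ ^ 3 + 1 / κ) * (V * |T| / ε)) := by
        gcongr
    _ = Real.log (2 / κ ^ 3 + 1 / κ) + Real.log (V * |T| / ε) :=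
        Real.log_mul (by positivity) hy.ne'
    _ ≤ K₂ * G ^ 2 + 2 * (K₁ * G) ^ 2 := add_le_add hconst haction
    _ = (K₂ + 2 * K₁ ^ 2) * G ^ 2 := by ring

/-- The constant relating the number of exponentials in the product formula to the cost scale. -/
def stepConstant (κ : ℝ) : ℝ := 24 * (1 + 1 / κ ^ 2) * (24 + 1 / κ ^ 3)

theorem ParameterRegime.steps_mul_le {κ V T ε : ℝ} (h : ParameterRegime κ V T ε) {a : ℝ}
    (ha : 1 ≤ a) (k : ℕ) {r : ℝ} (hr : r ≤ 1 + 3 ^ k * (a * V) * |T|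
      * (1 + 24 * (3 ^ k * (a * V) * |T| / ε)) ^ ((2 * (k + 1) : ℕ) : ℝ)⁻¹) :
    r * (8 * 5 ^ k) ≤ stepConstant κ * a ^ 2 * costScale (k + 1) V T ε := by
  have hκ := h.pos
  have hP := h.sq_le
  have hy := h.action_pos
  have hroot := rpow_one_add_le hκ ha h.cube_le k
  rw [h.costScale_eq]
  rw [show 3 ^ k * (a * V) * |T| / ε = 3 ^ k * (a * (V * |T| / ε)) by ring,
    show 3 ^ k * (a * V) * |T| = 3 ^ k * (a * (V * |T|)) by ring] at hr
  have hP0 : 0 < V * |T| := (by positivity : 0 < κ ^ 2).trans_le hP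
  set P := V * |T|
  set y := P / ε
  set z := (1 + 24 * (3 ^ k * (a * y))) ^ ((2 * (k + 1) : ℕ) : ℝ)⁻¹
  set w := y ^ ((2 * (k + 1) : ℕ) : ℝ)⁻¹
  have hthree : (1 : ℝ) ≤ 3 ^ k := one_le_pow₀ (by norm_num)
  have hz : 1 ≤ z := Real.one_le_rpow (by
    linarith [show 0 ≤ 24 * (3 ^ k * (a * y)) by positivity]) (by positivity)
  have hone : 1 ≤ 1 / κ ^ 2 * (3 ^ k * (a * P) * z) :=
    calc (1 : ℝ) = 1 / κ ^ 2 * (1 * (1 * κ ^ 2) * 1) := by field_simp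
      _ ≤ _ := by gcongr
  have hfifteen : (3 : ℝ) ^ k * 5 ^ k ≤ 25 ^ (k + 1) := by
    rw [← mul_pow, pow_succ]
    exact (pow_le_pow_left₀ (by norm_num) (by norm_num) k).trans
      (le_mul_of_one_le_right (by positivity) (by norm_num))
  calc r * (8 * 5 ^ k) ≤ (1 + 1 / κ ^ 2) * (3 ^ k * (a * P) * z) * (8 * 5 ^ k) := by
        gcongr
        linarith
    _ ≤ (1 + 1 / κ ^ 2) * (3 ^ k * (a * P) * ((24 + 1 / κ ^ 3) * (3 * (a * w)))) * (8 * 5 ^ k) := by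
        gcongr
    _ = stepConstant κ * a ^ 2 * (3 ^ k * 5 ^ k * P * w) := by rw [stepConstant]; ring
    _ ≤ stepConstant κ * a ^ 2 * (25 ^ (k + 1) * P * w) := by
        have : 0 < stepConstant κ := by rw [stepConstant]; positivity
        gcongr

end Parameters

/-! ## Exact circuit synthesis -/

section Synthesis

open Matrix

variable {q : ℕ}

/-- The inverse gate. -/
def Gate.adj : Gate q → Gate q
  | .one i U => .one i U⁻¹
  | .two i j h U => .two i j h U⁻¹

theorem Gate.matrix_adj (g : Gate q) : g.adj.matrix = g.matrixᴴ := by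
  cases g <;>
  · ext b b'
    rw [conjTranspose_apply]
    simp only [Gate.adj, Gate.matrix, eq_comm (a := b _)]
    rw [apply_ite star, star_zero]
    rfl

theorem exists_adjoint_circuit (c : Circuit q) :
    ∃ c' : Circuit q, circuitMatrix c' = (circuitMatrix c)ᴴ ∧ c'.length = c.length := by
  induction c using FreeMonoid.inductionOn' with
  | one => exact ⟨1, by simp [circuitMatrix], rfl⟩
  | of_mul g c ih =>
    obtain ⟨c', hc', hlength⟩ := ih
    refine ⟨c' * FreeMonoid.of g.adj, ?_, ?_⟩
    · simp only [circuitMatrix, map_mul, FreeMonoid.lift_eval_of, conjTranspose_mul,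
        Gate.matrix_adj] at hc' ⊢
      rw [hc']
    · rw [FreeMonoid.length_mul, FreeMonoid.length_mul, FreeMonoid.length_of, FreeMonoid.length_of,
        hlength, add_comm]

/-- `M` is a unitary matrix realized exactly by a circuit of at most `L` gates. -/
def Implementable (L : ℕ) (M : Matrix (Reg q) (Reg q) ℂ) : Prop :=
  M ∈ unitaryGroup (Reg q) ℂ ∧ ∃ c : Circuit q, circuitMatrix c = M ∧ c.length ≤ L

namespace Implementable

variable {L L' : ℕ} {M M' : Matrix (Reg q) (Reg q) ℂ}

theorem mono (h : Implementable L M) (hL : L ≤ L') : Implementable L' M :=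
  ⟨h.1, h.2.imp fun _ hc => ⟨hc.1, hc.2.trans hL⟩⟩

theorem one : Implementable 0 (1 : Matrix (Reg q) (Reg q) ℂ) :=
  ⟨one_mem _, 1, map_one _, le_rfl⟩

theorem mul (h : Implementable L M) (h' : Implementable L' M') :
    Implementable (L + L') (M * M') := by
  obtain ⟨hM, c, rfl, hc⟩ := h
  obtain ⟨hM', c', rfl, hc'⟩ := h'
  refine ⟨mul_mem hM hM', c * c', map_mul _ _ _, ?_⟩
  rw [FreeMonoid.length_mul]
  exact add_le_add hc hc'

theorem conjTranspose (h : Implementable L M) : Implementable L Mᴴ := by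
  obtain ⟨hM, c, rfl, hc⟩ := h
  obtain ⟨c', hc', hlength⟩ := exists_adjoint_circuit c
  exact ⟨Unitary.star_mem hM, c', hc', hlength.le.trans hc⟩

theorem gate (g : Gate q) (hg : g.matrix ∈ unitaryGroup (Reg q) ℂ) : Implementable 1 g.matrix :=
  ⟨hg, FreeMonoid.of g, FreeMonoid.lift_eval_of _ _, le_rfl⟩

end Implementable

theorem agree_off_iff (i : Qubit q) (b b' : Reg q) :
    (∀ l, l ≠ i → b l = b' l) ↔ b' = Function.update b i (b' i) := by
  rw [Function.eq_update_iff]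
  simp only [true_and, ne_eq, eq_comm]

open Classical in
/-- The one-qubit matrix `u b` applied to the qubit `i`; it may depend on the label `b`, so that
the other qubits act as controls. -/
def controlled (i : Qubit q) (u : Reg q → Matrix (Fin 2) (Fin 2) ℂ) :
    Matrix (Reg q) (Reg q) ℂ :=
  fun b b' => if ∀ l, l ≠ i → b l = b' l then u b (b i) (b' i) else 0

open Classical in
theorem sum_agree_off (i : Qubit q) (b : Reg q) (F : Reg q → ℂ) :
    (∑ b', if ∀ l, l ≠ i → b l = b' l then F b' else 0)
      = ∑ s, F (Function.update b i s) := by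
  rw [← Finset.sum_filter]
  refine (Finset.sum_bij (fun s _ => Function.update b i s) ?_ ?_ ?_ fun _ _ => rfl).symm
  · intro s _
    rw [Finset.mem_filter, agree_off_iff, Function.update_self]
    exact ⟨Finset.mem_univ _, rfl⟩
  · exact fun s _ s' _ h => Function.update_injective b i h
  · intro b' hb'
    exact ⟨b' i, Finset.mem_univ _, ((agree_off_iff i b b').1 (Finset.mem_filter.1 hb').2).symm⟩

theorem controlled_mulVec (i : Qubit q) (u : Reg q → Matrix (Fin 2) (Fin 2) ℂ) (v : Reg q → ℂ)
    (b : Reg q) :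
    (controlled i u *ᵥ v) b = (u b *ᵥ fun s => v (Function.update b i s)) (b i) := by
  simp only [mulVec, dotProduct, controlled, ite_mul, zero_mul]
  rw [sum_agree_off i b (fun b' => u b (b i) (b' i) * v b')]
  simp only [Function.update_self]

theorem controlled_mul (i : Qubit q) (u u' : Reg q → Matrix (Fin 2) (Fin 2) ℂ)
    (h : ∀ b s, u' (Function.update b i s) = u' b) :
    controlled i u * controlled i u' = controlled i (fun b => u b * u' b) := by
  classical
  ext b b''
  simp only [Matrix.mul_apply, controlled, ite_mul, zero_mul]
  rw [sum_agree_off i b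
    (fun b' => u b (b i) (b' i) * if ∀ l, l ≠ i → b' l = b'' l then u' b' (b' i) (b'' i) else 0)]
  have hagree (s) :
      (∀ l, l ≠ i → Function.update b i s l = b'' l) ↔ ∀ l, l ≠ i → b l = b'' l :=
    forall₂_congr fun l hl => by rw [Function.update_of_ne hl]
  simp only [hagree, h, Function.update_self]
  split_ifs <;> simp

theorem controlled_diagonal (i : Qubit q) (u : Reg q → Fin 2 → ℂ) :
    controlled i (fun b => diagonal (u b)) = diagonal (fun b => u b (b i)) := by
  ext b b'
  simp only [controlled, diagonal_apply, ← ite_and]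
  refine if_congr ?_ rfl rfl
  rw [agree_off_iff]
  constructor
  · rintro ⟨hb', hi⟩
    rw [hb', ← hi, Function.update_eq_self]
  · rintro rfl
    exact ⟨(Function.update_eq_self i b).symm, rfl⟩

theorem one_matrix_eq_controlled (i : Qubit q) (U : unitaryGroup (Fin 2) ℂ) :
    (Gate.one i U).matrix = controlled i (fun _ => U) := rfl

theorem one_matrix_mem_unitary (i : Qubit q) (U : unitaryGroup (Fin 2) ℂ) :
    (Gate.one i U).matrix ∈ unitaryGroup (Reg q) ℂ := by
  rw [mem_unitaryGroup_iff, star_eq_conjTranspose, ← Gate.matrix_adj, Gate.adj,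
    one_matrix_eq_controlled, one_matrix_eq_controlled, controlled_mul _ _ _ (fun _ _ => rfl)]
  simp only [← Submonoid.coe_mul, mul_inv_cancel, OneMemClass.coe_one]
  rw [← diagonal_one, controlled_diagonal, diagonal_one]

section Phase

variable {ι : Type} [DecidableEq ι]

/-- The diagonal unitary with phases `f`. -/
def phaseMatrix (f : ι → ℝ) : Matrix ι ι ℂ :=
  diagonal fun b => exp (I * (f b : ℂ))

theorem phaseMatrix_zero : phaseMatrix (0 : ι → ℝ) = 1 := by
  simp [phaseMatrix]

theorem phaseMatrix_single (b : ι) (θ : ℝ) :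
    phaseMatrix (Pi.single b θ) = 1 + (exp (I * (θ : ℂ)) - 1) • Matrix.single b b 1 := by
  rw [← diagonal_single, ← diagonal_one, ← diagonal_smul, diagonal_add, phaseMatrix]
  congr 1
  ext c
  rcases eq_or_ne c b with rfl | hc
  · simp
  · simp [hc]

variable [Fintype ι]

theorem phaseMatrix_add (f g : ι → ℝ) :
    phaseMatrix (f + g) = phaseMatrix f * phaseMatrix g := by
  simp only [phaseMatrix, diagonal_mul_diagonal, Pi.add_apply, Complex.ofReal_add, mul_add,
    Complex.exp_add]

theorem phaseMatrix_mem_unitary (f : ι → ℝ) : phaseMatrix f ∈ unitaryGroup ι ℂ := by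
  have hconj : (phaseMatrix f)ᴴ = phaseMatrix (-f) := by
    rw [phaseMatrix, diagonal_conjTranspose, phaseMatrix]
    congr 1
    ext b
    simp [← Complex.exp_conj]
  rw [mem_unitaryGroup_iff, star_eq_conjTranspose, hconj, ← phaseMatrix_add, add_neg_cancel,
    phaseMatrix_zero]

theorem conj_phaseMatrix_single {V : Matrix ι ι ℂ} (hV : V ∈ unitaryGroup ι ℂ) (b : ι) (θ : ℝ) :
    V * phaseMatrix (Pi.single b θ) * Vᴴ
      = 1 + (exp (I * (θ : ℂ)) - 1) • vecMulVec (V.col b) (star (V.col b)) := by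
  rw [phaseMatrix_single, mul_add, add_mul, mul_one, ← star_eq_conjTranspose,
    mem_unitaryGroup_iff.1 hV, mul_smul_comm, smul_mul_assoc, single_eq_single_vecMulVec_single,
    mul_vecMulVec, vecMulVec_mul, mulVec_single_one, single_one_vecMul, star_eq_conjTranspose]
  rfl

end Phase

theorem Implementable.conj_phaseMatrix_sum {ι : Type} {V : Matrix (Reg q) (Reg q) ℂ}
    (hV : V ∈ unitaryGroup (Reg q) ℂ) {L : ℕ} {f : ι → Reg q → ℝ}
    (hf : ∀ i, Implementable L (V * phaseMatrix (f i) * Vᴴ)) (s : Finset ι) :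
    Implementable (s.card * L) (V * phaseMatrix (∑ i ∈ s, f i) * Vᴴ) := by
  classical
  induction s using Finset.induction_on with
  | empty =>
    rw [Finset.sum_empty, phaseMatrix_zero, mul_one, ← star_eq_conjTranspose,
      mem_unitaryGroup_iff.1 hV, Finset.card_empty, zero_mul]
    exact .one
  | insert i s hi ih =>
    have hsplit : V * phaseMatrix (f i + ∑ i ∈ s, f i) * Vᴴ
        = (V * phaseMatrix (f i) * Vᴴ) * (V * phaseMatrix (∑ i ∈ s, f i) * Vᴴ) := by
      have hVV : Vᴴ * V = 1 := mem_unitaryGroup_iff'.1 hV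
      simp only [phaseMatrix_add, mul_assoc]
      rw [← mul_assoc Vᴴ V, hVV, one_mul]
    rw [Finset.sum_insert hi, Finset.card_insert_of_notMem hi, hsplit]
    exact ((hf i).mul ih).mono (by ring_nf; rfl)

theorem controlled_phaseMatrix (i : Qubit q) (f : Reg q → Fin 2 → ℝ) :
    controlled i (fun b => phaseMatrix (f b)) = phaseMatrix fun b => f b (b i) :=
  controlled_diagonal i fun b s => exp (I * (f b s : ℂ))

theorem implementable_phase_of_qubit (i : Qubit q) (f : Fin 2 → ℝ) :
    Implementable 1 (phaseMatrix fun b : Reg q => f (b i)) := by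
  rw [← controlled_phaseMatrix i fun _ => f]
  exact .gate (Gate.one i ⟨_, phaseMatrix_mem_unitary f⟩) (one_matrix_mem_unitary i _)

/-- The controlled-not gate with target the first factor and control the second. -/
def cnot : Matrix (Fin 2 × Fin 2) (Fin 2 × Fin 2) ℂ :=
  fun x y => if x = (y.1 + y.2, y.2) then 1 else 0

theorem cnot_mem_unitary : cnot ∈ unitaryGroup (Fin 2 × Fin 2) ℂ := by
  rw [mem_unitaryGroup_iff]
  ext ⟨a, b⟩ ⟨c, d⟩
  fin_cases a <;> fin_cases b <;> fin_cases c <;> fin_cases d <;>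
    simp [cnot, Matrix.mul_apply, Fintype.sum_prod_type]

/-- The action on basis labels of the controlled-not gate with target `i` and control `j`. -/
def cnotLabel (i j : Qubit q) (b : Reg q) : Reg q := Function.update b i (b i + b j)

theorem cnotLabel_cnotLabel {i j : Qubit q} (h : i ≠ j) (b : Reg q) :
    cnotLabel i j (cnotLabel i j b) = b := by
  have hadd : ∀ x y : Fin 2, x + y + y = x := by decide
  rw [cnotLabel, cnotLabel, Function.update_self, Function.update_of_ne h.symm,
    Function.update_idem, hadd, Function.update_eq_self]

theorem eq_cnotLabel_iff {i j : Qubit q} (h : i ≠ j) (b b' : Reg q) :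
    b' = cnotLabel i j b ↔
      (∀ l, l ≠ i → l ≠ j → b l = b' l) ∧ (b i, b j) = (b' i + b' j, b' j) := by
  have hadd : ∀ x y z : Fin 2, x = z + y ↔ z = x + y := by decide
  rw [cnotLabel, Function.eq_update_iff, Prod.mk.injEq]
  constructor
  · rintro ⟨hi, hoff⟩
    have hj := hoff j h.symm
    exact ⟨fun l hl _ => (hoff l hl).symm, by rw [hadd, hi, hj], hj.symm⟩
  · rintro ⟨hoff, hi, hj⟩
    refine ⟨by rw [hj, ← hadd]; exact hi, fun l hl => ?_⟩
    rcases eq_or_ne l j with rfl | hlj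
    · exact hj.symm
    · exact (hoff l hl hlj).symm

theorem cnot_matrix_apply {i j : Qubit q} (h : i ≠ j) (b b' : Reg q) :
    (Gate.two i j h ⟨cnot, cnot_mem_unitary⟩).matrix b b'
      = if b' = cnotLabel i j b then 1 else 0 := by
  simp only [Gate.matrix, cnot, ← ite_and, ← eq_cnotLabel_iff h]

theorem cnot_conj_diagonal {i j : Qubit q} (h : i ≠ j) (d : Reg q → ℂ) :
    (Gate.two i j h ⟨cnot, cnot_mem_unitary⟩).matrix * diagonal d
      * (Gate.two i j h ⟨cnot, cnot_mem_unitary⟩).matrix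
      = diagonal fun b => d (cnotLabel i j b) := by
  ext b b'
  rw [Matrix.mul_apply]
  simp only [Matrix.mul_diagonal, cnot_matrix_apply, diagonal_apply]
  rw [Finset.sum_eq_single (cnotLabel i j b) (fun x _ hx => by simp [hx]) (by simp)]
  simp only [if_true, one_mul, cnotLabel_cnotLabel h, mul_ite, mul_one, mul_zero, eq_comm (a := b')]

theorem cnot_matrix_mem_unitary {i j : Qubit q} (h : i ≠ j) :
    (Gate.two i j h ⟨cnot, cnot_mem_unitary⟩).matrix ∈ unitaryGroup (Reg q) ℂ := by
  have hstar : star (Gate.two i j h ⟨cnot, cnot_mem_unitary⟩).matrix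
      = (Gate.two i j h ⟨cnot, cnot_mem_unitary⟩).matrix := by
    ext b b'
    rw [star_apply, cnot_matrix_apply, cnot_matrix_apply]
    have hswap : b = cnotLabel i j b' ↔ b' = cnotLabel i j b := by
      constructor <;> (rintro rfl; rw [cnotLabel_cnotLabel h])
    simp only [hswap, apply_ite star, star_one, star_zero]
  rw [mem_unitaryGroup_iff, hstar]
  simpa using cnot_conj_diagonal h (fun _ => 1)

/-- The Walsh function of a set `S` of qubits: the sign character of their parity. -/
def walsh (S : Finset (Qubit q)) (b : Reg q) : ℝ := ∏ i ∈ S, (-1 : ℝ) ^ (b i : ℕ)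

theorem walsh_insert_cnotLabel {i j : Qubit q} {S : Finset (Qubit q)} (hij : i ≠ j) (hi : i ∉ S)
    (hj : j ∉ S) (b : Reg q) :
    walsh (insert i S) (cnotLabel i j b) = walsh (insert i (insert j S)) b := by
  have hsign : ∀ x y : Fin 2,
      (-1 : ℝ) ^ ((x + y : Fin 2) : ℕ) = (-1) ^ (x : ℕ) * (-1) ^ (y : ℕ) := by
    intro x y
    fin_cases x <;> fin_cases y <;> simp
  have hoff : ∏ l ∈ S, (-1 : ℝ) ^ (cnotLabel i j b l : ℕ) = ∏ l ∈ S, (-1 : ℝ) ^ (b l : ℕ) :=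
    Finset.prod_congr rfl fun l hl => by
      rw [cnotLabel, Function.update_of_ne (ne_of_mem_of_not_mem hl hi)]
  rw [walsh, walsh, Finset.prod_insert hi, Finset.prod_insert (by simp [hij, hi]),
    Finset.prod_insert hj, hoff, cnotLabel, Function.update_self, hsign, mul_assoc]

theorem implementable_walsh (a : ℝ) (S : Finset (Qubit q)) :
    Implementable (2 * S.card + 1) (phaseMatrix fun b => a * walsh S b) := by
  rcases S.eq_empty_or_nonempty with rfl | ⟨i, hi⟩
  · simpa [walsh] using implementable_phase_of_qubit (Sum.inl 0 : Qubit q) (fun _ => a)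
  obtain ⟨S, hiS, rfl⟩ : ∃ S', i ∉ S' ∧ S = insert i S' :=
    ⟨S.erase i, Finset.notMem_erase i S, (Finset.insert_erase hi).symm⟩
  clear hi
  induction S using Finset.induction_on with
  | empty =>
    refine Implementable.mono (L := 1) ?_ (by simp)
    simpa [walsh] using implementable_phase_of_qubit i (fun s => a * (-1) ^ (s : ℕ))
  | insert j S hj ih =>
    obtain ⟨hij, hiS⟩ := not_or.1 (Finset.mem_insert.not.1 hiS)
    have hcnot := Implementable.gate _ (cnot_matrix_mem_unitary hij)
    have h := (hcnot.mul (ih hiS)).mul hcnot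
    rw [phaseMatrix, cnot_conj_diagonal] at h
    simp only [walsh_insert_cnotLabel hij hiS hj] at h
    refine h.mono ?_
    rw [Finset.card_insert_of_notMem hiS, Finset.card_insert_of_notMem (by simp [hij, hiS]),
      Finset.card_insert_of_notMem hj]
    omega

theorem sum_walsh_mul_walsh (b c : Reg q) :
    ∑ S : Finset (Qubit q), walsh S b * walsh S c
      = if b = c then (2 : ℝ) ^ Fintype.card (Qubit q) else 0 := by
  have hfactor : ∀ x y : Fin 2,
      (1 + (-1 : ℝ) ^ (x : ℕ) * (-1) ^ (y : ℕ)) = if x = y then 2 else 0 := by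
    intro x y
    fin_cases x <;> fin_cases y <;> norm_num
  have hprod : ∑ S : Finset (Qubit q), walsh S b * walsh S c
      = ∏ i : Qubit q, if b i = c i then (2 : ℝ) else 0 := by
    simp only [← hfactor]
    rw [Finset.prod_one_add, Finset.powerset_univ]
    simp only [walsh, Finset.prod_mul_distrib]
  rw [hprod]
  split_ifs with hbc
  · simp [hbc]
  · obtain ⟨i, hi⟩ := Function.ne_iff.1 hbc
    exact Finset.prod_eq_zero (Finset.mem_univ i) (if_neg hi)

theorem sum_walsh_coeff_mul_walsh (f : Reg q → ℝ) :
    ∑ S : Finset (Qubit q), (fun b =>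
      ((2 ^ Fintype.card (Qubit q))⁻¹ * ∑ c, f c * walsh S c) * walsh S b) = f := by
  funext b
  rw [Finset.sum_apply]
  simp only [mul_assoc, Finset.sum_mul]
  rw [← Finset.mul_sum, Finset.sum_comm]
  simp only [mul_comm (walsh _ _) (walsh _ _), ← Finset.mul_sum, sum_walsh_mul_walsh, mul_ite,
    mul_zero, Finset.sum_ite_eq, Finset.mem_univ, if_true]
  field_simp

/-- The number of gates used for a diagonal unitary. -/
def phaseCost (q : ℕ) : ℕ := 2 ^ Fintype.card (Qubit q) * (2 * Fintype.card (Qubit q) + 1)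

/- Walsh expansion: each Walsh phase is a one-qubit phase conjugated by controlled-not gates. -/
theorem implementable_phaseMatrix (f : Reg q → ℝ) :
    Implementable (phaseCost q) (phaseMatrix f) := by
  have h := Implementable.conj_phaseMatrix_sum (one_mem _) (fun S : Finset (Qubit q) => by
    rw [conjTranspose_one, one_mul, mul_one]
    exact (implementable_walsh ((2 ^ Fintype.card (Qubit q))⁻¹ * ∑ c, f c * walsh S c) S).mono
      (by have := S.card_le_univ; omega : _ ≤ 2 * Fintype.card (Qubit q) + 1)) Finset.univ
  rwa [conjTranspose_one, one_mul, mul_one, sum_walsh_coeff_mul_walsh, Finset.card_univ,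
    Fintype.card_finset] at h

/-- The change of basis that diagonalizes plane rotations. -/
def rotBasis : Matrix (Fin 2) (Fin 2) ℂ := (((Real.sqrt 2)⁻¹ : ℝ) : ℂ) • !![1, 1; I, -I]

theorem rotBasis_conj_diagonal (x y : ℂ) :
    rotBasis * diagonal ![x, y] * rotBasisᴴ
      = (1 / 2 : ℂ) • !![x + y, -(I * (x - y)); I * (x - y), x + y] := by
  have hnormalization : (((Real.sqrt 2)⁻¹ : ℝ) : ℂ) * (((Real.sqrt 2)⁻¹ : ℝ) : ℂ) = 1 / 2 := by
    rw [← Complex.ofReal_mul, ← mul_inv, Real.mul_self_sqrt (by norm_num)]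
    norm_num
  rw [rotBasis, conjTranspose_smul, smul_mul_assoc, smul_mul_assoc, mul_smul_comm, smul_smul,
    RCLike.star_def, Complex.conj_ofReal, hnormalization]
  congr 1
  ext i j
  simp only [Matrix.mul_apply, Fin.sum_univ_two, conjTranspose_apply]
  have hI : I * I = -1 := I_mul_I
  fin_cases i <;> fin_cases j <;> simp <;> grind

theorem rotBasis_mem_unitary : rotBasis ∈ unitaryGroup (Fin 2) ℂ := by
  have hone : diagonal ![(1 : ℂ), 1] = 1 := by
    ext i j
    fin_cases i <;> fin_cases j <;> simp
  have h := rotBasis_conj_diagonal 1 1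
  rw [hone, mul_one] at h
  rw [mem_unitaryGroup_iff, star_eq_conjTranspose, h]
  ext i j
  fin_cases i <;> fin_cases j <;> norm_num

/-- The rotation of the plane by the angle `-θ`. -/
def planeRot (θ : ℝ) : Matrix (Fin 2) (Fin 2) ℂ :=
  !![(Real.cos θ : ℂ), (Real.sin θ : ℂ); -(Real.sin θ : ℂ), (Real.cos θ : ℂ)]

theorem planeRot_eq (θ : ℝ) :
    planeRot θ = rotBasis * phaseMatrix (fun s : Fin 2 => θ * (-1) ^ (s : ℕ)) * rotBasisᴴ := by
  have hphases : (fun s : Fin 2 => exp (I * ((θ * (-1) ^ (s : ℕ) : ℝ) : ℂ)))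
      = ![exp (θ * I), exp (-θ * I)] := by
    funext s
    fin_cases s <;> simp [mul_comm]
  rw [phaseMatrix, hphases, rotBasis_conj_diagonal, planeRot, Complex.ofReal_cos,
    Complex.ofReal_sin, Complex.cos, Complex.sin]
  ext i j
  fin_cases i <;> fin_cases j <;> simp <;> ring

theorem planeRot_arg_mulVec (x y : ℝ) :
    planeRot (arg ⟨x, y⟩) *ᵥ ![(x : ℂ), (y : ℂ)] = ![(√(x ^ 2 + y ^ 2) : ℂ), 0] := by
  have hre : ‖(⟨x, y⟩ : ℂ)‖ * Real.cos (arg ⟨x, y⟩) = x := Complex.norm_mul_cos_arg ⟨x, y⟩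
  have him : ‖(⟨x, y⟩ : ℂ)‖ * Real.sin (arg ⟨x, y⟩) = y := Complex.norm_mul_sin_arg ⟨x, y⟩
  have hnorm : ‖(⟨x, y⟩ : ℂ)‖ = √(x ^ 2 + y ^ 2) := by
    rw [Complex.norm_def, Complex.normSq_mk, pow_two, pow_two]
  rw [← hnorm]
  generalize arg ⟨x, y⟩ = θ at *
  generalize ‖(⟨x, y⟩ : ℂ)‖ = r at *
  subst hre him
  have hcircle : (Real.sin θ : ℂ) ^ 2 + (Real.cos θ : ℂ) ^ 2 = 1 := by
    exact_mod_cast Real.sin_sq_add_cos_sq θ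
  funext s
  fin_cases s
  · simp only [planeRot, Fin.zero_eta, mulVec, of_apply, vec2_dotProduct, Complex.ofReal_mul,
      cons_val_zero, cons_val_one]
    linear_combination (r : ℂ) * hcircle
  · simp only [planeRot, Fin.mk_one, mulVec, of_apply, vec2_dotProduct, Complex.ofReal_mul,
      cons_val_zero, cons_val_one]
    ring

theorem implementable_controlled_planeRot (i : Qubit q) (θ : Reg q → ℝ)
    (hθ : ∀ b s, θ (Function.update b i s) = θ b) :
    Implementable (phaseCost q + 2) (controlled i fun b => planeRot (θ b)) := by
  have hbasis := Implementable.gate _ (one_matrix_mem_unitary i ⟨_, rotBasis_mem_unitary⟩)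
  have h := (hbasis.mul (implementable_phaseMatrix (fun b => θ b * (-1) ^ (b i : ℕ)))).mul
    hbasis.conjTranspose
  rw [← Gate.matrix_adj, Gate.adj, one_matrix_eq_controlled, one_matrix_eq_controlled,
    ← controlled_phaseMatrix i fun b s => θ b * (-1) ^ (s : ℕ),
    controlled_mul _ _ _ (fun b s => by simp only [hθ]), controlled_mul _ _ _ (fun _ _ => rfl)] at h
  simp only [planeRot_eq]
  exact h.mono (by omega)

/-- The number of gates used to map a vector to a multiple of a basis vector. -/
def prepCost (q : ℕ) : ℕ := phaseCost q + Fintype.card (Qubit q) * (phaseCost q + 2)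

theorem exists_implementable_mulVec_eq_norm (v : Reg q → ℂ) :
    ∃ M : Matrix (Reg q) (Reg q) ℂ, Implementable (phaseCost q) M ∧
      M *ᵥ v = fun b => ((‖v b‖ : ℝ) : ℂ) := by
  refine ⟨_, implementable_phaseMatrix (fun b => -arg (v b)), ?_⟩
  funext b
  rw [phaseMatrix, mulVec_diagonal]
  nth_rw 2 [← Complex.norm_mul_exp_arg_mul_I (v b)]
  rw [mul_left_comm, ← Complex.exp_add]
  simp [mul_comm]

/- Rotating the qubit `i` in the planes spanned by the labels that differ only at `i` moves all the
weight to the labels with `b i = 0`. -/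
theorem exists_implementable_support (v : Reg q → ℂ) (S : Finset (Qubit q)) :
    ∃ (M : Matrix (Reg q) (Reg q) ℂ) (w : Reg q → ℝ),
      Implementable (phaseCost q + S.card * (phaseCost q + 2)) M ∧
      M *ᵥ v = (fun b => (w b : ℂ)) ∧ ∀ b, w b ≠ 0 → ∀ i ∈ S, b i = 0 := by
  induction S using Finset.induction_on with
  | empty =>
    obtain ⟨M, hM, h⟩ := exists_implementable_mulVec_eq_norm v
    exact ⟨M, _, by simpa using hM, h, by simp⟩
  | insert i S hi ih =>
    obtain ⟨M, w, hM, hw, hS⟩ := ih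
    let θ : Reg q → ℝ := fun b => arg ⟨w (Function.update b i 0), w (Function.update b i 1)⟩
    have hrot := implementable_controlled_planeRot i θ (fun b s => by
      simp only [θ, Function.update_idem])
    refine ⟨_, fun b => (![√(w (Function.update b i 0) ^ 2 + w (Function.update b i 1) ^ 2), 0] :
      Fin 2 → ℝ) (b i), (hrot.mul hM).mono ?_, ?_, ?_⟩
    · rw [Finset.card_insert_of_notMem hi]
      linarith
    · rw [← mulVec_mulVec, hw]
      funext b
      have hpair : (fun s => (w (Function.update b i s) : ℂ))
          = ![(w (Function.update b i 0) : ℂ), (w (Function.update b i 1) : ℂ)] := by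
        funext s
        fin_cases s <;> rfl
      rw [controlled_mulVec, hpair, planeRot_arg_mulVec]
      rcases Fin.exists_fin_two.1 ⟨b i, rfl⟩ with hb | hb <;> simp [hb]
    · intro b hb
      have hbi : b i = 0 := by
        rcases Fin.exists_fin_two.1 ⟨b i, rfl⟩ with h | h
        · exact h
        · simp [h] at hb
      refine (Finset.forall_mem_insert ..).2 ⟨hbi, fun l hl => ?_⟩
      by_contra hbl
      have hvanish (s) : w (Function.update b i s) = 0 := by
        by_contra h
        refine hbl ?_
        rw [← hS _ h l hl, Function.update_of_ne (ne_of_mem_of_not_mem hl hi)]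
      simp [hbi, hvanish] at hb

theorem exists_implementable_prep (v : Reg q → ℂ) :
    ∃ (M : Matrix (Reg q) (Reg q) ℂ) (c : ℂ), Implementable (prepCost q) M ∧
      M *ᵥ v = Pi.single 0 c := by
  obtain ⟨M, w, hM, hw, hsupport⟩ := exists_implementable_support v Finset.univ
  refine ⟨M, w 0, hM, ?_⟩
  rw [hw]
  funext b
  by_cases hb : b = 0
  · rw [hb, Pi.single_eq_same]
  · rw [Pi.single_eq_of_ne hb]
    by_contra h
    exact hb (funext fun i => hsupport b (by exact_mod_cast h) i (Finset.mem_univ i))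

/- If `M v = c e₀` with `M` unitary and `|c| = 1`, then `c̄ v` is the first column of `M⁻¹`, so the
rank-one phase along `v` is a phase of the single label `0` conjugated by `M`. -/
theorem implementable_rankOne (v : Reg q → ℂ) (hv : star v ⬝ᵥ v = 1) (θ : ℝ) :
    Implementable (2 * prepCost q + phaseCost q)
      (1 + (exp (I * (θ : ℂ)) - 1) • vecMulVec v (star v)) := by
  obtain ⟨M, c, hM, hMv⟩ := exists_implementable_prep v
  have hMM : Mᴴ * M = 1 := mem_unitaryGroup_iff'.1 hM.1
  have hcol : v = c • Mᴴ.col 0 := by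
    rw [← mulVec_single_one, ← mulVec_smul, ← Pi.single_smul, smul_eq_mul, mul_one, ← hMv,
      mulVec_mulVec, hMM, one_mulVec]
  have hc : c * star c = 1 := by
    have hnorm : star (M *ᵥ v) ⬝ᵥ (M *ᵥ v) = 1 := by
      rw [star_mulVec, ← dotProduct_mulVec, mulVec_mulVec, hMM, one_mulVec, hv]
    rw [hMv, dotProduct_single, Pi.star_apply, Pi.single_eq_same] at hnorm
    rw [mul_comm, hnorm]
  have h := (hM.conjTranspose.mul (implementable_phaseMatrix (Pi.single 0 θ))).mul hM
  rw [← conjTranspose_conjTranspose M, conjTranspose_conjTranspose Mᴴ,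
    conj_phaseMatrix_single hM.conjTranspose.1] at h
  rw [hcol, star_smul, smul_vecMulVec, vecMulVec_smul, smul_smul c, hc, one_smul]
  exact h.mono (by omega)

theorem propagator_eq_conj {H : Matrix (Reg q) (Reg q) ℂ} (hH : H.IsHermitian) (s : ℝ) :
    propagator H s = (hH.eigenvectorUnitary : Matrix (Reg q) (Reg q) ℂ)
      * phaseMatrix (fun b => -s * hH.eigenvalues b)
      * (hH.eigenvectorUnitary : Matrix (Reg q) (Reg q) ℂ)ᴴ := by
  have hV := mem_unitaryGroup_iff.1 hH.eigenvectorUnitary.2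
  rw [star_eq_conjTranspose] at hV
  have h := hH.spectral_theorem
  rw [Unitary.conjStarAlgAut_apply, star_eq_conjTranspose] at h
  set V := (hH.eigenvectorUnitary : Matrix (Reg q) (Reg q) ℂ)
  rw [← inv_eq_right_inv hV] at h ⊢
  rw [propagator]
  conv_lhs => rw [h]
  rw [← smul_mul_assoc, ← mul_smul_comm, exp_conj _ _ (IsUnit.of_mul_eq_one _ hV), ← diagonal_smul,
    exp_diagonal, phaseMatrix]
  congr 3
  funext b
  rw [Pi.coe_exp, ← Complex.exp_eq_exp_ℂ]
  simp only [Pi.smul_apply, Function.comp_apply, smul_eq_mul, coe_algebraMap, ofReal_mul,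
    ofReal_neg]
  ring_nf

theorem propagator_mem_unitary {H : Matrix (Reg q) (Reg q) ℂ} (hH : H.IsHermitian) (s : ℝ) :
    propagator H s ∈ unitaryGroup (Reg q) ℂ := by
  rw [propagator_eq_conj hH]
  exact mul_mem (mul_mem hH.eigenvectorUnitary.2 (phaseMatrix_mem_unitary _))
    (Unitary.star_mem hH.eigenvectorUnitary.2)

theorem card_reg_eq_two_pow : Fintype.card (Reg q) = 2 ^ Fintype.card (Qubit q) := by
  simp only [Fintype.card_pi, Fintype.card_fin, Finset.prod_const, Finset.card_univ]

theorem card_reg : Fintype.card (Reg q) = 4 * (2 ^ q) ^ 3 := by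
  rw [card_reg_eq_two_pow]
  simp only [Fintype.card_fin, Fintype.card_sum, Fintype.card_prod, pow_add, ← pow_mul]
  rw [mul_comm 3 q]
  norm_num

theorem card_mul_prepCost_le (q : ℕ) :
    Fintype.card (Reg q) * (2 * prepCost q + phaseCost q) ≤ 19 * Fintype.card (Reg q) ^ 4 := by
  rw [prepCost, phaseCost, ← card_reg_eq_two_pow]
  have hQ : Fintype.card (Qubit q) ≤ Fintype.card (Reg q) := by
    rw [card_reg_eq_two_pow]
    exact Nat.lt_two_pow_self.le
  have hN : 1 ≤ Fintype.card (Reg q) := Fintype.card_pos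
  generalize Fintype.card (Reg q) = N at *
  generalize Fintype.card (Qubit q) = Q at *
  have hphase : N * (2 * Q + 1) ≤ 3 * N ^ 2 := by nlinarith
  generalize N * (2 * Q + 1) = L at *
  have hprep : L + Q * (L + 2) ≤ 8 * N ^ 3 :=
    calc L + Q * (L + 2) ≤ 3 * N ^ 2 + N * (3 * N ^ 2 + 2) := by gcongr
      _ ≤ 8 * N ^ 3 := by nlinarith [Nat.mul_le_mul hN hN, Nat.pow_pos (n := 2) hN]
  calc N * (2 * (L + Q * (L + 2)) + L) ≤ N * (2 * (8 * N ^ 3) + 3 * N ^ 3) := by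
        gcongr
        exact hphase.trans (by gcongr; omega)
    _ = 19 * N ^ 4 := by ring

theorem implementable_propagator {H : Matrix (Reg q) (Reg q) ℂ} (hH : H.IsHermitian) (s : ℝ) :
    Implementable (19 * (4 * (2 ^ q) ^ 3) ^ 4) (propagator H s) := by
  have hV := hH.eigenvectorUnitary.2
  set V := (hH.eigenvectorUnitary : Matrix (Reg q) (Reg q) ℂ)
  have heigenvector (b) : star (V.col b) ⬝ᵥ V.col b = 1 := by
    simpa [Matrix.mul_apply, dotProduct] using congrFun₂ (mem_unitaryGroup_iff'.1 hV) b b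
  have h := Implementable.conj_phaseMatrix_sum hV (fun b => by
    rw [conj_phaseMatrix_single hV]
    exact implementable_rankOne (V.col b) (heigenvector b) (-s * hH.eigenvalues b)) Finset.univ
  rw [Finset.univ_sum_single fun b => -s * hH.eigenvalues b, ← propagator_eq_conj hH] at h
  refine h.mono ?_
  rw [Finset.card_univ, ← card_reg]
  exact card_mul_prepCost_le q

end Synthesis

/-! ## The register as spinor times grid -/

section Register

open Matrix

variable {q : ℕ}

/-- The register labels as pairs of a spinor label and coordinates in binary code. -/
def regEquiv (q : ℕ) : Reg q ≃ SpinIdx × (Fin 3 → Fin (2 ^ q)) :=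
  (Equiv.sumArrowEquivProdArrow _ _ _).trans <|
    Equiv.prodCongr (finTwoArrowEquiv (Fin 2)) <|
      (Equiv.curry _ _ _).trans (Equiv.arrowCongr (Equiv.refl _) finFunctionFinEquiv)

theorem regEquiv_fst (b : Reg q) : (regEquiv q b).1 = spin b := rfl

theorem gridIdx_eq (b : Reg q) (i : Fin 3) :
    gridIdx b i = (((regEquiv q b).2 i : ℕ) : ℤ) - ((2 ^ q / 2 : ℕ) : ℤ) := by
  have hcode : ((regEquiv q b).2 i : ℕ) = ∑ j : Fin q, (b (Sum.inr (i, j)) : ℕ) * 2 ^ (j : ℕ) :=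
    finFunctionFinEquiv_apply _
  rw [gridIdx, hcode]
  push_cast
  rfl

theorem spin_gridIdx_injective {b b' : Reg q} (hspin : spin b = spin b')
    (hgrid : gridIdx b = gridIdx b') : b = b' := by
  refine (regEquiv q).injective (Prod.ext hspin (funext fun i => Fin.ext ?_))
  have hi := congrFun hgrid i
  rw [gridIdx_eq, gridIdx_eq] at hi
  omega

theorem gridIdx_bounds (b : Reg q) (i : Fin 3) :
    -((2 ^ q / 2 : ℕ) : ℤ) ≤ gridIdx b i ∧ gridIdx b i < 2 ^ q - ((2 ^ q / 2 : ℕ) : ℤ) := by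
  have hlt : (((regEquiv q b).2 i : ℕ) : ℤ) < 2 ^ q := by
    exact_mod_cast ((regEquiv q b).2 i).isLt
  rw [gridIdx_eq]
  omega

theorem abs_gridIdx_le (b : Reg q) (i : Fin 3) : |(gridIdx b i : ℝ)| ≤ 2 ^ q / 2 := by
  have habs : |2 * gridIdx b i| ≤ 2 ^ q := by
    have hb := gridIdx_bounds b i
    push_cast at hb
    rw [abs_le]
    cases q with
    | zero => simp only [pow_zero] at hb ⊢; omega
    | succ q => rw [pow_succ] at hb ⊢; omega
  have hreal : |2 * (gridIdx b i : ℝ)| ≤ 2 ^ q := by exact_mod_cast habs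
  rw [abs_mul, abs_two] at hreal
  linarith

theorem abs_gridIdx_sub_lt (b b' : Reg q) (i : Fin 3) : |gridIdx b i - gridIdx b' i| < 2 ^ q := by
  have hb := gridIdx_bounds b i
  have hb' := gridIdx_bounds b' i
  rw [abs_lt]
  omega

theorem exists_gridIdx_eq {p : Fin 3 → ℤ} (hp : ∀ i, 2 * |p i| < 2 ^ q) :
    ∃ b : Reg q, gridIdx b = p := by
  have hcode (i) : 0 ≤ p i + ((2 ^ q / 2 : ℕ) : ℤ) ∧ p i + ((2 ^ q / 2 : ℕ) : ℤ) < 2 ^ q := by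
    have hi := hp i
    have := neg_abs_le (p i)
    have := le_abs_self (p i)
    push_cast
    omega
  let code : Fin 3 → Fin (2 ^ q) := fun i => ⟨(p i + ((2 ^ q / 2 : ℕ) : ℤ)).toNat, by
    rw [Int.toNat_lt (hcode i).1]
    exact_mod_cast (hcode i).2⟩
  refine ⟨(regEquiv q).symm ((0, 0), code), funext fun i => ?_⟩
  rw [gridIdx_eq, Equiv.apply_symm_apply]
  simp only [code]
  rw [Int.toNat_of_nonneg (hcode i).1]
  ring

theorem two_pow_le_of_forall_gridIdx_ne {p : Fin 3 → ℤ} (hp : ∀ b : Reg q, gridIdx b ≠ p) :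
    (2 : ℝ) ^ q ≤ 2 * ∑ i, |(p i : ℝ)| := by
  by_contra! hlt
  obtain ⟨b, hb⟩ := exists_gridIdx_eq (q := q) (p := p) fun i => by
    have hle : |(p i : ℝ)| ≤ ∑ i, |(p i : ℝ)| :=
      Finset.single_le_sum (f := fun i => |(p i : ℝ)|) (fun _ _ => abs_nonneg _)
        (Finset.mem_univ i)
    have hreal : 2 * |(p i : ℝ)| < 2 ^ q := by linarith
    exact_mod_cast hreal
  exact hp b hb

/-- The basis label `b` with its spinor label replaced by `a`; with `a` running through `SpinIdx`
these are all the labels at the grid point of `b`. -/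
def withSpin (b : Reg q) (a : SpinIdx) : Reg q :=
  Function.update (Function.update b (Sum.inl 0) a.1) (Sum.inl 1) a.2

@[simp]
theorem spin_withSpin (b : Reg q) (a : SpinIdx) : spin (withSpin b a) = a := by
  simp [spin, withSpin]

@[simp]
theorem gridIdx_withSpin (b : Reg q) (a : SpinIdx) : gridIdx (withSpin b a) = gridIdx b := by
  funext i
  simp [gridIdx, withSpin]

theorem withSpin_spin {b b' : Reg q} (h : gridIdx b = gridIdx b') : withSpin b (spin b') = b' :=
  spin_gridIdx_injective (spin_withSpin _ _) (by rw [gridIdx_withSpin, h])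

theorem sum_gridIdx_eq {R : Type*} [AddCommMonoid R] (b : Reg q) (F : Reg q → R) :
    (∑ b', if gridIdx b = gridIdx b' then F b' else 0) = ∑ a, F (withSpin b a) := by
  rw [← Finset.sum_filter]
  refine (Finset.sum_bij (fun a _ => withSpin b a) (by simp) (fun a _ a' _ h => ?_)
    (fun b' hb' => ?_) (fun _ _ => rfl)).symm
  · simpa using congrArg spin h
  · exact ⟨spin b', Finset.mem_univ _, withSpin_spin (by simpa using hb')⟩

theorem sum_spin_eq {R : Type*} [AddCommMonoid R] (a : SpinIdx) (G : (Fin 3 → ℤ) → R) :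
    (∑ b : Reg q, if spin b = a then G (gridIdx b) else 0)
      = ∑ g : Fin 3 → Fin (2 ^ q), G (fun i => ((g i : ℕ) : ℤ) - ((2 ^ q / 2 : ℕ) : ℤ)) := by
  have hgrid (b : Reg q) :
      gridIdx b = fun i => (((regEquiv q b).2 i : ℕ) : ℤ) - ((2 ^ q / 2 : ℕ) : ℤ) :=
    funext (gridIdx_eq b)
  simp only [hgrid, ← regEquiv_fst]
  rw [(regEquiv q).sum_comp (fun y => if y.1 = a then
      G (fun i => ((y.2 i : ℕ) : ℤ) - ((2 ^ q / 2 : ℕ) : ℤ)) else 0), Fintype.sum_prod_type,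
    Finset.sum_eq_single a (fun x _ hx => by simp [hx]) (by simp)]
  simp

theorem localMatrix_mulVec (D : Reg q → Matrix SpinIdx SpinIdx ℂ) (v : Reg q → ℂ) (b : Reg q) :
    (localMatrix D *ᵥ v) b = ∑ a, D b (spin b) a * v (withSpin b a) := by
  simp only [mulVec, dotProduct, localMatrix, ite_mul, zero_mul]
  rw [sum_gridIdx_eq b (fun b' => D b (spin b) (spin b') * v b')]
  simp only [spin_withSpin]

theorem localMatrix_const_mul (D D' : Matrix SpinIdx SpinIdx ℂ) :
    (localMatrix fun _ : Reg q => D) * (localMatrix fun _ => D') = localMatrix fun _ => D * D' := by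
  ext b b''
  simp only [Matrix.mul_apply, localMatrix, ite_mul, zero_mul]
  rw [sum_gridIdx_eq b (fun b' => D (spin b) (spin b')
    * if gridIdx b' = gridIdx b'' then D' (spin b') (spin b'') else 0)]
  simp only [gridIdx_withSpin, spin_withSpin]
  split_ifs <;> simp

theorem localMatrix_diagonal (d : Reg q → SpinIdx → ℂ) :
    localMatrix (fun b => diagonal (d b)) = diagonal fun b => d b (spin b) := by
  ext b b'
  simp only [localMatrix, diagonal_apply]
  by_cases h : b = b'
  · simp only [h, if_true]
  · rw [if_neg h]
    split_ifs with hgrid hspin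
    · exact absurd (spin_gridIdx_injective hspin hgrid) h
    · rfl
    · rfl

theorem localMatrix_one : localMatrix (fun _ : Reg q => (1 : Matrix SpinIdx SpinIdx ℂ)) = 1 := by
  simp only [← diagonal_one]
  exact localMatrix_diagonal _

theorem localMatrix_conjTranspose (D : Reg q → Matrix SpinIdx SpinIdx ℂ)
    (h : ∀ b b', gridIdx b = gridIdx b' → D b = D b') :
    (localMatrix D)ᴴ = localMatrix fun b => (D b)ᴴ := by
  ext b b'
  simp only [conjTranspose_apply, localMatrix, eq_comm (a := gridIdx b')]
  split_ifs with hgrid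
  · rw [h b b' hgrid]
  · exact star_zero ℂ

theorem localMatrix_sum_smul {ι : Type*} [Fintype ι] (f : ι → Reg q → ℂ)
    (D : ι → Matrix SpinIdx SpinIdx ℂ) :
    localMatrix (fun b => ∑ i, f i b • D i)
      = ∑ i, diagonal (f i) * localMatrix fun _ => D i := by
  ext b b'
  simp only [Matrix.sum_apply, diagonal_mul, localMatrix, mul_ite, mul_zero, Matrix.smul_apply,
    smul_eq_mul]
  split_ifs <;> simp

theorem pauli_mul_self (j : Fin 3) : pauli j * pauli j = 1 := by
  ext a b
  fin_cases j <;> fin_cases a <;> fin_cases b <;> simp [pauli, Matrix.mul_apply, Fin.sum_univ_two]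

theorem pauli_isHermitian (j : Fin 3) : (pauli j).IsHermitian := by
  ext a b
  fin_cases j <;> fin_cases a <;> fin_cases b <;> simp [pauli]

theorem diracAlpha_isHermitian (i : Fin 3) : (diracAlpha i).IsHermitian := by
  rw [IsHermitian, diracAlpha, conjTranspose_kronecker, (pauli_isHermitian 0).eq,
    (pauli_isHermitian i).eq]

theorem diracAlpha_mul_self (i : Fin 3) : diracAlpha i * diracAlpha i = 1 := by
  rw [diracAlpha, ← mul_kronecker_mul, pauli_mul_self, pauli_mul_self, one_kronecker_one]

theorem diracBeta_eq_diagonal : diracBeta = diagonal fun a => ((-1) ^ (a.1 : ℕ) : ℂ) := by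
  ext ⟨a, b⟩ ⟨c, d⟩
  fin_cases a <;> fin_cases b <;> fin_cases c <;> fin_cases d <;>
    simp [diracBeta, pauli]

/-! ## The discrete Fourier transform -/

theorem sum_fin_character {n : ℕ} (hn : n ≠ 0) (h : ℤ) {d : ℤ} (hd : |d| < n) :
    ∑ x : Fin n, exp (I * ((2 * Real.pi * (d * (((x : ℕ) : ℤ) - h : ℤ)) / n : ℝ) : ℂ))
      = if d = 0 then (n : ℂ) else 0 := by
  split_ifs with h0
  · simp [h0]
  have hn' : (n : ℂ) ≠ 0 := Nat.cast_ne_zero.2 hn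
  have hprim := Complex.isPrimitiveRoot_exp n hn
  set ζ : ℂ := exp (2 * Real.pi * I / n) ^ d with hζ
  have hζ_pow : ζ ^ n = 1 := by
    rw [hζ, ← zpow_natCast, zpow_comm, zpow_natCast, hprim.pow_eq_one, _root_.one_zpow]
  have hζ_ne : ζ ≠ 1 := fun h1 =>
    h0 (Int.eq_zero_of_abs_lt_dvd ((hprim.zpow_eq_one_iff_dvd d).1 h1) hd)
  have hterm (x : Fin n) :
      exp (I * ((2 * Real.pi * (d * (((x : ℕ) : ℤ) - h : ℤ)) / n : ℝ) : ℂ))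
        = exp (-(2 * Real.pi * I * (d * h / n))) * ζ ^ (x : ℕ) := by
    rw [hζ, ← Complex.exp_int_mul, ← Complex.exp_nat_mul, ← Complex.exp_add]
    congr 1
    push_cast
    field_simp
    ring
  simp only [hterm]
  rw [← Finset.mul_sum, Fin.sum_univ_eq_sum_range (fun k => ζ ^ k), geom_sum_eq hζ_ne, hζ_pow,
    sub_self, zero_div, mul_zero]

/-- The value at the grid point of `b` of the plane wave with momentum label `p`. -/
def gridPhase (p : Fin 3 → ℤ) (b : Reg q) : ℂ :=
  exp (I * ((2 * Real.pi * (∑ i, (p i : ℝ) * (gridIdx b i : ℝ)) / 2 ^ q : ℝ) : ℂ))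

theorem gridPhase_add (p p' : Fin 3 → ℤ) (b : Reg q) :
    gridPhase (p + p') b = gridPhase p b * gridPhase p' b := by
  rw [gridPhase, gridPhase, gridPhase, ← Complex.exp_add, ← mul_add, ← Complex.ofReal_add]
  simp only [Pi.add_apply, Int.cast_add, add_mul, Finset.sum_add_distrib, mul_add, add_div]

theorem star_gridPhase (p : Fin 3 → ℤ) (b : Reg q) : star (gridPhase p b) = gridPhase (-p) b := by
  rw [gridPhase, gridPhase, RCLike.star_def, ← Complex.exp_conj]
  simp only [map_mul, conj_I, conj_ofReal, Pi.neg_apply, Int.cast_neg, neg_mul,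
    Finset.sum_neg_distrib, mul_neg, neg_div, ofReal_neg]

theorem sum_gridPhase (a : SpinIdx) {p : Fin 3 → ℤ} (hp : ∀ i, |p i| < 2 ^ q) :
    (∑ b : Reg q, if spin b = a then gridPhase p b else 0)
      = if p = 0 then ((2 : ℂ) ^ q) ^ 3 else 0 := by
  simp only [gridPhase]
  rw [sum_spin_eq a (fun g : Fin 3 → ℤ =>
    exp (I * ((2 * Real.pi * (∑ i, (p i : ℝ) * (g i : ℝ)) / 2 ^ q : ℝ) : ℂ)))]
  have hprod (g : Fin 3 → Fin (2 ^ q)) :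
      exp (I * ((2 * Real.pi * (∑ i, (p i : ℝ)
        * ((((g i : ℕ) : ℤ) - ((2 ^ q / 2 : ℕ) : ℤ) : ℤ) : ℝ)) / 2 ^ q : ℝ) : ℂ))
      = ∏ i, exp (I * ((2 * Real.pi * (p i * (((g i : ℕ) : ℤ) - ((2 ^ q / 2 : ℕ) : ℤ) : ℤ))
          / ((2 ^ q : ℕ) : ℝ) : ℝ) : ℂ)) := by
    rw [← Complex.exp_sum, ← Finset.mul_sum, ← Complex.ofReal_sum, ← Finset.sum_div,
      ← Finset.mul_sum]
    push_cast
    rfl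
  have hcoord (i) := sum_fin_character (n := 2 ^ q) (by positivity) ((2 ^ q / 2 : ℕ) : ℤ)
    (d := p i) (by exact_mod_cast hp i)
  simp only [hprod]
  rw [← Fintype.prod_sum (fun (i : Fin 3) (x : Fin (2 ^ q)) =>
    exp (I * ((2 * Real.pi * (p i * (((x : ℕ) : ℤ) - ((2 ^ q / 2 : ℕ) : ℤ) : ℤ))
          / ((2 ^ q : ℕ) : ℝ) : ℝ) : ℂ)))]
  simp only [hcoord]
  split_ifs with h0
  · simp [h0]
  · obtain ⟨i, hi⟩ := Function.ne_iff.1 h0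
    exact Finset.prod_eq_zero (Finset.mem_univ i) (if_neg hi)

theorem fourierMatrix_apply (b b' : Reg q) : fourierMatrix q b b' =
    if spin b = spin b' then ((((Real.sqrt (2 ^ q)) ^ 3)⁻¹ : ℝ) : ℂ) * gridPhase (-gridIdx b) b'
    else 0 := by
  simp only [fourierMatrix, gridPhase, Pi.neg_apply, Int.cast_neg, neg_mul, Finset.sum_neg_distrib,
    mul_neg, neg_div, ofReal_neg]

theorem sqrt_pow_three_sq {x : ℝ} (hx : 0 ≤ x) : (Real.sqrt x ^ 3) ^ 2 = x ^ 3 := by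
  rw [← pow_mul, mul_comm 3 2, pow_mul, Real.sq_sqrt hx]

theorem fourierMatrix_mulVec_gridPhase (b₀ : Reg q) (c : SpinIdx → ℂ) (b : Reg q) :
    (fourierMatrix q *ᵥ fun b' => gridPhase (gridIdx b₀) b' * c (spin b')) b
      = if gridIdx b = gridIdx b₀ then ((Real.sqrt (2 ^ q) ^ 3 : ℝ) : ℂ) * c (spin b) else 0 := by
  set N : ℝ := Real.sqrt (2 ^ q) ^ 3 with hN
  have hN_ne : (N : ℂ) ≠ 0 := by
    exact_mod_cast (by positivity : N ≠ 0)
  have hN_sq : (N : ℂ) ^ 2 = ((2 : ℂ) ^ q) ^ 3 := by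
    have hsq : N ^ 2 = ((2 : ℝ) ^ q) ^ 3 := sqrt_pow_three_sq (by positivity)
    exact_mod_cast congrArg ((↑) : ℝ → ℂ) hsq
  have hterm (b') : fourierMatrix q b b' * (gridPhase (gridIdx b₀) b' * c (spin b'))
      = ((N : ℂ)⁻¹ * c (spin b))
        * if spin b' = spin b then gridPhase (gridIdx b₀ - gridIdx b) b' else 0 := by
    rw [fourierMatrix_apply, ofReal_inv, ← hN]
    by_cases h : spin b' = spin b
    · rw [if_pos h, if_pos h.symm, sub_eq_add_neg, gridPhase_add, h]
      ring
    · rw [if_neg h, if_neg (Ne.symm h), zero_mul, mul_zero]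
  simp only [mulVec, dotProduct, hterm]
  rw [← Finset.mul_sum, sum_gridPhase _ (p := gridIdx b₀ - gridIdx b)
    (fun i => abs_gridIdx_sub_lt b₀ b i)]
  simp only [sub_eq_zero, eq_comm (a := gridIdx b₀)]
  split_ifs
  · rw [← hN_sq]
    field_simp
  · rw [mul_zero]

theorem fourierMatrix_mem_unitary (q : ℕ) : fourierMatrix q ∈ unitaryGroup (Reg q) ℂ := by
  rw [mem_unitaryGroup_iff]
  ext b b''
  have hN : ((Real.sqrt (2 ^ q) ^ 3 : ℝ) : ℂ) ≠ 0 := by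
    exact_mod_cast (by positivity : Real.sqrt (2 ^ q) ^ 3 ≠ 0)
  have hrow (b') : star (fourierMatrix q) b' b'' = gridPhase (gridIdx b'') b'
      * if spin b'' = spin b' then (((Real.sqrt (2 ^ q) ^ 3)⁻¹ : ℝ) : ℂ) else 0 := by
    rw [star_apply, fourierMatrix_apply, apply_ite star, star_mul', star_gridPhase, neg_neg,
      star_zero, mul_ite, mul_zero, mul_comm (gridPhase _ _), RCLike.star_def, conj_ofReal]
  rw [Matrix.mul_apply, Matrix.one_apply]
  simp only [hrow]
  refine (fourierMatrix_mulVec_gridPhase b''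
    (fun a => if spin b'' = a then (((Real.sqrt (2 ^ q) ^ 3)⁻¹ : ℝ) : ℂ) else 0) b).trans ?_
  by_cases hb : b = b''
  · simp only [hb, if_true, ofReal_inv]
    exact mul_inv_cancel₀ hN
  · rw [if_neg hb]
    split_ifs with hgrid hspin
    · exact absurd (spin_gridIdx_injective hspin.symm hgrid) hb
    · rw [mul_zero]
    · rfl

end Register

/-! ## The discretized Hamiltonian -/

section HamiltonianTerms

open Matrix
open scoped Matrix.Norms.L2Operator

variable {q : ℕ}

theorem norm_act_le (U : Matrix (Reg q) (Reg q) ℂ) (v : QState q) : ‖act U v‖ ≤ ‖U‖ * ‖v‖ :=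
  l2_opNorm_mulVec U v

theorem act_mul (U U' : Matrix (Reg q) (Reg q) ℂ) (v : QState q) :
    act (U * U') v = act U (act U' v) := by
  simp only [act, mulVec_mulVec]

theorem act_one (v : QState q) : act 1 v = v := by
  simp only [act, one_mulVec]

theorem act_sub_left (U U' : Matrix (Reg q) (Reg q) ℂ) (v : QState q) :
    act (U - U') v = act U v - act U' v := by
  simp only [act, sub_mulVec, WithLp.toLp_sub]

theorem act_sub (U : Matrix (Reg q) (Reg q) ℂ) (v w : QState q) :
    act U (v - w) = act U v - act U w := by
  simp only [act, WithLp.ofLp_sub, mulVec_sub, WithLp.toLp_sub]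

theorem norm_act_of_unitary {U : Matrix (Reg q) (Reg q) ℂ} (hU : U ∈ unitaryGroup (Reg q) ℂ)
    (v : QState q) : ‖act U v‖ = ‖v‖ := by
  have hle {W : Matrix (Reg q) (Reg q) ℂ} (hW : W ∈ unitaryGroup (Reg q) ℂ) (w : QState q) :
      ‖act W w‖ ≤ ‖w‖ := by
    simpa only [CStarRing.norm_of_mem_unitary hW, one_mul] using norm_act_le W w
  refine (hle hU v).antisymm ?_
  simpa only [← act_mul, mem_unitaryGroup_iff'.1 hU, act_one] using
    hle (Unitary.star_mem hU) (act U v)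

theorem norm_diagonal_le {d : Reg q → ℂ} {c : ℝ} (h : ∀ b, ‖d b‖ ≤ c) : ‖diagonal d‖ ≤ c := by
  rw [l2_opNorm_diagonal]
  exact (pi_norm_le_iff_of_nonempty _).2 h

theorem localMatrix_diracAlpha_mem_unitary (i : Fin 3) :
    (localMatrix fun _ : Reg q => diracAlpha i) ∈ unitaryGroup (Reg q) ℂ := by
  rw [mem_unitaryGroup_iff, star_eq_conjTranspose, localMatrix_conjTranspose _ (fun _ _ _ => rfl),
    diracAlpha_isHermitian, localMatrix_const_mul, diracAlpha_mul_self, localMatrix_one]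

theorem norm_localMatrix_sum_diracAlpha_le (f : Fin 3 → Reg q → ℂ) {c : ℝ}
    (h : ∀ i b, ‖f i b‖ ≤ c) : ‖localMatrix fun b => ∑ i, f i b • diracAlpha i‖ ≤ 3 * c := by
  rw [localMatrix_sum_smul]
  have hterm (i : Fin 3) (_ : i ∈ Finset.univ) :
      ‖diagonal (f i) * localMatrix fun _ : Reg q => diracAlpha i‖ ≤ c := by
    refine (norm_mul_le _ _).trans ?_
    rw [CStarRing.norm_of_mem_unitary (localMatrix_diracAlpha_mem_unitary i), mul_one]
    exact norm_diagonal_le (h i)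
  refine (norm_sum_le _ _).trans ((Finset.sum_le_card_nsmul _ _ _ hterm).trans_eq ?_)
  simp

theorem localMatrix_sum_diracAlpha_isHermitian (f : Fin 3 → Reg q → ℝ)
    (h : ∀ i b b', gridIdx b = gridIdx b' → f i b = f i b') :
    (localMatrix fun b => ∑ i, (f i b : ℂ) • diracAlpha i).IsHermitian := by
  rw [IsHermitian, localMatrix_conjTranspose _ (fun b b' hb => by simp only [h _ b b' hb])]
  congr 1
  funext b
  simp [conjTranspose_sum, conjTranspose_smul, (diracAlpha_isHermitian _).eq]

variable (Ω m e : ℝ) (φ : Space → ℝ) (A : Space → Fin 3 → ℝ)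

theorem node_congr {b b' : Reg q} (h : gridIdx b = gridIdx b') : node Ω b = node Ω b' := by
  funext i
  simp only [node, h]

theorem waveVec_congr {b b' : Reg q} (h : gridIdx b = gridIdx b') :
    waveVec Ω b = waveVec Ω b' := by
  funext i
  simp only [waveVec, h]

theorem hamTerm_zero : hamTerm Ω m e φ A q 0 = (fourierMatrix q)ᴴ *
    localMatrix (fun b => ∑ i, (waveVec Ω b i : ℂ) • diracAlpha i) * fourierMatrix q := rfl

theorem hamTerm_one : hamTerm Ω m e φ A q 1
    = diagonal fun b => ((m * (-1) ^ (b (Sum.inl 0) : ℕ) : ℝ) : ℂ) := by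
  calc localMatrix (fun _ => (m : ℂ) • diracBeta)
      = localMatrix (fun _ => diagonal ((m : ℂ) • fun a : SpinIdx => ((-1) ^ (a.1 : ℕ) : ℂ))) := by
        simp only [diracBeta_eq_diagonal, diagonal_smul]
    _ = _ := by
        rw [localMatrix_diagonal]
        simp [spin]

theorem hamTerm_two : hamTerm Ω m e φ A q 2
    = diagonal fun b => ((-(e * φ (node Ω b)) : ℝ) : ℂ) := by
  calc localMatrix (fun b => ((-(e * φ (node Ω b)) : ℝ) : ℂ) • 1)
      = localMatrix (fun b => diagonal fun _ => ((-(e * φ (node Ω b)) : ℝ) : ℂ)) := by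
        simp only [smul_one_eq_diagonal]
    _ = _ := localMatrix_diagonal _

theorem hamTerm_three : hamTerm Ω m e φ A q 3
    = localMatrix (fun b => ∑ i, ((e * A (node Ω b) i : ℝ) : ℂ) • diracAlpha i) := rfl

theorem hamTerm_isHermitian (j : Fin 4) : (hamTerm Ω m e φ A q j).IsHermitian := by
  fin_cases j
  · exact isHermitian_conjTranspose_mul_mul _ (localMatrix_sum_diracAlpha_isHermitian _
      fun i b b' h => congrFun (waveVec_congr Ω h) i)
  · change (hamTerm Ω m e φ A q 1).IsHermitian
    rw [hamTerm_one]
    exact isHermitian_diagonal_of_self_adjoint _ (funext fun b => Complex.conj_ofReal _)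
  · change (hamTerm Ω m e φ A q 2).IsHermitian
    rw [hamTerm_two]
    exact isHermitian_diagonal_of_self_adjoint _ (funext fun b => Complex.conj_ofReal _)
  · exact localMatrix_sum_diracAlpha_isHermitian _ fun i b b' h => by rw [node_congr Ω h]

theorem norm_hamTerm_zero_le (hΩ : 0 < Ω) :
    ‖hamTerm Ω m e φ A q 0‖ ≤ 3 * (Real.pi / Ω * 2 ^ q) := by
  have hF : ‖fourierMatrix q‖ = 1 := CStarRing.norm_of_mem_unitary (fourierMatrix_mem_unitary q)
  have hD : ‖localMatrix fun b : Reg q => ∑ i, (waveVec Ω b i : ℂ) • diracAlpha i‖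
      ≤ 3 * (Real.pi / Ω * 2 ^ q) := by
    refine norm_localMatrix_sum_diracAlpha_le _ fun i b => ?_
    rw [Complex.norm_real, Real.norm_eq_abs, waveVec, abs_div, abs_mul, abs_of_pos hΩ,
      abs_of_pos Real.two_pi_pos]
    calc 2 * Real.pi * |(gridIdx b i : ℝ)| / Ω ≤ 2 * Real.pi * (2 ^ q / 2) / Ω := by
          gcongr
          exact abs_gridIdx_le b i
      _ = _ := by ring
  calc ‖hamTerm Ω m e φ A q 0‖
      ≤ ‖(fourierMatrix q)ᴴ‖
        * ‖localMatrix fun b : Reg q => ∑ i, (waveVec Ω b i : ℂ) • diracAlpha i‖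
        * ‖fourierMatrix q‖ := norm_mul₃_le
    _ ≤ 3 * (Real.pi / Ω * 2 ^ q) := by
        rwa [l2_opNorm_conjTranspose, hF, one_mul, mul_one]

theorem norm_hamTerm_one_le : ‖hamTerm Ω m e φ A q 1‖ ≤ |m| := by
  rw [hamTerm_one]
  refine norm_diagonal_le fun b => ?_
  simp

variable {φ A} {c : ℝ}

theorem norm_hamTerm_two_le (hφ : ∀ x, |φ x| ≤ c) : ‖hamTerm Ω m e φ A q 2‖ ≤ |e| * c := by
  rw [hamTerm_two]
  refine norm_diagonal_le fun b => ?_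
  rw [Complex.norm_real, Real.norm_eq_abs, abs_neg, abs_mul]
  gcongr
  exact hφ _

theorem norm_hamTerm_three_le (hA : ∀ x i, |A x i| ≤ c) :
    ‖hamTerm Ω m e φ A q 3‖ ≤ 3 * (|e| * c) := by
  rw [hamTerm_three]
  refine norm_localMatrix_sum_diracAlpha_le _ fun i b => ?_
  rw [Complex.norm_real, Real.norm_eq_abs, abs_mul]
  gcongr
  exact hA _ _

variable (φ A) in
theorem implementable_propagator_mass (s : ℝ) :
    Implementable 1 (propagator (hamTerm Ω m e φ A q 1) s) := by
  have hphase := implementable_phase_of_qubit (Sum.inl 0 : Qubit q)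
    (fun x => -(s * (m * (-1) ^ (x : ℕ))))
  convert hphase using 1
  rw [hamTerm_one, propagator, ← diagonal_smul, exp_diagonal, phaseMatrix]
  congr 1
  funext b
  rw [Pi.coe_exp, ← Complex.exp_eq_exp_ℂ]
  simp only [Pi.smul_apply, smul_eq_mul]
  push_cast
  ring_nf

end HamiltonianTerms

/-! ## Bounded potentials -/

section PeriodicPotentials

theorem Periodic3.add_single_int_mul {β : Type} {Ω : ℝ} {f : Space → β} (hf : Periodic3 Ω f)
    (x : Space) (i : Fin 3) (n : ℤ) : f (x + Pi.single i (n * Ω)) = f x := by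
  have hper : Function.Periodic (fun s : ℝ => f (x + Pi.single i s)) Ω := fun s => by
    simp only [Pi.single_add, ← add_assoc]
    exact hf _ i
  simpa using hper.int_mul n 0

theorem Periodic3.exists_mem_Icc {β : Type} {Ω : ℝ} (hΩ : 0 < Ω) {f : Space → β}
    (hf : Periodic3 Ω f) (x : Space) : ∃ y ∈ Set.Icc (0 : Space) (fun _ => Ω), f y = f x := by
  let n : Fin 3 → ℤ := fun i => -⌊x i / Ω⌋
  have hmem (i) : 0 ≤ x i + n i * Ω ∧ x i + n i * Ω ≤ Ω := by
    have hfloor := Int.floor_le (x i / Ω)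
    have hlt := (Int.lt_floor_add_one (x i / Ω)).le
    rw [le_div_iff₀ hΩ] at hfloor
    rw [div_le_iff₀ hΩ] at hlt
    simp only [n]
    push_cast
    constructor <;> linarith
  refine ⟨x + Pi.single 0 (n 0 * Ω) + Pi.single 1 (n 1 * Ω) + Pi.single 2 (n 2 * Ω), ?_, ?_⟩
  · constructor <;> intro i <;> fin_cases i <;> simp [hmem]
  · rw [hf.add_single_int_mul, hf.add_single_int_mul, hf.add_single_int_mul]

theorem Periodic3.bddAbove_range {Ω : ℝ} (hΩ : 0 < Ω) {f : Space → ℝ} (hf : Periodic3 Ω f)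
    (hc : Continuous f) : BddAbove (Set.range f) := by
  have hbdd : BddAbove (f '' Set.Icc (0 : Space) (fun _ => Ω)) :=
    isCompact_Icc.bddAbove_image hc.continuousOn
  refine hbdd.mono ?_
  rintro _ ⟨x, rfl⟩
  obtain ⟨y, hy, hyx⟩ := hf.exists_mem_Icc hΩ x
  exact ⟨y, hy, hyx⟩

end PeriodicPotentials

/-! ## Error of the product formula -/

section Trotter

open Matrix
open scoped Matrix.Norms.L2Operator

variable {q : ℕ}

theorem propagator_eq (H : Matrix (Reg q) (Reg q) ℂ) (t : ℝ) :
    propagator H t = NormedSpace.exp (t • ((-I) • H)) := by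
  rw [propagator, ← Complex.coe_smul, smul_smul]
  congr 2
  ring

theorem propagator_pow (H : Matrix (Reg q) (Reg q) ℂ) (t : ℝ) {r : ℕ} (hr : r ≠ 0) :
    propagator H (t / r) ^ r = propagator H t := by
  rw [propagator, ← Matrix.exp_nsmul, propagator, ← Nat.cast_smul_eq_nsmul ℂ, smul_smul]
  congr 2
  have hr' : (r : ℂ) ≠ 0 := Nat.cast_ne_zero.2 hr
  push_cast
  field_simp

theorem norm_pow_sub_pow_le {R : Type*} [NormedRing R] {u v : R} (hu : ∀ r, ‖u ^ r‖ ≤ 1)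
    (hv : ‖v‖ ≤ 1) (r : ℕ) : ‖u ^ r - v ^ r‖ ≤ r * ‖u - v‖ := by
  induction r with
  | zero => simp
  | succ r ih =>
    calc ‖u ^ (r + 1) - v ^ (r + 1)‖
        = ‖u ^ r * (u - v) + (u ^ r - v ^ r) * v‖ := by
          rw [pow_succ, pow_succ, mul_sub, sub_mul]
          abel_nf
      _ ≤ ‖u ^ r‖ * ‖u - v‖ + ‖u ^ r - v ^ r‖ * ‖v‖ :=
          (norm_add_le _ _).trans (add_le_add (norm_mul_le _ _) (norm_mul_le _ _))
      _ ≤ 1 * ‖u - v‖ + r * ‖u - v‖ * 1 := by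
          gcongr
          exact hu r
      _ = (r + 1 : ℕ) * ‖u - v‖ := by
          push_cast
          ring

theorem norm_suzuki_sub_propagator_le {H : Fin 4 → Matrix (Reg q) (Reg q) ℂ} {Λ : ℝ}
    (hΛ : ∑ j, ‖H j‖ ≤ Λ) (k : ℕ) {t : ℝ} (ht : 3 ^ k * Λ * |t| ≤ 1) :
    ‖suzuki (fun j => propagator (H j)) (k + 1) t - propagator (∑ j, H j) t‖
      ≤ 6 * (3 ^ k * Λ * |t|) ^ (2 * k + 3) := by
  have hnorm (j) : ‖(-I) • H j‖ = ‖H j‖ := by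
    rw [norm_smul, norm_neg, norm_I, one_mul]
  have hΛt : 3 ^ k * (∑ j, ‖H j‖) * |t| ≤ 3 ^ k * Λ * |t| := by gcongr
  have herror := norm_suzuki_sub_exp_le (fun j => (-I) • H j) k t
  simp only [hnorm, ← Finset.smul_sum, ← propagator_eq] at herror
  refine (herror (hΛt.trans ht)).trans ?_
  gcongr

theorem norm_suzuki_pow_sub_propagator_le {H : Fin 4 → Matrix (Reg q) (Reg q) ℂ}
    (hH : ∀ j, (H j).IsHermitian) {Λ : ℝ} (hΛ : ∑ j, ‖H j‖ ≤ Λ) (k : ℕ) {T : ℝ} {r : ℕ}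
    (hr : 0 < r) (hT : 3 ^ k * Λ * |T| ≤ r) :
    ‖suzuki (fun j => propagator (H j)) (k + 1) (T / r) ^ r - propagator (∑ j, H j) T‖
      ≤ r * (6 * (3 ^ k * Λ * |T| / r) ^ (2 * k + 3)) := by
  have hr' : (0 : ℝ) < r := by exact_mod_cast hr
  have hstep : 3 ^ k * Λ * |T / r| = 3 ^ k * Λ * |T| / r := by
    rw [abs_div, abs_of_pos hr', mul_div_assoc]
  have hone_step := norm_suzuki_sub_propagator_le hΛ k
    (hstep.trans_le ((div_le_one hr').2 hT))
  rw [hstep] at hone_step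
  rw [← propagator_pow (∑ j, H j) T hr.ne']
  have hsuzuki (s : ℕ) : ‖suzuki (fun j => propagator (H j)) (k + 1) (T / r) ^ s‖ = 1 :=
    CStarRing.norm_of_mem_unitary <| pow_mem (S := unitaryGroup (Reg q) ℂ)
      (suzuki_mem (fun j t => propagator_mem_unitary (hH j) t) (k + 1) (T / r)) s
  have hsum : (∑ j, H j).IsHermitian := by
    simp only [IsHermitian, conjTranspose_sum, fun j => (hH j).eq]
  have hexact : ‖propagator (∑ j, H j) (T / r)‖ = 1 :=
    CStarRing.norm_of_mem_unitary (propagator_mem_unitary hsum (T / r))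
  exact (norm_pow_sub_pow_le (fun s => (hsuzuki s).le) hexact.le r).trans
    (mul_le_mul_of_nonneg_left hone_step hr'.le)

end Trotter

/-! ## Plane waves on the register -/

section Modes

open Matrix
open scoped Matrix.Norms.L2Operator

variable {q : ℕ} {Ω : ℝ}

/-- A plane wave with a constant spinor. -/
def mode (Ω : ℝ) (p : Fin 3 → ℤ) (c : SpinIdx → ℂ) (x : Space) : SpinIdx → ℂ :=
  planeWave Ω p x • c

/-- The symbol `α · k_p` by which `-i α · ∇` acts on the plane wave with wave vector `k_p`. -/
def kineticSymbol (Ω : ℝ) (p : Fin 3 → ℤ) : Matrix SpinIdx SpinIdx ℂ :=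
  ∑ i, ((2 * Real.pi * (p i : ℝ) / Ω : ℝ) : ℂ) • diracAlpha i

/-- The `ℓ¹` size `|p₁| + |p₂| + |p₃|` of a momentum label, which measures the analytic decay of
Fourier coefficients. -/
def momentumSize (p : Fin 3 → ℤ) : ℝ := ∑ i, |(p i : ℝ)|

theorem momentumSize_nonneg (p : Fin 3 → ℤ) : 0 ≤ momentumSize p :=
  Finset.sum_nonneg fun _ _ => abs_nonneg _

theorem norm_planeWave (p : Fin 3 → ℤ) (x : Space) : ‖planeWave Ω p x‖ = 1 := by
  rw [planeWave, mul_comm]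
  exact norm_exp_ofReal_mul_I _

theorem norm_mode (p : Fin 3 → ℤ) (c : SpinIdx → ℂ) (x : Space) : ‖mode Ω p c x‖ = ‖c‖ := by
  rw [mode, norm_smul, norm_planeWave, one_mul]

theorem planeWave_node (hΩ : Ω ≠ 0) (p : Fin 3 → ℤ) (b : Reg q) :
    planeWave Ω p (node Ω b) = gridPhase p b := by
  rw [planeWave, gridPhase]
  congr 3
  rw [Finset.mul_sum, Finset.sum_div]
  refine Finset.sum_congr rfl fun i _ => ?_
  rw [node]
  field_simp

theorem sampleState_apply (f : Space → SpinIdx → ℂ) (b : Reg q) :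
    (sampleState Ω q f).ofLp b
      = ((Real.sqrt (Ω / 2 ^ q) ^ 3 : ℝ) : ℂ) * f (node Ω b) (spin b) := rfl

theorem fourierMatrix_mulVec_sampleState_mode (hΩ : 0 < Ω) (b₀ : Reg q) (c : SpinIdx → ℂ)
    (b : Reg q) : (fourierMatrix q *ᵥ (sampleState Ω q (mode Ω (gridIdx b₀) c)).ofLp) b
      = if gridIdx b = gridIdx b₀ then ((Real.sqrt Ω ^ 3 : ℝ) : ℂ) * c (spin b) else 0 := by
  have hsample : (sampleState Ω q (mode Ω (gridIdx b₀) c)).ofLp = fun b' =>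
      gridPhase (gridIdx b₀) b' * (((Real.sqrt (Ω / 2 ^ q) ^ 3 : ℝ) : ℂ) • c) (spin b') := by
    funext b'
    rw [sampleState_apply, mode, Pi.smul_apply, Pi.smul_apply, smul_eq_mul, smul_eq_mul,
      planeWave_node hΩ.ne', mul_left_comm]
  have hscale : Real.sqrt (2 ^ q) ^ 3 * Real.sqrt (Ω / 2 ^ q) ^ 3 = Real.sqrt Ω ^ 3 := by
    rw [← mul_pow, ← Real.sqrt_mul (by positivity), mul_div_cancel₀ _ (by positivity)]
  rw [hsample, fourierMatrix_mulVec_gridPhase, Pi.smul_apply, smul_eq_mul, ← mul_assoc,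
    ← ofReal_mul, hscale]

theorem act_hamTerm_zero_sampleState_mode (hΩ : 0 < Ω) (m e : ℝ) (φ : Space → ℝ)
    (A : Space → Fin 3 → ℝ) (b₀ : Reg q) (c : SpinIdx → ℂ) :
    act (hamTerm Ω m e φ A q 0) (sampleState Ω q (mode Ω (gridIdx b₀) c))
      = sampleState Ω q (mode Ω (gridIdx b₀) (kineticSymbol Ω (gridIdx b₀) *ᵥ c)) := by
  have hmomentum : localMatrix (fun b => ∑ i, (waveVec Ω b i : ℂ) • diracAlpha i)
      *ᵥ (fourierMatrix q *ᵥ (sampleState Ω q (mode Ω (gridIdx b₀) c)).ofLp)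
      = fourierMatrix q *ᵥ
        (sampleState Ω q (mode Ω (gridIdx b₀) (kineticSymbol Ω (gridIdx b₀) *ᵥ c))).ofLp := by
    funext b
    simp only [localMatrix_mulVec, fourierMatrix_mulVec_sampleState_mode hΩ, gridIdx_withSpin,
      spin_withSpin]
    by_cases hb : gridIdx b = gridIdx b₀
    · have hsymbol : (∑ i, (waveVec Ω b i : ℂ) • diracAlpha i) = kineticSymbol Ω (gridIdx b₀) := by
        simp only [waveVec, hb, kineticSymbol]
      simp only [if_pos hb, hsymbol, mulVec, dotProduct, Finset.mul_sum, mul_left_comm]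
    · simp only [if_neg hb, mul_zero, Finset.sum_const_zero]
  have hunitary := mem_unitaryGroup_iff'.1 (fourierMatrix_mem_unitary q)
  rw [star_eq_conjTranspose] at hunitary
  rw [act, hamTerm_zero, mul_assoc, ← mulVec_mulVec, ← mulVec_mulVec, hmomentum, mulVec_mulVec,
    hunitary, one_mulVec]

theorem interpolant_sampleState_mode (hΩ : 0 < Ω) (b₀ : Reg q) (c : SpinIdx → ℂ) (x : Space) :
    interpolant Ω (sampleState Ω q (mode Ω (gridIdx b₀) c)) x = mode Ω (gridIdx b₀) c x := by
  classical
  funext a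
  have hsqrt : ((Real.sqrt Ω ^ 3 : ℝ) : ℂ) ≠ 0 := by
    exact_mod_cast (by positivity : Real.sqrt Ω ^ 3 ≠ 0)
  simp only [interpolant, act, fourierMatrix_mulVec_sampleState_mode hΩ, mode, Pi.smul_apply,
    smul_eq_mul]
  rw [Finset.sum_eq_single (withSpin b₀ a)]
  · simp only [spin_withSpin, gridIdx_withSpin, if_true]
    rw [ofReal_inv]
    field_simp
  · intro b _ hb
    split_ifs with hspin hgrid
    · exact absurd (spin_gridIdx_injective (by rw [spin_withSpin, hspin])
        (by rw [gridIdx_withSpin, hgrid])) hb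
    · rw [zero_mul]
    · rfl
  · simp only [Finset.mem_univ, not_true_eq_false, false_implies]

theorem sqrt_card_reg : Real.sqrt (Fintype.card (Reg q)) = 2 * Real.sqrt (2 ^ q) ^ 3 := by
  have hsq : (Fintype.card (Reg q) : ℝ) = (2 * Real.sqrt (2 ^ q) ^ 3) ^ 2 := by
    rw [card_reg, mul_pow, sqrt_pow_three_sq (by positivity)]
    push_cast
    norm_num
  rw [hsq, Real.sqrt_sq (by positivity)]

theorem norm_sampleState_le (hΩ : 0 < Ω) {f : Space → SpinIdx → ℂ} {K : ℝ}
    (hf : ∀ x, ‖f x‖ ≤ K) : ‖sampleState Ω q f‖ ≤ 2 * Real.sqrt Ω ^ 3 * K := by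
  have hK : 0 ≤ K := (norm_nonneg _).trans (hf 0)
  have hsum : ∑ b, ‖(sampleState Ω q f).ofLp b‖ ^ 2
      ≤ Fintype.card (Reg q) * (Real.sqrt (Ω / 2 ^ q) ^ 3 * K) ^ 2 := by
    rw [← nsmul_eq_mul, ← Finset.card_univ]
    refine Finset.sum_le_card_nsmul _ _ _ fun b _ => ?_
    rw [sampleState_apply, norm_mul, norm_real, Real.norm_of_nonneg (by positivity)]
    gcongr
    exact (norm_le_pi_norm _ _).trans (hf _)
  calc ‖sampleState Ω q f‖
      ≤ Real.sqrt (Fintype.card (Reg q) * (Real.sqrt (Ω / 2 ^ q) ^ 3 * K) ^ 2) := by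
        rw [EuclideanSpace.norm_eq]
        exact Real.sqrt_le_sqrt hsum
    _ = 2 * (Real.sqrt (2 ^ q) * Real.sqrt (Ω / 2 ^ q)) ^ 3 * K := by
        rw [Real.sqrt_mul (by positivity), Real.sqrt_sq (by positivity), sqrt_card_reg]
        ring
    _ = 2 * Real.sqrt Ω ^ 3 * K := by
        rw [← Real.sqrt_mul (by positivity), mul_div_cancel₀ _ (by positivity)]

theorem norm_sampleState_mode_le (hΩ : 0 < Ω) (p : Fin 3 → ℤ) (c : SpinIdx → ℂ) :
    ‖sampleState Ω q (mode Ω p c)‖ ≤ 2 * Real.sqrt Ω ^ 3 * ‖c‖ :=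
  norm_sampleState_le hΩ fun x => (norm_mode p c x).le

theorem norm_interpolant_le (hΩ : 0 < Ω) (v : QState q) (x : Space) :
    ‖interpolant Ω v x‖ ≤ (Real.sqrt Ω ^ 3)⁻¹ * (4 * (2 ^ q) ^ 3 * ‖v‖) := by
  classical
  refine (pi_norm_le_iff_of_nonneg (by positivity)).2 fun a => ?_
  rw [interpolant, norm_mul, norm_real, Real.norm_of_nonneg (by positivity)]
  gcongr
  have hterm (b : Reg q) (_ : b ∈ Finset.univ) : ‖if spin b = a then
      (act (fourierMatrix q) v) b * planeWave Ω (gridIdx b) x else 0‖ ≤ ‖v‖ := by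
    split_ifs
    · rw [norm_mul, norm_planeWave, mul_one,
        ← norm_act_of_unitary (fourierMatrix_mem_unitary q) v]
      exact PiLp.norm_apply_le _ _
    · rw [norm_zero]
      exact norm_nonneg v
  refine (norm_sum_le _ _).trans ((Finset.sum_le_card_nsmul _ _ _ hterm).trans_eq ?_)
  rw [Finset.card_univ, card_reg, nsmul_eq_mul]
  push_cast
  rfl

theorem norm_diracAlpha_apply_le (i : Fin 3) (a a' : SpinIdx) : ‖diracAlpha i a a'‖ ≤ 1 := by
  obtain ⟨a, b⟩ := a
  obtain ⟨c, d⟩ := a'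
  fin_cases i <;> fin_cases a <;> fin_cases b <;> fin_cases c <;> fin_cases d <;>
    simp [diracAlpha, pauli]

theorem norm_kineticSymbol_apply_le (hΩ : 0 < Ω) (p : Fin 3 → ℤ) (a a' : SpinIdx) :
    ‖kineticSymbol Ω p a a'‖ ≤ 2 * Real.pi / Ω * momentumSize p := by
  rw [kineticSymbol, Matrix.sum_apply, momentumSize, Finset.mul_sum]
  refine (norm_sum_le _ _).trans (Finset.sum_le_sum fun i _ => ?_)
  rw [Matrix.smul_apply, smul_eq_mul, norm_mul, norm_real, Real.norm_eq_abs, abs_div,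
    abs_mul, abs_of_pos hΩ, abs_of_pos Real.two_pi_pos, mul_div_right_comm]
  exact mul_le_of_le_one_right (by positivity) (norm_diracAlpha_apply_le i a a')

theorem norm_kineticSymbol_mulVec_le (hΩ : 0 < Ω) (p : Fin 3 → ℤ) (c : SpinIdx → ℂ) :
    ‖kineticSymbol Ω p *ᵥ c‖ ≤ 8 * Real.pi / Ω * momentumSize p * ‖c‖ := by
  have hsize := momentumSize_nonneg p
  refine (pi_norm_le_iff_of_nonneg (by positivity)).2 fun a => ?_
  have hterm (a' : SpinIdx) (_ : a' ∈ Finset.univ) :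
      ‖kineticSymbol Ω p a a' * c a'‖ ≤ 2 * Real.pi / Ω * momentumSize p * ‖c‖ := by
    rw [norm_mul]
    gcongr
    · exact norm_kineticSymbol_apply_le hΩ p a a'
    · exact norm_le_pi_norm c a'
  refine (norm_sum_le _ _).trans ((Finset.sum_le_card_nsmul _ _ _ hterm).trans_eq ?_)
  rw [Finset.card_univ, Fintype.card_prod, Fintype.card_fin, nsmul_eq_mul]
  push_cast
  ring

theorem norm_kinetic_defect_le (hΩ : 0 < Ω) (m e : ℝ) (φ : Space → ℝ) (A : Space → Fin 3 → ℝ)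
    {p : Fin 3 → ℤ} (hp : 2 ^ q ≤ 2 * momentumSize p) (c : SpinIdx → ℂ) :
    ‖sampleState Ω q (mode Ω p (kineticSymbol Ω p *ᵥ c))
        - act (hamTerm Ω m e φ A q 0) (sampleState Ω q (mode Ω p c))‖
      ≤ 28 * Real.pi / Ω * Real.sqrt Ω ^ 3 * momentumSize p * ‖c‖ := by
  have hexact : ‖sampleState Ω q (mode Ω p (kineticSymbol Ω p *ᵥ c))‖
      ≤ 2 * Real.sqrt Ω ^ 3 * (8 * Real.pi / Ω * momentumSize p * ‖c‖) :=
    (norm_sampleState_mode_le hΩ p _).trans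
      (mul_le_mul_of_nonneg_left (norm_kineticSymbol_mulVec_le hΩ p c) (by positivity))
  have hgrid : ‖act (hamTerm Ω m e φ A q 0) (sampleState Ω q (mode Ω p c))‖
      ≤ 3 * (Real.pi / Ω * (2 * momentumSize p)) * (2 * Real.sqrt Ω ^ 3 * ‖c‖) := by
    have hsize := momentumSize_nonneg p
    refine (norm_act_le _ _).trans ?_
    gcongr
    · exact (norm_hamTerm_zero_le Ω m e φ A hΩ).trans (by gcongr)
    · exact norm_sampleState_mode_le hΩ p c
  refine (norm_sub_le _ _).trans ((add_le_add hexact hgrid).trans_eq ?_)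
  ring

theorem norm_interpolation_defect_le (hΩ : 0 < Ω) {p : Fin 3 → ℤ}
    (hp : 2 ^ q ≤ 2 * momentumSize p) (c : SpinIdx → ℂ) (x : Space) :
    ‖interpolant Ω (sampleState Ω q (mode Ω p c)) x - mode Ω p c x‖
      ≤ (64 * momentumSize p ^ 3 + 1) * ‖c‖ := by
  have hsqrt : Real.sqrt Ω ≠ 0 := (Real.sqrt_pos.2 hΩ).ne'
  have hsize := momentumSize_nonneg p
  have hinterpolant : ‖interpolant Ω (sampleState Ω q (mode Ω p c)) x‖ ≤ (Real.sqrt Ω ^ 3)⁻¹ *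
      (4 * (2 * momentumSize p) ^ 3 * (2 * Real.sqrt Ω ^ 3 * ‖c‖)) := by
    refine (norm_interpolant_le hΩ _ x).trans ?_
    gcongr
    exact norm_sampleState_mode_le hΩ p c
  refine (norm_sub_le _ _).trans ((add_le_add hinterpolant (norm_mode p c x).le).trans_eq ?_)
  field_simp
  ring

end Modes

/-! ## The cell -/

section Cell

open MeasureTheory

variable {Ω : ℝ}

theorem integral_Ico_character (hΩ : 0 < Ω) (d : ℤ) :
    ∫ x in Set.Ico (-(Ω / 2)) (Ω / 2), exp (I * ((2 * Real.pi * (d : ℝ) / Ω * x : ℝ) : ℂ))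
      = if d = 0 then (Ω : ℂ) else 0 := by
  rw [integral_Ico_eq_integral_Ioo, ← integral_Ioc_eq_integral_Ioo,
    ← intervalIntegral.integral_of_le (by linarith)]
  split_ifs with hd
  · simp [hd]
  have hΩ' : (Ω : ℂ) ≠ 0 := ofReal_ne_zero.2 hΩ.ne'
  have hrate : (I * (2 * Real.pi * d / Ω : ℂ)) ≠ 0 := by
    simp [hΩ', Real.pi_ne_zero, hd]
  have hlinear (x : ℝ) : exp (I * ((2 * Real.pi * (d : ℝ) / Ω * x : ℝ) : ℂ))
      = exp (I * (2 * Real.pi * d / Ω : ℂ) * x) := by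
    push_cast
    ring_nf
  have hperiodic : exp (I * (2 * Real.pi * d / Ω : ℂ) * ((Ω / 2 : ℝ) : ℂ))
      = exp (I * (2 * Real.pi * d / Ω : ℂ) * ((-(Ω / 2) : ℝ) : ℂ)) := by
    rw [Complex.exp_eq_exp_iff_exists_int]
    refine ⟨d, ?_⟩
    push_cast
    field_simp
    ring
  simp only [hlinear]
  rw [integral_exp_mul_complex hrate, hperiodic, sub_self, zero_div]

theorem planeWave_eq_prod (p : Fin 3 → ℤ) (x : Space) :
    planeWave Ω p x = ∏ i, exp (I * ((2 * Real.pi * (p i : ℝ) / Ω * x i : ℝ) : ℂ)) := by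
  rw [planeWave, ← Complex.exp_sum, ofReal_sum, Finset.mul_sum]

theorem volume_restrict_cell : (volume : Measure Space).restrict (cell Ω)
    = Measure.pi fun _ => volume.restrict (Set.Ico (-(Ω / 2)) (Ω / 2)) := by
  rw [cell, volume_pi, Measure.restrict_pi_pi]

theorem integral_cell_planeWave (hΩ : 0 < Ω) (p : Fin 3 → ℤ) :
    ∫ x in cell Ω, planeWave Ω p x = if p = 0 then ((Ω ^ 3 : ℝ) : ℂ) else 0 := by
  rw [volume_restrict_cell]
  simp only [planeWave_eq_prod]
  rw [integral_fintype_prod_eq_prod (𝕜 := ℂ)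
    (fun i (y : ℝ) => exp (I * ((2 * Real.pi * (p i : ℝ) / Ω * y : ℝ) : ℂ)))]
  simp only [integral_Ico_character hΩ]
  split_ifs with hp
  · simp [hp]
  · obtain ⟨i, hi⟩ := Function.ne_iff.1 hp
    exact Finset.prod_eq_zero (Finset.mem_univ i) (if_neg hi)

@[fun_prop]
theorem continuous_planeWave (p : Fin 3 → ℤ) : Continuous (planeWave Ω p) := by
  unfold planeWave
  fun_prop

theorem integrableOn_cell {E : Type*} [NormedAddCommGroup E] {f : Space → E} (hf : Continuous f) :
    IntegrableOn f (cell Ω) := by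
  refine (hf.continuousOn.integrableOn_compact isCompact_Icc :
    IntegrableOn f (Set.Icc (fun _ => -(Ω / 2)) (fun _ => Ω / 2))).mono_set fun x hx => ?_
  exact ⟨fun i => (hx i trivial).1, fun i => (hx i trivial).2.le⟩

theorem measureReal_cell (hΩ : 0 ≤ Ω) : volume.real (cell Ω) = Ω ^ 3 := by
  rw [measureReal_def, cell, volume_pi_pi]
  simp only [Real.volume_Ico, sub_neg_eq_add, add_halves, Finset.prod_const, Finset.card_univ,
    Fintype.card_fin, ENNReal.toReal_pow, ENNReal.toReal_ofReal hΩ]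

theorem planeWave_mul_conj (p p' : Fin 3 → ℤ) (x : Space) :
    planeWave Ω p x * (starRingEnd ℂ) (planeWave Ω p' x) = planeWave Ω (p - p') x := by
  rw [planeWave, planeWave, planeWave, ← Complex.exp_conj, ← Complex.exp_add, map_mul, conj_I,
    conj_ofReal, neg_mul, ← sub_eq_add_neg, ← mul_sub, ← ofReal_sub, ← Finset.sum_sub_distrib]
  congr 3
  refine Finset.sum_congr rfl fun i _ => ?_
  rw [Pi.sub_apply]
  push_cast
  ring

theorem integral_norm_sq_sum_planeWave (hΩ : 0 < Ω) {ι : Type*} {s : Finset ι}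
    {p : ι → Fin 3 → ℤ} (hp : Set.InjOn p s) (z : ι → ℂ) :
    ∫ x in cell Ω, ‖∑ b ∈ s, z b * planeWave Ω (p b) x‖ ^ 2 = Ω ^ 3 * ∑ b ∈ s, ‖z b‖ ^ 2 := by
  have hexpand (x) : ((‖∑ b ∈ s, z b * planeWave Ω (p b) x‖ ^ 2 : ℝ) : ℂ)
      = ∑ b ∈ s, ∑ b' ∈ s, (z b * (starRingEnd ℂ) (z b')) * planeWave Ω (p b - p b') x := by
    rw [ofReal_pow, ← Complex.mul_conj', map_sum, Finset.sum_mul_sum]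
    refine Finset.sum_congr rfl fun b _ => Finset.sum_congr rfl fun b' _ => ?_
    rw [map_mul, mul_mul_mul_comm, planeWave_mul_conj]
  have hmodes (b b') : IntegrableOn
      (fun x => (z b * (starRingEnd ℂ) (z b')) * planeWave Ω (p b - p b') x) (cell Ω) :=
    integrableOn_cell (by fun_prop)
  apply ofReal_injective
  rw [← integral_complex_ofReal]
  simp only [hexpand]
  rw [integral_finsetSum _ (fun b _ => integrable_finsetSum _ fun b' _ => hmodes b b'), ofReal_mul,
    ofReal_sum, Finset.mul_sum]
  refine Finset.sum_congr rfl fun b hb => ?_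
  rw [integral_finsetSum _ (fun b' _ => hmodes b b')]
  simp only [integral_const_mul, integral_cell_planeWave hΩ, sub_eq_zero]
  rw [Finset.sum_eq_single_of_mem b hb]
  · rw [if_pos rfl, Complex.mul_conj', ofReal_pow, ofReal_pow, mul_comm]
  · intro b' hb' hne
    rw [if_neg fun h => hne (hp hb hb' h).symm, mul_zero]

theorem continuous_interpolant {q : ℕ} (v : QState q) : Continuous (interpolant Ω v) := by
  classical
  refine continuous_pi fun a => ?_
  unfold interpolant
  refine continuous_const.mul (continuous_finsetSum _ fun b _ => ?_)
  split_ifs <;> fun_prop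

theorem integral_norm_sq_interpolant (hΩ : 0 < Ω) {q : ℕ} (v : QState q) (a : SpinIdx) :
    ∫ x in cell Ω, ‖interpolant Ω v x a‖ ^ 2
      = ∑ b : Reg q, if spin b = a then ‖act (fourierMatrix q) v b‖ ^ 2 else 0 := by
  classical
  have hfield (x) : ‖interpolant Ω v x a‖ ^ 2
      = (Ω ^ 3)⁻¹ * ‖∑ b ∈ Finset.univ.filter (fun b : Reg q => spin b = a),
        act (fourierMatrix q) v b * planeWave Ω (gridIdx b) x‖ ^ 2 := by
    rw [Finset.sum_filter, interpolant, norm_mul, mul_pow, norm_real,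
      Real.norm_of_nonneg (by positivity), inv_pow, sqrt_pow_three_sq hΩ.le]
  have hinj : Set.InjOn gridIdx {b : Reg q | spin b = a} := by
    intro b hb b' hb' hgrid
    exact spin_gridIdx_injective (Eq.trans hb hb'.symm) hgrid
  simp only [hfield]
  rw [integral_const_mul, integral_norm_sq_sum_planeWave hΩ (by simpa using hinj),
    inv_mul_cancel_left₀ (by positivity), Finset.sum_filter]

theorem cellNorm_interpolant (hΩ : 0 < Ω) {q : ℕ} (v : QState q) :
    cellNorm Ω (interpolant Ω v) = ‖v‖ := by
  rw [← norm_act_of_unitary (fourierMatrix_mem_unitary q) v, cellNorm, EuclideanSpace.norm_eq,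
    integral_finsetSum]
  · simp only [integral_norm_sq_interpolant hΩ]
    rw [Finset.sum_comm]
    simp only [Finset.sum_ite_eq, Finset.mem_univ, if_true]
  · intro a _
    exact integrableOn_cell (((continuous_pi_iff.1 (continuous_interpolant v) a).norm).pow 2)

theorem memLp_cell {E : Type*} [NormedAddCommGroup E] {f : Space → E} (hf : Continuous f) :
    MemLp f 2 (volume.restrict (cell Ω)) := by
  rw [memLp_two_iff_integrable_sq_norm hf.aestronglyMeasurable]
  exact integrableOn_cell (hf.norm.pow 2)

theorem cellNorm_eq_eLpNorm {f : Space → EuclideanSpace ℂ SpinIdx} (hf : Continuous f) :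
    cellNorm Ω (fun x => (f x).ofLp) = (eLpNorm f 2 (volume.restrict (cell Ω))).toReal := by
  rw [(memLp_cell hf).eLpNorm_eq_integral_rpow_norm (by norm_num) (by norm_num), cellNorm,
    Real.sqrt_eq_rpow, ENNReal.toReal_ofReal (by positivity)]
  norm_num [EuclideanSpace.norm_sq_eq]

theorem cellNorm_add_le {f g : Space → SpinIdx → ℂ} (hf : Continuous f) (hg : Continuous g) :
    cellNorm Ω (f + g) ≤ cellNorm Ω f + cellNorm Ω g := by
  let F (x : Space) : EuclideanSpace ℂ SpinIdx := WithLp.toLp 2 (f x)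
  let G (x : Space) : EuclideanSpace ℂ SpinIdx := WithLp.toLp 2 (g x)
  have hF : Continuous F := by fun_prop
  have hG : Continuous G := by fun_prop
  have hF' := memLp_cell (Ω := Ω) hF
  have hG' := memLp_cell (Ω := Ω) hG
  calc cellNorm Ω (f + g)
      = (eLpNorm (F + G) 2 (volume.restrict (cell Ω))).toReal := cellNorm_eq_eLpNorm (hF.add hG)
    _ ≤ (eLpNorm F 2 (volume.restrict (cell Ω))).toReal
          + (eLpNorm G 2 (volume.restrict (cell Ω))).toReal := by
        rw [← ENNReal.toReal_add hF'.eLpNorm_ne_top hG'.eLpNorm_ne_top]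
        exact ENNReal.toReal_mono
          (ENNReal.add_ne_top.2 ⟨hF'.eLpNorm_ne_top, hG'.eLpNorm_ne_top⟩)
          (eLpNorm_add_le hF'.1 hG'.1 (by norm_num))
    _ = cellNorm Ω f + cellNorm Ω g := by
        rw [← cellNorm_eq_eLpNorm hF, ← cellNorm_eq_eLpNorm hG]

theorem cellNorm_le_of_norm_le (hΩ : 0 ≤ Ω) {f : Space → SpinIdx → ℂ} (hf : Continuous f) {K : ℝ}
    (h : ∀ x, ‖f x‖ ≤ K) : cellNorm Ω f ≤ 2 * Real.sqrt Ω ^ 3 * K := by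
  have hK : 0 ≤ K := (norm_nonneg _).trans (h 0)
  have hpoint (x) : ∑ a, ‖f x a‖ ^ 2 ≤ 4 * K ^ 2 := by
    refine (Finset.sum_le_card_nsmul _ _ (K ^ 2) fun a _ => ?_).trans_eq ?_
    · gcongr
      exact (norm_le_pi_norm _ _).trans (h x)
    · rw [Finset.card_univ, Fintype.card_prod, Fintype.card_fin, nsmul_eq_mul]
      norm_num
  rw [cellNorm]
  refine Real.sqrt_le_iff.2 ⟨by positivity, ?_⟩
  calc ∫ x in cell Ω, ∑ a, ‖f x a‖ ^ 2
      ≤ ∫ _ in cell Ω, 4 * K ^ 2 :=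
        setIntegral_mono (integrableOn_cell (by fun_prop)) (integrableOn_cell (by fun_prop)) hpoint
    _ = 4 * Ω ^ 3 * K ^ 2 := by
        rw [setIntegral_const, measureReal_cell hΩ, smul_eq_mul]
        ring
    _ = (2 * Real.sqrt Ω ^ 3 * K) ^ 2 := by
        rw [← sqrt_pow_three_sq hΩ]
        ring

end Cell

/-! ## Exponentially decaying Fourier series -/

section Tails

theorem summable_prod_pi {ι : Type*} {f : ι → ℝ} (hf₀ : ∀ x, 0 ≤ f x) (hf : Summable f) (n : ℕ) :
    Summable fun p : Fin n → ι => ∏ i, f (p i) := by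
  induction n with
  | zero => exact Summable.of_finite
  | succ n ih =>
    rw [← (Fin.consEquiv fun _ => ι).summable_iff]
    refine (hf.mul_of_nonneg ih hf₀ fun p => Finset.prod_nonneg fun i _ => hf₀ _).congr fun x => ?_
    simp only [Function.comp_apply, Fin.consEquiv_apply, Fin.prod_univ_succ, Fin.cons_zero,
      Fin.cons_succ]

theorem summable_exp_neg_abs {δ : ℝ} (hδ : 0 < δ) :
    Summable fun x : ℤ => Real.exp (-(δ * |(x : ℝ)|)) := by
  have hnat : Summable fun n : ℕ => Real.exp (-(δ * n)) :=
    (Real.summable_exp_nat_mul_iff.2 (neg_lt_zero.2 hδ)).congr fun n => by ring_nf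
  exact Summable.of_nat_of_neg (by simpa using hnat) (by simpa using hnat)

/-- The exponential weight `(1 + |p|)³ e^{-δ|p|}`; the polynomial factor leaves room for the
symbol of `-i α · ∇` (degree one) and for the number of grid momenta (degree three). -/
def decayWeight (δ : ℝ) (p : Fin 3 → ℤ) : ℝ :=
  (1 + momentumSize p) ^ 3 * Real.exp (-(δ * momentumSize p))

theorem one_le_one_add_momentumSize (p : Fin 3 → ℤ) : 1 ≤ 1 + momentumSize p :=
  le_add_of_nonneg_right (momentumSize_nonneg p)

theorem momentumSize_le_one_add_pow (p : Fin 3 → ℤ) : momentumSize p ≤ (1 + momentumSize p) ^ 3 :=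
  (le_add_of_nonneg_left zero_le_one).trans
    (le_self_pow₀ (one_le_one_add_momentumSize p) three_ne_zero)

theorem decayWeight_nonneg (δ : ℝ) (p : Fin 3 → ℤ) : 0 ≤ decayWeight δ p := by
  have := momentumSize_nonneg p
  unfold decayWeight
  positivity

theorem one_add_le_mul_exp {η s : ℝ} (hη : 0 < η) (hs : 0 ≤ s) :
    1 + s ≤ (1 / η + 1) * Real.exp (η * s) := by
  have hone : 1 ≤ Real.exp (η * s) := Real.one_le_exp (by positivity)
  have hlin : s ≤ 1 / η * Real.exp (η * s) := by
    rw [one_div, ← div_eq_inv_mul, le_div_iff₀' hη]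
    linarith [Real.add_one_le_exp (η * s)]
  linarith

theorem decayWeight_le {δ : ℝ} (hδ : 0 < δ) (p : Fin 3 → ℤ) :
    decayWeight δ p ≤ (6 / δ + 1) ^ 3 * ∏ i, Real.exp (-(δ / 2 * |(p i : ℝ)|)) := by
  have hpoly := one_add_le_mul_exp (η := δ / 6) (by positivity) (momentumSize_nonneg p)
  rw [one_div_div] at hpoly
  have hone := one_le_one_add_momentumSize p
  calc decayWeight δ p
      ≤ ((6 / δ + 1) * Real.exp (δ / 6 * momentumSize p)) ^ 3
          * Real.exp (-(δ * momentumSize p)) := by rw [decayWeight]; gcongr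
    _ = (6 / δ + 1) ^ 3 * Real.exp (-(δ / 2 * momentumSize p)) := by
        rw [mul_pow, mul_assoc, ← Real.exp_nat_mul, ← Real.exp_add]
        ring_nf
    _ = (6 / δ + 1) ^ 3 * ∏ i, Real.exp (-(δ / 2 * |(p i : ℝ)|)) := by
        rw [← Real.exp_sum, momentumSize, Finset.mul_sum, Finset.sum_neg_distrib]

theorem summable_decayWeight {δ : ℝ} (hδ : 0 < δ) : Summable (decayWeight δ) :=
  Summable.of_nonneg_of_le (decayWeight_nonneg δ) (decayWeight_le hδ)
    ((summable_prod_pi (fun _ => (Real.exp_pos _).le)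
      (summable_exp_neg_abs (half_pos hδ)) 3).mul_left _)

/-- Half of the decay rate pays for summability; on unresolved momenta `2 ^ q ≤ 2|p|`, so the other
half gives the factor `e^{-ρ 2^q / 4}`. -/
theorem norm_le_of_hasSum_tail {E : Type*} [NormedAddCommGroup E] {q : ℕ} {ρ B : ℝ} (hρ : 0 < ρ)
    (hB : 0 ≤ B) {g : (Fin 3 → ℤ) → E} {G : E} (hg : HasSum g G)
    (hgrid : ∀ b : Reg q, g (gridIdx b) = 0)
    (htail : ∀ p, (2 : ℝ) ^ q ≤ 2 * momentumSize p → ‖g p‖ ≤ B * decayWeight ρ p) :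
    ‖G‖ ≤ B * Real.exp (-(ρ / 4 * 2 ^ q)) * ∑' p, decayWeight (ρ / 2) p := by
  refine hg.norm_le_of_bounded ((summable_decayWeight (half_pos hρ)).hasSum.mul_left
    (B * Real.exp (-(ρ / 4 * 2 ^ q)))) fun p => ?_
  have hweight := decayWeight_nonneg (ρ / 2) p
  by_cases hp : ∃ b : Reg q, gridIdx b = p
  · obtain ⟨b, rfl⟩ := hp
    rw [hgrid, norm_zero]
    positivity
  · push Not at hp
    have hsize : (2 : ℝ) ^ q ≤ 2 * momentumSize p := two_pow_le_of_forall_gridIdx_ne hp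
    have hnonneg := momentumSize_nonneg p
    refine (htail p hsize).trans ?_
    rw [mul_assoc, decayWeight, decayWeight, mul_left_comm (Real.exp _), ← Real.exp_add]
    gcongr
    nlinarith

end Tails

/-! ## Sampling analytic fields -/

section Analytic

open Matrix

variable {Ω ρ M : ℝ} {q : ℕ}

theorem hasSum_sampleState {ι : Type*} {F : ι → Space → SpinIdx → ℂ} {f : Space → SpinIdx → ℂ}
    (hF : ∀ x, HasSum (fun p => F p x) (f x)) :
    HasSum (fun p => sampleState Ω q (F p)) (sampleState Ω q f) := by
  have hcoord : HasSum (fun p => (sampleState Ω q (F p)).ofLp) (sampleState Ω q f).ofLp := by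
    rw [Pi.hasSum]
    intro b
    simp only [sampleState_apply]
    exact (Pi.hasSum.1 (hF (node Ω b)) (spin b)).mul_left _
  exact hcoord.mapL
    (PiLp.continuousLinearEquiv 2 ℂ (fun _ : Reg q => ℂ)).symm.toContinuousLinearMap

theorem hasSum_act {ι : Type*} (U : Matrix (Reg q) (Reg q) ℂ) {g : ι → QState q} {G : QState q}
    (hg : HasSum g G) : HasSum (fun p => act U (g p)) (act U G) :=
  hg.mapL (Matrix.toEuclideanCLM (n := Reg q) (𝕜 := ℂ) U)

theorem hasSum_interpolant {ι : Type*} {g : ι → QState q} {G : QState q}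
    (hg : HasSum g G) (x : Space) :
    HasSum (fun p => interpolant Ω (g p) x) (interpolant Ω G x) := by
  classical
  refine Pi.hasSum.2 fun a => ?_
  unfold interpolant
  refine HasSum.mul_left _ (hasSum_sum fun b _ => ?_)
  split_ifs
  · exact ((hasSum_act (fourierMatrix q) hg).mapL
      (EuclideanSpace.proj b : QState q →L[ℂ] ℂ)).mul_right _
  · exact hasSum_zero

theorem nonneg_of_norm_coeff_le {c : (Fin 3 → ℤ) → SpinIdx → ℂ}
    (hc : ∀ p, ‖c p‖ ≤ M * Real.exp (-(ρ * momentumSize p))) : 0 ≤ M :=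
  nonneg_of_mul_nonneg_left ((norm_nonneg _).trans (hc 0)) (Real.exp_pos _)

theorem AnalyticPeriodic.exists_hasSum_mode {f : Space → SpinIdx → ℂ}
    (hf : AnalyticPeriodic Ω ρ M f) :
    ∃ c : (Fin 3 → ℤ) → SpinIdx → ℂ, (∀ p, ‖c p‖ ≤ M * Real.exp (-(ρ * momentumSize p))) ∧
      ∀ x, HasSum (fun p => mode Ω p (c p) x) (f x) := by
  obtain ⟨c, hc, hs⟩ := hf
  exact ⟨c, fun p => (pi_norm_le_iff_of_nonneg ((norm_nonneg _).trans (hc p (0, 0)))).2 (hc p), hs⟩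

theorem norm_interpolant_sampleState_sub_le (hΩ : 0 < Ω) (hρ : 0 < ρ) {f : Space → SpinIdx → ℂ}
    (hf : AnalyticPeriodic Ω ρ M f) (x : Space) :
    ‖interpolant Ω (sampleState Ω q f) x - f x‖
      ≤ 65 * M * Real.exp (-(ρ / 4 * 2 ^ q)) * ∑' p, decayWeight (ρ / 2) p := by
  obtain ⟨c, hc, hs⟩ := hf.exists_hasSum_mode
  have hM := nonneg_of_norm_coeff_le hc
  refine norm_le_of_hasSum_tail (q := q) hρ (by positivity)
    ((hasSum_interpolant (hasSum_sampleState (q := q) hs) x).sub (hs x)) (fun b => ?_)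
    fun p hp => ?_
  · rw [interpolant_sampleState_mode hΩ, sub_self]
  · have hsize := momentumSize_nonneg p
    have hpoly : 64 * momentumSize p ^ 3 + 1 ≤ 65 * (1 + momentumSize p) ^ 3 := by
      have hcube : momentumSize p ^ 3 ≤ (1 + momentumSize p) ^ 3 := by gcongr; linarith
      linarith [one_le_pow₀ (one_le_one_add_momentumSize p) (n := 3)]
    calc ‖interpolant Ω (sampleState Ω q (mode Ω p (c p))) x - mode Ω p (c p) x‖
        ≤ (64 * momentumSize p ^ 3 + 1) * ‖c p‖ := norm_interpolation_defect_le hΩ hp (c p) x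
      _ ≤ 65 * (1 + momentumSize p) ^ 3 * (M * Real.exp (-(ρ * momentumSize p))) := by
          gcongr
          exact hc p
      _ = 65 * M * decayWeight ρ p := by rw [decayWeight]; ring

theorem planeWave_add_smul_single (p : Fin 3 → ℤ) (x : Space) (i : Fin 3) (s : ℝ) :
    planeWave Ω p (x + s • Pi.single i 1)
      = planeWave Ω p x * exp (I * ((2 * Real.pi * (p i : ℝ) / Ω : ℝ) : ℂ) * s) := by
  have hcoord : ∀ j, 2 * Real.pi * (p j : ℝ) / Ω * (x + s • (Pi.single i 1 : Space)) j
      = 2 * Real.pi * (p j : ℝ) / Ω * x j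
        + if j = i then 2 * Real.pi * (p j : ℝ) / Ω * s else 0 := by
    intro j
    rw [Pi.add_apply, Pi.smul_apply, Pi.single_apply]
    split_ifs <;> simp [mul_add]
  rw [planeWave, planeWave, ← Complex.exp_add, mul_assoc, ← mul_add, ← ofReal_mul, ← ofReal_add]
  simp only [hcoord, Finset.sum_add_distrib, Finset.sum_ite_eq', Finset.mem_univ, if_true]

theorem hasDerivAt_mode_line (p : Fin 3 → ℤ) (c : SpinIdx → ℂ) (x : Space) (i : Fin 3) (s : ℝ) :
    HasDerivAt (fun s : ℝ => mode Ω p c (x + s • Pi.single i 1))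
      ((I * ((2 * Real.pi * (p i : ℝ) / Ω : ℝ) : ℂ)) • mode Ω p c (x + s • Pi.single i 1)) s := by
  set k : ℂ := I * ((2 * Real.pi * (p i : ℝ) / Ω : ℝ) : ℂ) with hk
  have hexp : HasDerivAt (fun s : ℝ => exp (k * s)) (exp (k * s) * k) s := by
    simpa using ((hasDerivAt_id s).ofReal_comp.const_mul k).cexp
  simp only [mode, planeWave_add_smul_single, ← hk]
  refine ((hexp.const_mul (planeWave Ω p x)).smul_const c).congr_deriv ?_
  rw [smul_smul]
  congr 1
  ring

theorem norm_mode_deriv_le (hΩ : 0 < Ω) {p : Fin 3 → ℤ} {c : SpinIdx → ℂ}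
    (hc : ‖c‖ ≤ M * Real.exp (-(ρ * momentumSize p))) (x : Space) (i : Fin 3) :
    ‖(I * ((2 * Real.pi * (p i : ℝ) / Ω : ℝ) : ℂ)) • mode Ω p c x‖
      ≤ 2 * Real.pi / Ω * M * decayWeight ρ p := by
  have hsize : |(p i : ℝ)| ≤ (1 + momentumSize p) ^ 3 :=
    (Finset.single_le_sum (f := fun j => |(p j : ℝ)|) (fun _ _ => abs_nonneg _)
      (Finset.mem_univ i)).trans (momentumSize_le_one_add_pow p)
  rw [norm_smul, norm_mode, norm_mul, norm_I, one_mul, norm_real, Real.norm_eq_abs, abs_div,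
    abs_mul, abs_of_pos hΩ, abs_of_pos Real.two_pi_pos]
  calc 2 * Real.pi * |(p i : ℝ)| / Ω * ‖c‖
      ≤ 2 * Real.pi * (1 + momentumSize p) ^ 3 / Ω
          * (M * Real.exp (-(ρ * momentumSize p))) := by
        have := momentumSize_nonneg p
        gcongr
    _ = 2 * Real.pi / Ω * M * decayWeight ρ p := by rw [decayWeight]; ring

theorem hasSum_fderiv (hΩ : 0 < Ω) (hρ : 0 < ρ) {f : Space → SpinIdx → ℂ}
    {c : (Fin 3 → ℤ) → SpinIdx → ℂ} (hc : ∀ p, ‖c p‖ ≤ M * Real.exp (-(ρ * momentumSize p)))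
    (hs : ∀ x, HasSum (fun p => mode Ω p (c p) x) (f x)) (hf : Differentiable ℝ f)
    (x : Space) (i : Fin 3) :
    HasSum (fun p => (I * ((2 * Real.pi * (p i : ℝ) / Ω : ℝ) : ℂ)) • mode Ω p (c p) x)
      (fderiv ℝ f x (Pi.single i 1)) := by
  have hbound : Summable fun p => 2 * Real.pi / Ω * M * decayWeight ρ p :=
    (summable_decayWeight hρ).mul_left _
  have hseries := hasDerivAt_tsum (y₀ := 0) hbound
    (fun p s => hasDerivAt_mode_line (Ω := Ω) p (c p) x i s)
    (fun p s => norm_mode_deriv_le hΩ (hc p) _ i) (hs _).summable 0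
  simp only [(hs _).tsum_eq, zero_smul, add_zero] at hseries
  have hline : HasDerivAt (fun s : ℝ => f (x + s • Pi.single i 1))
      (fderiv ℝ f x (Pi.single i 1)) 0 := by
    have hdir : HasDerivAt (fun s : ℝ => x + s • (Pi.single i 1 : Space)) (Pi.single i 1) 0 := by
      simpa using ((hasDerivAt_id (0 : ℝ)).smul_const (Pi.single i 1 : Space)).const_add x
    have hfx : HasFDerivAt f (fderiv ℝ f x) (x + (0 : ℝ) • (Pi.single i 1 : Space)) := by
      simpa using (hf x).hasFDerivAt
    exact hfx.comp_hasDerivAt (0 : ℝ) hdir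
  rw [← hseries.unique hline]
  exact (Summable.of_norm_bounded hbound fun p => norm_mode_deriv_le hΩ (hc p) x i).hasSum

/-- The kinetic part `-i α · ∇ f` of the Dirac Hamiltonian, which the register replaces by its
spectral version `H₁`. -/
def kineticField (f : Space → SpinIdx → ℂ) (x : Space) : SpinIdx → ℂ :=
  ∑ i, diracAlpha i *ᵥ ((-I) • fderiv ℝ f x (Pi.single i 1))

theorem mode_kineticSymbol (p : Fin 3 → ℤ) (c : SpinIdx → ℂ) (x : Space) :
    mode Ω p (kineticSymbol Ω p *ᵥ c) x
      = ∑ i, diracAlpha i *ᵥ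
          ((-I) • (I * ((2 * Real.pi * (p i : ℝ) / Ω : ℝ) : ℂ)) • mode Ω p c x) := by
  rw [mode, kineticSymbol, sum_mulVec, Finset.smul_sum]
  refine Finset.sum_congr rfl fun i _ => ?_
  rw [mode, smul_mulVec, mulVec_smul, mulVec_smul, mulVec_smul, smul_smul, smul_smul, smul_smul]
  congr 1
  linear_combination (planeWave Ω p x * ((2 * Real.pi * (p i : ℝ) / Ω : ℝ) : ℂ)) * I_mul_I

theorem hasSum_kineticField (hΩ : 0 < Ω) (hρ : 0 < ρ) {f : Space → SpinIdx → ℂ}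
    {c : (Fin 3 → ℤ) → SpinIdx → ℂ} (hc : ∀ p, ‖c p‖ ≤ M * Real.exp (-(ρ * momentumSize p)))
    (hs : ∀ x, HasSum (fun p => mode Ω p (c p) x) (f x)) (hf : Differentiable ℝ f)
    (x : Space) :
    HasSum (fun p => mode Ω p (kineticSymbol Ω p *ᵥ c p) x) (kineticField f x) := by
  simp only [mode_kineticSymbol, kineticField]
  exact hasSum_sum fun i _ => ((hasSum_fderiv hΩ hρ hc hs hf x i).const_smul (-I)).mapL
    (LinearMap.toContinuousLinearMap (diracAlpha i).mulVecLin)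

theorem norm_kinetic_consistency_le (hΩ : 0 < Ω) (hρ : 0 < ρ) (m e : ℝ) (φ : Space → ℝ)
    (A : Space → Fin 3 → ℝ) {f : Space → SpinIdx → ℂ} (hf : AnalyticPeriodic Ω ρ M f)
    (hd : Differentiable ℝ f) :
    ‖sampleState Ω q (kineticField f) - act (hamTerm Ω m e φ A q 0) (sampleState Ω q f)‖
      ≤ 28 * Real.pi / Ω * Real.sqrt Ω ^ 3 * M * Real.exp (-(ρ / 4 * 2 ^ q))
        * ∑' p, decayWeight (ρ / 2) p := by
  obtain ⟨c, hc, hs⟩ := hf.exists_hasSum_mode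
  have hM := nonneg_of_norm_coeff_le hc
  refine norm_le_of_hasSum_tail (q := q) hρ (by positivity)
    ((hasSum_sampleState (hasSum_kineticField hΩ hρ hc hs hd)).sub
      (hasSum_act (hamTerm Ω m e φ A q 0) (hasSum_sampleState hs))) (fun b => ?_) fun p hp => ?_
  · rw [act_hamTerm_zero_sampleState_mode hΩ, sub_self]
  · have hsize := momentumSize_nonneg p
    calc ‖sampleState Ω q (mode Ω p (kineticSymbol Ω p *ᵥ c p))
            - act (hamTerm Ω m e φ A q 0) (sampleState Ω q (mode Ω p (c p)))‖
        ≤ 28 * Real.pi / Ω * Real.sqrt Ω ^ 3 * momentumSize p * ‖c p‖ :=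
          norm_kinetic_defect_le hΩ m e φ A hp (c p)
      _ ≤ 28 * Real.pi / Ω * Real.sqrt Ω ^ 3 * (1 + momentumSize p) ^ 3
            * (M * Real.exp (-(ρ * momentumSize p))) := by
          gcongr
          · exact momentumSize_le_one_add_pow p
          · exact hc p
      _ = 28 * Real.pi / Ω * Real.sqrt Ω ^ 3 * M * decayWeight ρ p := by rw [decayWeight]; ring

end Analytic

/-! ## Comparison with the discrete evolution -/

section Duhamel

open Matrix

variable {q : ℕ}

theorem norm_exp_smul_apply_sub_le {E : Type*} [NormedAddCommGroup E] [NormedSpace ℂ E]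
    [CompleteSpace E] (Y : E →L[ℂ] E) (hY : ∀ (t : ℝ) x, ‖NormedSpace.exp (t • Y) x‖ = ‖x‖)
    {v d : ℝ → E} {T δ : ℝ}
    (hv : ∀ t ∈ Set.uIcc 0 T, HasDerivWithinAt v (Y (v t) + d t) (Set.uIcc 0 T) t)
    (hd : ∀ t ∈ Set.uIcc 0 T, ‖d t‖ ≤ δ) :
    ‖NormedSpace.exp (T • Y) (v 0) - v T‖ ≤ δ * |T| := by
  -- The interaction picture: transported back to time `0`, the solution moves only through `d`.
  have hderiv : ∀ t ∈ Set.uIcc 0 T,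
      HasDerivWithinAt (fun s : ℝ => NormedSpace.exp ((T - s) • Y) (v s))
        (NormedSpace.exp ((T - t) • Y) (d t)) (Set.uIcc 0 T) t := by
    intro t ht
    have hexp : HasDerivAt (fun s : ℝ => NormedSpace.exp ((T - s) • Y))
        (-(NormedSpace.exp ((T - t) • Y) * Y)) t := by
      refine ((hasDerivAt_exp_smul_const (𝕂 := ℝ) Y (T - t)).scomp t
        ((hasDerivAt_id t).const_sub T)).congr_deriv ?_
      rw [neg_smul, one_smul]
    have happly : HasDerivAt
        (fun s : ℝ => ((NormedSpace.exp ((T - s) • Y)).restrictScalars ℝ : E →L[ℝ] E))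
        ((-(NormedSpace.exp ((T - t) • Y) * Y)).restrictScalars ℝ) t :=
      (ContinuousLinearMap.restrictScalarsL ℂ E E ℝ ℝ).hasFDerivAt.comp_hasDerivAt t hexp
    refine (happly.hasDerivWithinAt.clm_apply (hv t ht)).congr_deriv ?_
    rw [ContinuousLinearMap.coe_restrictScalars', ContinuousLinearMap.coe_restrictScalars',
      _root_.neg_apply, mul_apply_eq_comp, map_add, neg_add_cancel_left]
  have hmean := Convex.norm_image_sub_le_of_norm_hasDerivWithin_le hderiv
    (fun t ht => (hY (T - t) (d t)).trans_le (hd t ht)) (convex_uIcc 0 T)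
    Set.left_mem_uIcc Set.right_mem_uIcc
  rw [norm_sub_rev]
  simpa using hmean

open scoped Matrix.Norms.L2Operator in
theorem act_propagator (H : Matrix (Reg q) (Reg q) ℂ) (t : ℝ) (v : QState q) :
    act (propagator H t) v
      = NormedSpace.exp (t • toEuclideanCLM (n := Reg q) (𝕜 := ℂ) ((-I) • H)) v := by
  have hcont : Continuous (toEuclideanCLM (n := Reg q) (𝕜 := ℂ)) :=
    LinearMap.continuous_of_finiteDimensional
      (toEuclideanCLM (n := Reg q) (𝕜 := ℂ)).toAlgEquiv.toLinearMap
  have hsmul : toEuclideanCLM (n := Reg q) (𝕜 := ℂ) (t • ((-I) • H))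
      = t • toEuclideanCLM (n := Reg q) (𝕜 := ℂ) ((-I) • H) :=
    map_smul (toEuclideanCLM (n := Reg q) (𝕜 := ℂ)) (t : ℂ) ((-I) • H)
  let _ : NormedAlgebra ℚ (Matrix (Reg q) (Reg q) ℂ) := .restrictScalars ℚ ℂ _
  rw [← hsmul, ← NormedSpace.map_exp _ hcont, ← propagator_eq]
  rfl

theorem norm_propagator_sub_le {H : Matrix (Reg q) (Reg q) ℂ} (hH : H.IsHermitian)
    {v d : ℝ → QState q} {T δ : ℝ}
    (hv : ∀ t ∈ Set.uIcc 0 T,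
      HasDerivWithinAt v ((-I) • act H (v t) + d t) (Set.uIcc 0 T) t)
    (hd : ∀ t ∈ Set.uIcc 0 T, ‖d t‖ ≤ δ) :
    ‖act (propagator H T) (v 0) - v T‖ ≤ δ * |T| := by
  have hgen (w : QState q) :
      toEuclideanCLM (n := Reg q) (𝕜 := ℂ) ((-I) • H) w = (-I) • act H w := by
    rw [map_smul]
    rfl
  rw [act_propagator]
  refine norm_exp_smul_apply_sub_le _ (fun t x => ?_) (fun t ht => ?_) hd
  · rw [← act_propagator, norm_act_of_unitary (propagator_mem_unitary hH t)]
  · rw [hgen]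
    exact hv t ht

variable {Ω ρ M m e T : ℝ} {φ : Space → ℝ} {A : Space → Fin 3 → ℝ} {ψ : ℝ → Space → SpinIdx → ℂ}

theorem hasDerivWithinAt_sampleState {ψ' : Space → SpinIdx → ℂ} {S : Set ℝ} {t : ℝ}
    (h : ∀ x, HasDerivWithinAt (fun s => ψ s x) (ψ' x) S t) :
    HasDerivWithinAt (fun s => sampleState Ω q (ψ s)) (sampleState Ω q ψ') S t := by
  have hcoord : HasDerivWithinAt (fun s => (sampleState Ω q (ψ s)).ofLp)
      (sampleState Ω q ψ').ofLp S t :=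
    hasDerivWithinAt_pi.2 fun b =>
      (hasDerivWithinAt_pi.1 (h (node Ω b)) (spin b)).const_mul _
  exact (PiLp.continuousLinearEquiv 2 ℝ
    (fun _ : Reg q => ℂ)).symm.toContinuousLinearMap.hasFDerivAt.comp_hasDerivWithinAt t hcoord

theorem act_sum {ι : Type*} (s : Finset ι) (U : ι → Matrix (Reg q) (Reg q) ℂ) (v : QState q) :
    act (∑ j ∈ s, U j) v = ∑ j ∈ s, act (U j) v := by
  simp only [act, sum_mulVec, WithLp.toLp_sum]

theorem act_hamTerm_one_sampleState (f : Space → SpinIdx → ℂ) :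
    act (hamTerm Ω m e φ A q 1) (sampleState Ω q f)
      = sampleState Ω q fun x => (m : ℂ) • diracBeta *ᵥ f x := by
  ext b
  rw [hamTerm_one, act, sampleState_apply, diracBeta_eq_diagonal]
  simp only [mulVec_diagonal, Pi.smul_apply, sampleState_apply, smul_eq_mul]
  push_cast
  simp only [spin]
  ring

theorem act_hamTerm_two_sampleState (f : Space → SpinIdx → ℂ) :
    act (hamTerm Ω m e φ A q 2) (sampleState Ω q f)
      = sampleState Ω q fun x => -(((e * φ x : ℝ) : ℂ) • f x) := by
  ext b
  rw [hamTerm_two, act, sampleState_apply]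
  simp only [mulVec_diagonal, Pi.neg_apply, Pi.smul_apply, sampleState_apply, smul_eq_mul]
  push_cast
  ring

theorem act_hamTerm_three_sampleState (f : Space → SpinIdx → ℂ) :
    act (hamTerm Ω m e φ A q 3) (sampleState Ω q f)
      = sampleState Ω q fun x => ∑ i, diracAlpha i *ᵥ (((e * A x i : ℝ) : ℂ) • f x) := by
  ext b
  rw [hamTerm_three, act, sampleState_apply]
  simp only [localMatrix_mulVec, sampleState_apply, node_congr Ω (gridIdx_withSpin b _),
    spin_withSpin, mulVec_smul, ← smul_mulVec, ← sum_mulVec]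
  rw [mulVec, dotProduct, Finset.mul_sum]
  exact Finset.sum_congr rfl fun a _ => mul_left_comm _ _ _

theorem sampleState_diracHamiltonian (f : Space → SpinIdx → ℂ) :
    sampleState Ω q (diracHamiltonian m e φ A f)
      = act (∑ j, hamTerm Ω m e φ A q j) (sampleState Ω q f)
        + (sampleState Ω q (kineticField f)
          - act (hamTerm Ω m e φ A q 0) (sampleState Ω q f)) := by
  rw [act_sum, Fin.sum_univ_four, act_hamTerm_one_sampleState, act_hamTerm_two_sampleState,
    act_hamTerm_three_sampleState]
  ext b
  simp only [PiLp.add_apply, PiLp.sub_apply, sampleState_apply, diracHamiltonian, kineticField,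
    mulVec_add, Finset.sum_add_distrib, Pi.add_apply, Pi.sub_apply, Pi.neg_apply]
  ring

theorem IsDiracSolution.norm_propagator_sub_le (hΩ : 0 < Ω) (hρ : 0 < ρ)
    (h : IsDiracSolution Ω m e φ A ρ M T ψ) :
    ‖act (propagator (∑ j, hamTerm Ω m e φ A q j) T) (sampleState Ω q (ψ 0))
        - sampleState Ω q (ψ T)‖
      ≤ 28 * Real.pi / Ω * Real.sqrt Ω ^ 3 * M * Real.exp (-(ρ / 4 * 2 ^ q))
        * (∑' p, decayWeight (ρ / 2) p) * |T| := by
  have hH : (∑ j, hamTerm Ω m e φ A q j).IsHermitian := by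
    simp only [IsHermitian, conjTranspose_sum, (hamTerm_isHermitian Ω m e φ A _).eq]
  refine DiracSim.norm_propagator_sub_le hH (v := fun t => sampleState Ω q (ψ t))
    (d := fun t => (-I) • (sampleState Ω q (kineticField (ψ t))
      - act (hamTerm Ω m e φ A q 0) (sampleState Ω q (ψ t)))) (fun t ht => ?_) fun t ht => ?_
  · refine (hasDerivWithinAt_sampleState (h.equation t ht)).congr_deriv ?_
    rw [← smul_add, ← sampleState_diracHamiltonian]
    ext b
    simp only [sampleState_apply, PiLp.smul_apply, Pi.smul_apply, smul_eq_mul]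
    ring
  · rw [norm_smul, norm_neg, norm_I, one_mul]
    exact norm_kinetic_consistency_le hΩ hρ m e φ A (h.analytic t ht) (h.differentiable t ht)

theorem IsDiracSolution.cellNorm_interpolant_sub_le (hΩ : 0 < Ω) (hρ : 0 < ρ)
    (h : IsDiracSolution Ω m e φ A ρ M T ψ) {t : ℝ} (ht : t ∈ Set.uIcc 0 T) :
    cellNorm Ω (interpolant Ω (sampleState Ω q (ψ t)) - ψ t)
      ≤ 130 * Real.sqrt Ω ^ 3 * M * Real.exp (-(ρ / 4 * 2 ^ q))
        * ∑' p, decayWeight (ρ / 2) p := by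
  refine (cellNorm_le_of_norm_le hΩ.le
    ((continuous_interpolant _).sub (h.differentiable t ht).continuous)
    (norm_interpolant_sampleState_sub_le hΩ hρ (h.analytic t ht))).trans_eq ?_
  ring

theorem cellNorm_sub_comm (f g : Space → SpinIdx → ℂ) :
    cellNorm Ω (f - g) = cellNorm Ω (g - f) := by
  simp only [cellNorm, Pi.sub_apply, norm_sub_rev]

theorem IsDiracSolution.abs_norm_sampleState_sub_one_le (hΩ : 0 < Ω) (hρ : 0 < ρ)
    (h : IsDiracSolution Ω m e φ A ρ M T ψ) :
    |‖sampleState Ω q (ψ 0)‖ - 1|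
      ≤ 130 * Real.sqrt Ω ^ 3 * M * Real.exp (-(ρ / 4 * 2 ^ q))
        * ∑' p, decayWeight (ρ / 2) p := by
  have hψ := (h.differentiable 0 Set.left_mem_uIcc).continuous
  have hinterp := continuous_interpolant (Ω := Ω) (sampleState Ω q (ψ 0))
  have hle := cellNorm_add_le (Ω := Ω) (hinterp.sub hψ) hψ
  have hge := cellNorm_add_le (Ω := Ω) (hψ.sub hinterp) hinterp
  rw [sub_add_cancel, cellNorm_interpolant hΩ, h.normalized] at hle hge
  rw [cellNorm_sub_comm] at hge
  refine le_trans ?_ (h.cellNorm_interpolant_sub_le (q := q) hΩ hρ Set.left_mem_uIcc)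
  rw [abs_le]
  constructor <;> linarith

end Duhamel

/-! ## The product-formula circuit -/

section ProductCircuit

open Matrix
open scoped Matrix.Norms.L2Operator

variable {q : ℕ}

theorem circuitMatrix_suzuki_pow (W : Fin 4 → ℝ → Circuit q) (k : ℕ) (t : ℝ) (r : ℕ) :
    circuitMatrix (suzuki W k t ^ r) = suzuki (fun j s => circuitMatrix (W j s)) k t ^ r := by
  rw [circuitMatrix, map_pow, map_suzuki]
  rfl

theorem circuitMatrix_suzuki_pow_mem_unitary {H : Fin 4 → Matrix (Reg q) (Reg q) ℂ}
    (hH : ∀ j, (H j).IsHermitian) {W : Fin 4 → ℝ → Circuit q}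
    (hW : ∀ j s, circuitMatrix (W j s) = propagator (H j) s) (k : ℕ) (t : ℝ) (r : ℕ) :
    circuitMatrix (suzuki W k t ^ r) ∈ unitaryGroup (Reg q) ℂ := by
  rw [circuitMatrix_suzuki_pow]
  refine pow_mem (suzuki_mem (fun j s => ?_) k t) r
  rw [hW]
  exact propagator_mem_unitary (hH j) s

theorem length_suzuki_pow_le {α : Type} {W : Fin 4 → ℝ → FreeMonoid α} {N : ℕ}
    (hW : ∀ j s, (W j s).length ≤ N) (k : ℕ) (t : ℝ) (r : ℕ) :
    ((suzuki W (k + 1) t ^ r).length : ℝ) ≤ r * (8 * 5 ^ k) * N := by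
  rw [length_pow_freeMonoid, mul_assoc]
  exact_mod_cast Nat.mul_le_mul_left r (length_suzuki_le hW k t)

theorem exists_steps_suzuki_circuit {κ V T ε : ℝ} (h : ParameterRegime κ V T ε)
    {H : Fin 4 → Matrix (Reg q) (Reg q) ℂ} (hH : ∀ j, (H j).IsHermitian) {a : ℝ} (ha : 1 ≤ a)
    (hHV : ∑ j, ‖H j‖ ≤ a * V) {W : Fin 4 → ℝ → Circuit q}
    (hW : ∀ j s, circuitMatrix (W j s) = propagator (H j) s) {N : ℕ}
    (hN : ∀ j s, (W j s).length ≤ N) (k : ℕ) :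
    ∃ r : ℕ, 0 < r ∧
      ((suzuki W (k + 1) (T / r) ^ r).length : ℝ)
        ≤ stepConstant κ * a ^ 2 * costScale (k + 1) V T ε * N ∧
      ∀ v : QState q, ‖act (circuitMatrix (suzuki W (k + 1) (T / r) ^ r)) v
        - act (propagator (∑ j, H j) T) v‖ ≤ ε / 4 * ‖v‖ := by
  have hV := h.potential_pos
  have hT := h.abs_time_pos
  obtain ⟨r, hr, hstep, herror, hcount⟩ := exists_steps
    (τ := 3 ^ k * (a * V) * |T|) (by positivity) h.precision_pos
    (Nat.mul_ne_zero two_ne_zero k.succ_ne_zero)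
  refine ⟨r, hr, (length_suzuki_pow_le hN k _ r).trans ?_, fun v => ?_⟩
  · exact mul_le_mul_of_nonneg_right (h.steps_mul_le ha k hcount) N.cast_nonneg
  · rw [← act_sub_left, circuitMatrix_suzuki_pow]
    simp only [hW]
    refine (norm_act_le _ v).trans ?_
    gcongr
    exact (norm_suzuki_pow_sub_propagator_le hH hHV k hr hstep).trans herror

end ProductCircuit

/-! ## Resources for the discretized Dirac Hamiltonian -/

section Resources

open scoped Matrix.Norms.L2Operator

variable {Ω m e : ℝ} {φ : Space → ℝ} {A : Space → Fin 3 → ℝ} {q : ℕ} {c d : ℝ}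

theorem sum_norm_hamTerm_le (hΩ : 0 < Ω) (hφ : ∀ x, |φ x| ≤ c)
    (hA : ∀ x, √(∑ i, A x i ^ 2) ≤ d) :
    ∑ j, ‖hamTerm Ω m e φ A q j‖ ≤ 3 * (Real.pi / Ω * 2 ^ q) + |m| + 3 * |e| * (c + d) := by
  have hcomponent (x) (i) : |A x i| ≤ d :=
    (Real.abs_le_sqrt (Finset.single_le_sum (f := fun i => A x i ^ 2)
      (fun i _ => sq_nonneg _) (Finset.mem_univ i))).trans (hA x)
  have hc : 0 ≤ |e| * c := mul_nonneg (abs_nonneg e) ((abs_nonneg _).trans (hφ 0))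
  rw [Fin.sum_univ_four]
  linarith [norm_hamTerm_zero_le (q := q) Ω m e φ A hΩ, norm_hamTerm_one_le (q := q) Ω m e φ A,
    norm_hamTerm_two_le (q := q) (A := A) Ω m e hφ,
    norm_hamTerm_three_le (q := q) (φ := φ) Ω m e hcomponent]

/-- With `B log (2 + |T| / ε)` grid points per direction and potentials of strength `V`, the terms
of the discretized Hamiltonian have total norm at most
`hamiltonianConstant Ω m e κ B * log (2 + |T| / ε) * V`. The last summand makes
`hamiltonianConstant Ω m e κ B * log (2 + |T| / ε)` at least `1`. -/
def hamiltonianConstant (Ω m e κ B : ℝ) : ℝ :=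
  3 * Real.pi * B / (Ω * κ) + |m| / (κ * Real.log 2) + 3 * |e| / Real.log 2 + 1 / Real.log 2

theorem hamiltonianConstant_pos {κ B : ℝ} (hΩ : 0 < Ω) (hκ : 0 < κ) (hB : 0 < B) :
    0 < hamiltonianConstant Ω m e κ B := by
  have := Real.log_pos one_lt_two
  unfold hamiltonianConstant
  positivity

theorem one_le_hamiltonianConstant_mul_log {κ B x : ℝ} (hΩ : 0 < Ω) (hκ : 0 < κ) (hB : 0 < B)
    (hx : 0 ≤ x) : 1 ≤ hamiltonianConstant Ω m e κ B * Real.log (2 + x) := by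
  have hlog : 0 < Real.log 2 := Real.log_pos one_lt_two
  have hlog' : 0 < Real.log (2 + x) := hlog.trans_le (log_two_le_log_two_add hx)
  refine (le_div_log_two_mul_log zero_le_one hx).trans ?_
  gcongr
  exact le_add_of_nonneg_left (by positivity)

theorem sum_norm_hamTerm_le_mul_log {κ B x : ℝ} (hΩ : 0 < Ω) (hκ : 0 < κ) (hx : 0 ≤ x)
    (hq : 2 ^ q ≤ B * Real.log (2 + x)) (hφ : ∀ x, |φ x| ≤ c)
    (hA : ∀ x, √(∑ i, A x i ^ 2) ≤ d) (hV : κ ≤ c + d) :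
    ∑ j, ‖hamTerm Ω m e φ A q j‖
      ≤ hamiltonianConstant Ω m e κ B * Real.log (2 + x) * (c + d) := by
  have hlog : 0 < Real.log 2 := Real.log_pos one_lt_two
  have hV₀ : 0 < c + d := hκ.trans_le hV
  refine (sum_norm_hamTerm_le hΩ hφ hA).trans ?_
  have hBℓ : 0 < B * Real.log (2 + x) := hq.trans_lt' (by positivity)
  have hmℓ := le_div_log_two_mul_log (abs_nonneg m) hx
  have heℓ := le_div_log_two_mul_log (mul_nonneg (zero_le_three (α := ℝ)) (abs_nonneg e)) hx
  have hℓ : 0 < Real.log (2 + x) := hlog.trans_le (log_two_le_log_two_add hx)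
  set ℓ := Real.log (2 + x)
  have hkinetic : 3 * (Real.pi / Ω * 2 ^ q) ≤ 3 * Real.pi * B / (Ω * κ) * ℓ * (c + d) :=
    calc 3 * (Real.pi / Ω * 2 ^ q) ≤ 3 * (Real.pi / Ω * (B * ℓ)) := by gcongr
      _ = 3 * Real.pi * (B * ℓ) / (Ω * κ) * κ := by field_simp
      _ ≤ 3 * Real.pi * (B * ℓ) / (Ω * κ) * (c + d) := by gcongr
      _ = 3 * Real.pi * B / (Ω * κ) * ℓ * (c + d) := by ring
  have hmass : |m| ≤ |m| / (κ * Real.log 2) * ℓ * (c + d) :=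
    calc |m| ≤ |m| / Real.log 2 * ℓ := hmℓ
      _ = |m| / (κ * Real.log 2) * ℓ * κ := by field_simp
      _ ≤ |m| / (κ * Real.log 2) * ℓ * (c + d) := by gcongr
  have hpotential : 3 * |e| * (c + d) ≤ 3 * |e| / Real.log 2 * ℓ * (c + d) := by gcongr
  have hslack : 0 ≤ 1 / Real.log 2 * ℓ * (c + d) := by positivity
  unfold hamiltonianConstant
  linarith

theorem exists_circuits_hamTerm (Ω m e : ℝ) (φ : Space → ℝ) (A : Space → Fin 3 → ℝ) (q : ℕ) :
    ∃ W : Fin 4 → ℝ → Circuit q,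
      (∀ j s, circuitMatrix (W j s) = propagator (hamTerm Ω m e φ A q j) s) ∧
      (∀ j s, (W j s).length ≤ 4864 * (2 ^ q) ^ 12) ∧ ∀ s, (W 1 s).length ≤ 1 := by
  have hterm : ∀ (j : Fin 4) (s : ℝ), ∃ c : Circuit q,
      circuitMatrix c = propagator (hamTerm Ω m e φ A q j) s ∧
      c.length ≤ 4864 * (2 ^ q) ^ 12 ∧ (j = 1 → c.length ≤ 1) := by
    intro j s
    by_cases hj : j = 1
    · subst hj
      obtain ⟨-, c, hc, hlength⟩ := implementable_propagator_mass (q := q) Ω m e φ A s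
      exact ⟨c, hc, hlength.trans (Nat.succ_le_of_lt (by positivity)), fun _ => hlength⟩
    · obtain ⟨-, c, hc, hlength⟩ :=
        implementable_propagator (hamTerm_isHermitian (q := q) Ω m e φ A j) s
      exact ⟨c, hc, hlength.trans_eq (by ring), fun h => absurd h hj⟩
  choose W hmatrix hlength hmass using hterm
  exact ⟨W, hmatrix, hlength, fun s => hmass 1 s rfl⟩

end Resources

/-! ## Accuracy on solutions of the Dirac equation -/

section Accuracy

open Matrix

variable {Ω : ℝ} {q : ℕ}

theorem norm_initialState {f : Space → SpinIdx → ℂ} (hf : sampleState Ω q f ≠ 0) :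
    ‖initialState Ω q f‖ = 1 := by
  rw [initialState, norm_smul, norm_real, norm_inv, norm_norm,
    inv_mul_cancel₀ (norm_ne_zero_iff.2 hf)]

theorem norm_initialState_sub_sampleState {f : Space → SpinIdx → ℂ}
    (hf : sampleState Ω q f ≠ 0) :
    ‖initialState Ω q f - sampleState Ω q f‖ = |‖sampleState Ω q f‖ - 1| := by
  have hpos : 0 < ‖sampleState Ω q f‖ := norm_pos_iff.2 hf
  have hscale : initialState Ω q f - sampleState Ω q f
      = ((‖sampleState Ω q f‖⁻¹ - 1 : ℝ) : ℂ) • sampleState Ω q f := by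
    rw [initialState, ofReal_sub, sub_smul, ofReal_one, one_smul]
  rw [hscale, norm_smul, norm_real, Real.norm_eq_abs, ← abs_norm (sampleState Ω q f), ← abs_mul,
    abs_norm, sub_mul, inv_mul_cancel₀ hpos.ne', one_mul, abs_sub_comm]

theorem interpolant_sub (v w : QState q) :
    interpolant Ω (v - w) = interpolant Ω v - interpolant Ω w := by
  classical
  funext x a
  simp only [interpolant, Pi.sub_apply, act_sub, PiLp.sub_apply, sub_mul, ← mul_sub,
    ← Finset.sum_sub_distrib]
  congr 1
  refine Finset.sum_congr rfl fun b _ => ?_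
  split_ifs <;> simp

/-- On `2 ^ q` grid points per direction, with decay constants `ρ` and `M`, the errors of sampling
and of the discretized evolution up to time `T` add up to at most
`discretizationConstant Ω ρ M * exp (-(ρ / 4 * 2 ^ q)) * (1 + |T|)`. The summand `1` makes the
constant positive. -/
def discretizationConstant (Ω ρ M : ℝ) : ℝ :=
  (28 * Real.pi / Ω + 130) * √Ω ^ 3 * |M| * (∑' p, decayWeight (ρ / 2) p) + 1

theorem discretizationConstant_pos (hΩ : 0 < Ω) (ρ M : ℝ) : 0 < discretizationConstant Ω ρ M := by
  have : 0 ≤ ∑' p, decayWeight (ρ / 2) p := tsum_nonneg (decayWeight_nonneg _)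
  unfold discretizationConstant
  positivity

theorem sampling_add_evolution_error_le (hΩ : 0 < Ω) (ρ M T : ℝ) {E : ℝ} (hE : 0 ≤ E) :
    130 * √Ω ^ 3 * M * E * (∑' p, decayWeight (ρ / 2) p)
        + 28 * Real.pi / Ω * √Ω ^ 3 * M * E * (∑' p, decayWeight (ρ / 2) p) * |T|
      ≤ discretizationConstant Ω ρ M * E * (1 + |T|) := by
  have hD : 0 ≤ ∑' p, decayWeight (ρ / 2) p := tsum_nonneg (decayWeight_nonneg _)
  unfold discretizationConstant
  set D := ∑' p, decayWeight (ρ / 2) p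
  have hsampling : 0 ≤ 130 * √Ω ^ 3 * |M| * E * D * |T| := by positivity
  have hevolution : 0 ≤ 28 * Real.pi / Ω * √Ω ^ 3 * |M| * E * D := by positivity
  have hslack : 0 ≤ E * (1 + |T|) := by positivity
  calc 130 * √Ω ^ 3 * M * E * D + 28 * Real.pi / Ω * √Ω ^ 3 * M * E * D * |T|
      ≤ 130 * √Ω ^ 3 * |M| * E * D + 28 * Real.pi / Ω * √Ω ^ 3 * |M| * E * D * |T| := by
        gcongr <;> exact le_abs_self M
    _ ≤ ((28 * Real.pi / Ω + 130) * √Ω ^ 3 * |M| * D + 1) * E * (1 + |T|) := by linarith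

variable {m e ρ M T δ η : ℝ} {φ : Space → ℝ} {A : Space → Fin 3 → ℝ}
  {ψ : ℝ → Space → SpinIdx → ℂ}

theorem IsDiracSolution.sampleState_ne_zero (hΩ : 0 < Ω) (hρ : 0 < ρ)
    (h : IsDiracSolution Ω m e φ A ρ M T ψ)
    (hq : discretizationConstant Ω ρ M * Real.exp (-(ρ / 4 * 2 ^ q)) * (1 + |T|) < 1) :
    sampleState Ω q (ψ 0) ≠ 0 := by
  intro hzero
  have hnorm := h.abs_norm_sampleState_sub_one_le (q := q) hΩ hρ
  have hevolution := (norm_nonneg _).trans (h.norm_propagator_sub_le (q := q) hΩ hρ)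
  have herror := sampling_add_evolution_error_le hΩ ρ M T (Real.exp_pos (-(ρ / 4 * 2 ^ q))).le
  rw [hzero, norm_zero, zero_sub, abs_neg, abs_one] at hnorm
  linarith

theorem IsDiracSolution.norm_act_initialState_sub_le (hΩ : 0 < Ω) (hρ : 0 < ρ)
    (h : IsDiracSolution Ω m e φ A ρ M T ψ) (hδ : δ < 1)
    (hq : discretizationConstant Ω ρ M * Real.exp (-(ρ / 4 * 2 ^ q)) * (1 + |T|) ≤ δ)
    {U : Matrix (Reg q) (Reg q) ℂ}
    (hU : ∀ v : QState q,
      ‖act U v - act (propagator (∑ j, hamTerm Ω m e φ A q j) T) v‖ ≤ η * ‖v‖) :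
    ‖act U (initialState Ω q (ψ 0)) - sampleState Ω q (ψ T)‖ ≤ η + δ := by
  have hne := h.sampleState_ne_zero hΩ hρ (hq.trans_lt hδ)
  have hHermitian : (∑ j, hamTerm Ω m e φ A q j).IsHermitian := by
    simp only [IsHermitian, conjTranspose_sum,
      fun j => (hamTerm_isHermitian (q := q) Ω m e φ A j).eq]
  have hsimulation := hU (initialState Ω q (ψ 0))
  rw [norm_initialState hne, mul_one] at hsimulation
  set Z := propagator (∑ j, hamTerm Ω m e φ A q j) T
  have hnormalization : ‖act Z (initialState Ω q (ψ 0)) - act Z (sampleState Ω q (ψ 0))‖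
      = |‖sampleState Ω q (ψ 0)‖ - 1| := by
    rw [← act_sub, norm_act_of_unitary (propagator_mem_unitary hHermitian T),
      norm_initialState_sub_sampleState hne]
  have hsampling := h.abs_norm_sampleState_sub_one_le (q := q) hΩ hρ
  have hevolution := h.norm_propagator_sub_le (q := q) hΩ hρ
  have herror := sampling_add_evolution_error_le hΩ ρ M T (Real.exp_pos (-(ρ / 4 * 2 ^ q))).le
  have htriangle := (norm_sub_le_norm_sub_add_norm_sub (act U (initialState Ω q (ψ 0)))
    (act Z (initialState Ω q (ψ 0))) (sampleState Ω q (ψ T))).trans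
    (add_le_add_right (norm_sub_le_norm_sub_add_norm_sub (act Z (initialState Ω q (ψ 0)))
      (act Z (sampleState Ω q (ψ 0))) (sampleState Ω q (ψ T))) _)
  linarith

theorem IsDiracSolution.cellNorm_interpolant_act_sub_le (hΩ : 0 < Ω) (hρ : 0 < ρ)
    (h : IsDiracSolution Ω m e φ A ρ M T ψ) (hδ : δ < 1)
    (hq : discretizationConstant Ω ρ M * Real.exp (-(ρ / 4 * 2 ^ q)) * (1 + |T|) ≤ δ)
    {U : Matrix (Reg q) (Reg q) ℂ}
    (hU : ∀ v : QState q,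
      ‖act U v - act (propagator (∑ j, hamTerm Ω m e φ A q j) T) v‖ ≤ η * ‖v‖) :
    cellNorm Ω (interpolant Ω (act U (initialState Ω q (ψ 0))) - ψ T) ≤ η + 2 * δ := by
  have hstate := h.norm_act_initialState_sub_le hΩ hρ hδ hq hU
  have hinterpolation := h.cellNorm_interpolant_sub_le (q := q) hΩ hρ Set.right_mem_uIcc
  have hevolution := (norm_nonneg _).trans (h.norm_propagator_sub_le (q := q) hΩ hρ)
  have herror := sampling_add_evolution_error_le hΩ ρ M T (Real.exp_pos (-(ρ / 4 * 2 ^ q))).le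
  have htriangle := cellNorm_add_le (Ω := Ω) (continuous_interpolant (Ω := Ω)
      (act U (initialState Ω q (ψ 0)) - sampleState Ω q (ψ T)))
    ((continuous_interpolant (Ω := Ω) (sampleState Ω q (ψ T))).sub
      (h.differentiable T Set.right_mem_uIcc).continuous)
  rw [cellNorm_interpolant hΩ, interpolant_sub, sub_add_sub_cancel] at htriangle
  linarith

end Accuracy

/-! ## The complexity bound -/

theorem exists_gate_count_constant {κ B K c : ℝ} (hκ : 0 < κ) (hB : 0 < B) (hK : 0 < K)
    (hc : 0 < c) :
    ∃ C : ℝ, 0 < C ∧ B ≤ C ∧ ∀ (q : ℕ) (ℓ : ℝ), Real.log 2 ≤ ℓ → 2 ^ q ≤ B * ℓ →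
      4864 * ((2 : ℝ) ^ q) ^ 12 ≤ C * ℓ ^ 28 ∧
      ∀ g l : ℝ, 0 < g → ℓ ≤ K * l ^ 2 →
        stepConstant κ * (c * ℓ) ^ 2 * g * (4864 * (2 ^ q) ^ 12) ≤ C * g * l ^ 28 := by
  have hlog : 0 < Real.log 2 := Real.log_pos one_lt_two
  have hstep : 0 < stepConstant κ := by
    unfold stepConstant
    positivity
  set L := 4864 * B ^ 12 with hL
  set F := stepConstant κ * c ^ 2
  have hsingle : 0 < L / Real.log 2 ^ 16 := by positivity
  have htotal : 0 < F * L * K ^ 14 := by positivity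
  refine ⟨B + L / Real.log 2 ^ 16 + F * L * K ^ 14, by positivity, by linarith,
    fun q ℓ hℓ hq => ?_⟩
  have hℓ₀ : 0 < ℓ := hlog.trans_le hℓ
  have hN : 4864 * ((2 : ℝ) ^ q) ^ 12 ≤ L * ℓ ^ 12 := by
    rw [hL, mul_assoc, ← mul_pow]
    gcongr
  refine ⟨?_, fun g l hg hl => ?_⟩
  · calc 4864 * ((2 : ℝ) ^ q) ^ 12 ≤ L * ℓ ^ 12 := hN
      _ = L / Real.log 2 ^ 16 * (ℓ ^ 12 * Real.log 2 ^ 16) := by field_simp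
      _ ≤ L / Real.log 2 ^ 16 * (ℓ ^ 12 * ℓ ^ 16) := by gcongr
      _ = L / Real.log 2 ^ 16 * ℓ ^ 28 := by ring
      _ ≤ (B + L / Real.log 2 ^ 16 + F * L * K ^ 14) * ℓ ^ 28 := by
        gcongr
        linarith
  · calc stepConstant κ * (c * ℓ) ^ 2 * g * (4864 * (2 ^ q) ^ 12)
        ≤ stepConstant κ * (c * ℓ) ^ 2 * g * (L * ℓ ^ 12) := by gcongr
      _ = F * L * g * ℓ ^ 14 := by ring
      _ ≤ F * L * g * (K * l ^ 2) ^ 14 := by gcongr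
      _ = F * L * K ^ 14 * g * l ^ 28 := by ring
      _ ≤ (B + L / Real.log 2 ^ 16 + F * L * K ^ 14) * g * l ^ 28 := by
        gcongr
        linarith

theorem ParameterRegime.tolerance_le {κ V T ε : ℝ} (h : ParameterRegime κ V T ε) :
    min (1 / 4) (κ / 2) * ε ≤ ε / 4 := by
  have := mul_le_mul_of_nonneg_right (min_le_left (1 / 4) (κ / 2)) h.precision_pos.le
  linarith

theorem ParameterRegime.tolerance_lt_one {κ V T ε : ℝ} (h : ParameterRegime κ V T ε) :
    min (1 / 4) (κ / 2) * ε < 1 := by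
  have hκ := h.pos
  calc min (1 / 4) (κ / 2) * ε ≤ κ / 2 * (1 / κ) :=
        mul_le_mul (min_le_right _ _) h.precision_le h.precision_pos.le (by positivity)
    _ < 1 := by
      field_simp
      norm_num

theorem mainTheorem1_general (Ω m e ρ M κ : ℝ) (hΩ : 0 < Ω) (hρ : 0 < ρ) (hκ : 0 < κ) :
    ∃ (C : ℝ) (a : ℕ), 0 < C ∧
      ∀ (φ : Space → ℝ) (A : Space → Fin 3 → ℝ) (k : ℕ) (T ε : ℝ),
        BddAbove (Set.range fun x => |φ x|) →
        BddAbove (Set.range fun x => √(∑ i, A x i ^ 2)) →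
        1 ≤ k → κ ≤ scalarMax φ + vectorMax A → κ ≤ |T| → 0 < ε → ε ≤ 1 / κ →
        ∃ (q r : ℕ) (W : Fin 4 → ℝ → Circuit q) (circ : Circuit q),
          (2 : ℝ) ^ q ≤ C * Real.log (2 + |T| / ε) ∧
          (∀ j s, circuitMatrix (W j s) = propagator (hamTerm Ω m e φ A q j) s) ∧
          (∀ j s, ((W j s).length : ℝ) ≤ C * Real.log (2 + |T| / ε) ^ a) ∧
          (∀ s, (W 1 s).length ≤ 1) ∧
          0 < r ∧ circ = suzuki W k (T / r) ^ r ∧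
          (circ.length : ℝ) ≤
            C * costScale k (scalarMax φ + vectorMax A) T ε *
              Real.log (2 + costScale k (scalarMax φ + vectorMax A) T ε) ^ a ∧
          (∀ v : QState q,
            ‖act (circuitMatrix circ) v - act (propagator (∑ j, hamTerm Ω m e φ A q j) T) v‖
              ≤ ε * ‖v‖) ∧
          ∀ ψ : ℝ → Space → SpinIdx → ℂ, IsDiracSolution Ω m e φ A ρ M T ψ →
            ‖act (circuitMatrix circ) (initialState Ω q (ψ 0))‖ = 1 ∧
            ‖act (circuitMatrix circ) (initialState Ω q (ψ 0)) - sampleState Ω q (ψ T)‖ ≤ ε ∧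
            cellNorm Ω
              (interpolant Ω (act (circuitMatrix circ) (initialState Ω q (ψ 0))) - ψ T) ≤ ε := by
  obtain ⟨B, hB, hgrid⟩ := exists_grid_size (δ := ρ / 4) (c := min (1 / 4) (κ / 2))
    (by positivity) hκ (discretizationConstant_pos hΩ ρ M) (by positivity)
  obtain ⟨K, hK, hlog⟩ := exists_log_le_log_costScale_sq hκ
  obtain ⟨C, hC, hBC, hcost⟩ := exists_gate_count_constant hκ hB hK
    (hamiltonianConstant_pos (m := m) (e := e) hΩ hκ hB)
  refine ⟨C, 28, hC, fun φ A k T ε hφ hA hk hV hT hε hε' => ?_⟩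
  obtain ⟨k, rfl⟩ := Nat.exists_eq_add_of_le' hk
  have h : ParameterRegime κ (scalarMax φ + vectorMax A) T ε := ⟨hκ, hV, hT, hε, hε'⟩
  have hx : 0 ≤ |T| / ε := by positivity
  obtain ⟨q, hq, hgrid⟩ := hgrid T ε hT hε
  obtain ⟨W, hW, hN, hmass⟩ := exists_circuits_hamTerm Ω m e φ A q
  have hHermitian := hamTerm_isHermitian (q := q) Ω m e φ A
  obtain ⟨r, hr, hlength, hsim⟩ := exists_steps_suzuki_circuit h hHermitian
    (one_le_hamiltonianConstant_mul_log hΩ hκ hB hx)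
    (sum_norm_hamTerm_le_mul_log hΩ hκ hx hq (le_ciSup hφ) (le_ciSup hA) hV) hW hN k
  obtain ⟨hsingle, htotal⟩ := hcost q _ (log_two_le_log_two_add hx) hq
  have hunitary := circuitMatrix_suzuki_pow_mem_unitary hHermitian hW (k + 1) (T / r) r
  push_cast at hlength
  refine ⟨q, r, W, _, hq.trans (mul_le_mul_of_nonneg_right hBC (Real.log_nonneg (by linarith))), hW,
    fun j s => le_trans (by exact_mod_cast hN j s) hsingle, hmass, hr, rfl,
    hlength.trans (htotal _ _ (h.costScale_pos (k + 1)) (hlog h k.succ_ne_zero)),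
    fun v => (hsim v).trans (by gcongr; linarith), fun ψ hψ => ⟨?_, ?_, ?_⟩⟩
  · rw [norm_act_of_unitary hunitary,
      norm_initialState (hψ.sampleState_ne_zero hΩ hρ (hgrid.trans_lt h.tolerance_lt_one))]
  · linarith [hψ.norm_act_initialState_sub_le hΩ hρ h.tolerance_lt_one hgrid hsim, h.tolerance_le]
  · linarith [hψ.cellNorm_interpolant_act_sub_le hΩ hρ h.tolerance_lt_one hgrid hsim,
      h.tolerance_le]

theorem bddAbove_range_abs {Ω : ℝ} (hΩ : 0 < Ω) {φ : Space → ℝ} (hφ : Periodic3 Ω φ)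
    (hc : Continuous φ) : BddAbove (Set.range fun x => |φ x|) :=
  Periodic3.bddAbove_range hΩ (fun x i => congrArg _ (hφ x i)) hc.abs

theorem bddAbove_range_sqrt_sum_sq {Ω : ℝ} (hΩ : 0 < Ω) {A : Space → Fin 3 → ℝ}
    (hA : Periodic3 Ω A) (hc : Continuous A) :
    BddAbove (Set.range fun x => √(∑ i, A x i ^ 2)) :=
  Periodic3.bddAbove_range hΩ (fun x i => congrArg (fun v => √(∑ i, v i ^ 2)) (hA x i))
    (by fun_prop)

end DiracSim

end

open DiracSim in
theorem mainTheorem1 (Ω m e ρ M κ : ℝ) (hΩ : 0 < Ω) (hρ : 0 < ρ) (hκ : 0 < κ) :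
    ∃ (C : ℝ) (a : ℕ), 0 < C ∧
      ∀ (φ : Space → ℝ) (A : Space → Fin 3 → ℝ) (k : ℕ) (T ε : ℝ),
        Continuous φ → Periodic3 Ω φ → Continuous A → Periodic3 Ω A →
        1 ≤ k → κ ≤ scalarMax φ + vectorMax A → κ ≤ |T| → 0 < ε → ε ≤ 1 / κ →
        ∃ (q r : ℕ) (W : Fin 4 → ℝ → Circuit q) (circ : Circuit q),
          -- the number of grid points per direction
          (2 : ℝ) ^ q ≤ C * Real.log (2 + |T| / ε) ∧
          -- circuits for the four exponentials, and their gate counts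
          (∀ j s, circuitMatrix (W j s) = propagator (hamTerm Ω m e φ A q j) s) ∧
          (∀ j s, ((W j s).length : ℝ) ≤ C * Real.log (2 + |T| / ε) ^ a) ∧
          (∀ s, (W 1 s).length ≤ 1) ∧
          -- the circuit is the product formula of order `2k` with `r` time steps
          0 < r ∧ circ = suzuki W k (T / r) ^ r ∧
          -- its gate count
          (circ.length : ℝ) ≤
            C * costScale k (scalarMax φ + vectorMax A) T ε *
              Real.log (2 + costScale k (scalarMax φ + vectorMax A) T ε) ^ a ∧
          -- it approximates the evolution generated by the discretized Hamiltonian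
          (∀ v : QState q,
            ‖act (circuitMatrix circ) v - act (propagator (∑ j, hamTerm Ω m e φ A q j) T) v‖
              ≤ ε * ‖v‖) ∧
          -- it maps the encoded initial state to a normalized state approximating `ψ(T)`
          ∀ ψ : ℝ → Space → SpinIdx → ℂ, IsDiracSolution Ω m e φ A ρ M T ψ →
            ‖act (circuitMatrix circ) (initialState Ω q (ψ 0))‖ = 1 ∧
            ‖act (circuitMatrix circ) (initialState Ω q (ψ 0)) - sampleState Ω q (ψ T)‖ ≤ ε ∧
            cellNorm Ω
              (interpolant Ω (act (circuitMatrix circ) (initialState Ω q (ψ 0))) - ψ T) ≤ ε := by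
  obtain ⟨C, a, hC, h⟩ := mainTheorem1_general Ω m e ρ M κ hΩ hρ hκ
  exact ⟨C, a, hC, fun φ A k T ε hφ hφp hA hAp => h φ A k T ε (bddAbove_range_abs hΩ hφp hφ)
    (bddAbove_range_sqrt_sum_sq hΩ hAp hA)⟩
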